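/- **Theorem 1.** Let $\mathcal N\in\{2,3\}$ and let $\Omega\subset\mathbb R^{\mathcal N}$ be a nonempty bounded convex domain which, up to a null set, is the union of pairwise disjoint open subsets $\Omega_1,\dots,\Omega_K$; let $\partial\Omega=\partial\Omega_T\cup\partial\Omega_q$ with measurable parts. For each $s$ let $k^s=(k^s_{ij}(\mathbf y))$ be a measurable symmetric matrix field on $\mathbb R^{\mathcal N}$, $1$-periodic in every variable, with $\gamma_0|\xi|^2\le k^s_{ij}(\mathbf y)\xi_i\xi_j\le\gamma_1|\xi|^2$ for almost every $\mathbf y$ and all $\xi$, where $0<\gamma_0\le\gamma_1$ are constants. Let $h\in L^2(\Omega)$, $\widehat T\in L^2(\partial\Omega_T)$, $\bar q\in L^2(\partial\Omega_q)$. For $\varepsilon=(\varepsilon_1,\dots,\varepsilon_K)$, $\varepsilon_s>0$, put $k^\varepsilon_{ij}(\mathbf x)=k^s_{ij}(\mathbf x/\varepsilon_s)$ for $\mathbf x\in\Omega_s$, and consider the heat conduction problem $$-\frac{\partial}{\partial x_i}\Big(k^\varepsilon_{ij}\frac{\partial T^\varepsilon}{\partial x_j}\Big)=h\ \text{ in }\Omega,\qquad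 T^\varepsilon=\widehat T\ \text{ on }\partial\Omega_T,\qquad k^\varepsilon_{ij}\frac{\partial T^\varepsilon}{\partial x_j}n_i=\bar q\ \text{ on }\partial\Omega_q .\tag{P$_\varepsilon$}$$ (Repeated indices are summed; solutions are weak $H^1$ solutions.) Let $Q=(0,1)^{\mathcal N}$. Then the following hold. 1. *Cell functions.* For every $s$ and all $\alpha,\beta$ there are unique weak solutions $M^s_\alpha,M^s_{\alpha\beta}\in H^1_0(Q)$ of $$\frac{\partial}{\partial y_i}\Big(k^s_{ij}\frac{\partial M^s_{\alpha}}{\partial y_j}\Big)=-\frac{\partial k^s_{i\alpha}}{\partial y_i}\ \text{ in }Q,$$ $$\frac{\partial}{\partial y_i}\Big(k^s_{ij}\frac{\partial M^s_{\alpha\beta}}{\partial y_j}\Big)=\widehat k^s_{\alpha\beta}-k^s_{\alpha\beta}-\frac{\partial}{\partial y_i}\big(k^s_{i\beta}M^s_{\alpha}\big)-k^s_{\alpha j}\frac{\partial M^s_{\beta}}{\partial y_j}\ \text{ in }Q,$$ where $\widehat k^s_{ij}=\frac1{|Q|}\int_Q\big(k^s_{ij}+k^s_{i\alpha}\,\partial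 M^s_j/\partial y_\alpha\big)\,d\mathbf y$. The constant matrices $\widehat k^s$ are symmetric and satisfy $\gamma_0|\xi|^2\le\widehat k^s_{ij}\xi_i\xi_j\le\gamma_1|\xi|^2$ for all $\xi$. 2. *Formal expansion.* Let $T^{(0)}$ be a weak solution of the homogenized problem, i.e. of (P$_\varepsilon$) with $k^\varepsilon$ replaced by the piecewise constant coefficient equal to $\widehat k^s$ on $\Omega_s$. Then in each $\Omega_s$ the problem has the second-order two-scale expansion $$T^\varepsilon\cong T^{(2\varepsilon)}:=T^{(0)}+\varepsilon_sM^s_{\alpha}(\mathbf y^s)\frac{\partial T^{(0)}}{\partial x_\alpha}+\varepsilon_s^2M^s_{\alpha\beta}(\mathbf y^s)\frac{\partial^2T^{(0)}}{\partial x_\alpha\partial x_\beta},\qquad \mathbf y^s=\mathbf x/\varepsilon_s,$$ in the formal sense: $T^{(0)}$ has second weak derivatives in $L^2_{\rm loc}(\Omega_s)$, and, with $T^{(1)}(\mathbf x,\mathbf y)=M^s_\alpha(\mathbf y)\,\partial T^{(0)}/\partial x_\alpha$ and $T^{(2)}(\mathbf x,\mathbf y)=M^s_{\alpha\beta}(\mathbf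 y)\,\partial^2T^{(0)}/\partial x_\alpha\partial x_\beta$, when $\partial/\partial x_i$ is replaced by $\partial/\partial x_i+\varepsilon_s^{-1}\partial/\partial y_i$ and $T^{(0)}+\varepsilon_sT^{(1)}+\varepsilon_s^2T^{(2)}$ is inserted in the heat equation, the terms of orders $\varepsilon_s^{-2}$, $\varepsilon_s^{-1}$ and $\varepsilon_s^{0}$ match, as distributions on $\Omega_s\times Q$. 3. *Truncation.* Extend the cell functions $1$-periodically from $Q$. If moreover $T^{(0)}\in C^3(\Omega_s)$, then $T^{(2\varepsilon)}$ has a weak gradient in $\Omega_s$ and satisfies the heat equation inside the cells up to $O(\varepsilon_s)$: for every compact $B\subset\Omega_s$ there is a constant $C$, independent of $\varepsilon$, such that, if $\varepsilon_s\le1$, for every $\varphi\in C_c^\infty$ with support in $B$ and in the union of the open cells $\varepsilon_s(\mathbf z+Q)$, $\mathbf z\in\mathbb Z^{\mathcal N}$, $$\Big|\int_{\Omega_s}k^\varepsilon_{ij}\frac{\partial T^{(2\varepsilon)}}{\partial x_j}\frac{\partial\varphi}{\partial x_i}\,d\mathbf x-\int_{\Omega_s}h\varphi\,d\mathbf x\Big|\le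 C\varepsilon_s\big(\|\varphi\|_{L^2}+\varepsilon_s\|\nabla\varphi\|_{L^2}\big),$$ and, for every weak solution $T^\varepsilon$ of (P$_\varepsilon$), $$\Big|\int_{\Omega_s}k^\varepsilon_{ij}\frac{\partial (T^\varepsilon-T^{(2\varepsilon)})}{\partial x_j}\frac{\partial\varphi}{\partial x_i}\,d\mathbf x\Big|\le C\varepsilon_s\big(\|\varphi\|_{L^2}+\varepsilon_s\|\nabla\varphi\|_{L^2}\big).$$ -/

import Mathlib

open MeasureTheory Filter Topology Set
open scoped ContDiff

noncomputable section

/-- `ℝᴺ` with its Euclidean norm. -/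
abbrev Space (N : ℕ) : Type := EuclideanSpace ℝ (Fin N)

/-- `φ ∈ C_c^∞(U)`. -/
structure IsTestFunction {E : Type*} [NormedAddCommGroup E] [NormedSpace ℝ E]
    (U : Set E) (φ : E → ℝ) : Prop where
  smooth : ContDiff ℝ ∞ φ
  compact : HasCompactSupport φ
  support_subset : tsupport φ ⊆ U

/-- `g` is the weak derivative of `u` in the direction `v` on the open set `U`. -/
structure HasWeakDeriv {E : Type*} [NormedAddCommGroup E] [NormedSpace ℝ E] [MeasureSpace E]
    (U : Set E) (v : E) (u g : E → ℝ) : Prop where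
  locallyIntegrable : LocallyIntegrableOn u U
  locallyIntegrable_deriv : LocallyIntegrableOn g U
  integral_eq : ∀ φ : E → ℝ, IsTestFunction U φ →
    ∫ x in U, u x * fderiv ℝ φ x v = -∫ x in U, g x * φ x

variable {N : ℕ}

/-- The unit vector `e_i`. -/
def unitVec (i : Fin N) : Space N := EuclideanSpace.single i 1

/-- The classical partial derivative `∂φ/∂x_i`. -/
def partialDeriv (i : Fin N) (φ : Space N → ℝ) (x : Space N) : ℝ := fderiv ℝ φ x (unitVec i)

/-- `g` is the weak gradient of `u` on the open set `U`. -/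
def HasWeakGrad (U : Set (Space N)) (u : Space N → ℝ) (g : Space N → Fin N → ℝ) : Prop :=
  ∀ i, HasWeakDeriv U (unitVec i) u (fun x => g x i)

/-! ### Function spaces and boundary value problems -/

/-- `u ∈ H¹₀(U)` with weak gradient `g`: the closure of `C_c^∞(U)` in the `H¹` norm. -/
structure MemH10 (U : Set (Space N)) (u : Space N → ℝ) (g : Space N → Fin N → ℝ) : Prop where
  memLp : MemLp u 2 (volume.restrict U)
  memLp_grad : ∀ i, MemLp (fun x => g x i) 2 (volume.restrict U)
  approx : ∃ φ : ℕ → Space N → ℝ, (∀ n, IsTestFunction U (φ n)) ∧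
    Tendsto (fun n => eLpNorm (fun x => φ n x - u x) 2 (volume.restrict U)) atTop (𝓝 0) ∧
    ∀ i, Tendsto (fun n => eLpNorm (fun x => partialDeriv i (φ n) x - g x i) 2
      (volume.restrict U)) atTop (𝓝 0)

/-- The surface measure in `ℝᴺ`: the `(N-1)`-dimensional Hausdorff measure, normalised so that it
agrees with Lebesgue measure on hyperplanes. -/
def surfaceMeasure (N : ℕ) : Measure (Space N) := Measure.euclideanHausdorffMeasure (N - 1)

/-- `u ∈ H¹(Ω)` with weak gradient `g` and boundary trace `t ∈ L²(∂Ω)`, for a bounded Lipschitz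
domain `Ω`: smooth functions converge to `u` in `H¹(Ω)` and their boundary values converge to `t`
in `L²(∂Ω)`. -/
structure MemH1Trace (Ω : Set (Space N)) (u : Space N → ℝ) (g : Space N → Fin N → ℝ)
    (t : Space N → ℝ) : Prop where
  memLp : MemLp u 2 (volume.restrict Ω)
  memLp_grad : ∀ i, MemLp (fun x => g x i) 2 (volume.restrict Ω)
  memLp_trace : MemLp t 2 ((surfaceMeasure N).restrict (frontier Ω))
  approx : ∃ φ : ℕ → Space N → ℝ, (∀ n, ContDiff ℝ ∞ (φ n)) ∧
    Tendsto (fun n => eLpNorm (fun x => φ n x - u x) 2 (volume.restrict Ω)) atTop (𝓝 0) ∧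
    (∀ i, Tendsto (fun n => eLpNorm (fun x => partialDeriv i (φ n) x - g x i) 2
      (volume.restrict Ω)) atTop (𝓝 0)) ∧
    Tendsto (fun n => eLpNorm (fun x => φ n x - t x) 2
      ((surfaceMeasure N).restrict (frontier Ω))) atTop (𝓝 0)

/-- `T ∈ H¹(Ω)`, with weak gradient `dT`, is a weak solution of the mixed problem
`-∂_i (A_ij ∂_j T) = h` in `Ω`, `T = That` on `ΓT`, `A_ij ∂_j T n_i = q` on `Γq`. -/
def IsWeakSolution (Ω ΓT Γq : Set (Space N)) (A : Space N → Matrix (Fin N) (Fin N) ℝ)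
    (h That q : Space N → ℝ) (T : Space N → ℝ) (dT : Space N → Fin N → ℝ) : Prop :=
  (∃ t : Space N → ℝ, MemH1Trace Ω T dT t ∧ t =ᵐ[(surfaceMeasure N).restrict ΓT] That) ∧
  ∀ (v : Space N → ℝ) (dv : Space N → Fin N → ℝ) (tv : Space N → ℝ), MemH1Trace Ω v dv tv →
    tv =ᵐ[(surfaceMeasure N).restrict ΓT] 0 →
    ∫ x in Ω, ∑ i, ∑ j, A x i j * dT x j * dv x i =
      (∫ x in Ω, h x * v x) + ∫ x in Γq, q x * tv x ∂(surfaceMeasure N)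

/-- The coefficient field on `⋃ s, Ωs s` that equals `A s` on the subdomain `Ωs s`. -/
def piecewiseCoeff {K : ℕ} (Ωs : Fin K → Set (Space N))
    (A : Fin K → Space N → Matrix (Fin N) (Fin N) ℝ) (x : Space N) : Matrix (Fin N) (Fin N) ℝ :=
  ∑ s, (Ωs s).indicator (A s) x

/-- The oscillating coefficient `k^ε`, equal to `k_s(x / ε_s)` on `Ωs s`. -/
def oscillatingCoeff {K : ℕ} (Ωs : Fin K → Set (Space N))
    (k : Fin K → Space N → Matrix (Fin N) (Fin N) ℝ) (ε : Fin K → ℝ) :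
    Space N → Matrix (Fin N) (Fin N) ℝ :=
  piecewiseCoeff Ωs (fun s x => k s ((ε s)⁻¹ • x))

/-! ### Cell problems -/

/-- The unit cell `Q = (0,1)ᴺ`. -/
def unitCell (N : ℕ) : Set (Space N) := {y | ∀ i, 0 < y i ∧ y i < 1}

/-- Weak form of `∂_i (k_ij ∂_j M_α) = -∂_i k_iα` in `Q`, `M_α = 0` on `∂Q`. -/
def IsFirstCellSolution (k : Space N → Matrix (Fin N) (Fin N) ℝ) (α : Fin N)
    (M : Space N → ℝ) (dM : Space N → Fin N → ℝ) : Prop :=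
  MemH10 (unitCell N) M dM ∧
  ∀ φ : Space N → ℝ, IsTestFunction (unitCell N) φ →
    ∫ y in unitCell N, ∑ i, ∑ j, k y i j * dM y j * partialDeriv i φ y =
      -∫ y in unitCell N, ∑ i, k y i α * partialDeriv i φ y

/-- The homogenized coefficient `(1/|Q|) ∫_Q (k_ij + k_iα ∂_α M_j)`. -/
def homogenized (k : Space N → Matrix (Fin N) (Fin N) ℝ)
    (dM : Fin N → Space N → Fin N → ℝ) : Matrix (Fin N) (Fin N) ℝ :=
  Matrix.of fun i j => ⨍ y in unitCell N, (k y i j + ∑ α, k y i α * dM j y α)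

/-- Weak form of
`∂_i (k_ij ∂_j M_αβ) = khat_αβ - k_αβ - ∂_i (k_iβ M_α) - k_αj ∂_j M_β` in `Q`,
`M_αβ = 0` on `∂Q`, where `M1`, `dM1` are the first-order cell functions and their gradients. -/
def IsSecondCellSolution (k : Space N → Matrix (Fin N) (Fin N) ℝ)
    (M1 : Fin N → Space N → ℝ) (dM1 : Fin N → Space N → Fin N → ℝ) (α β : Fin N)
    (M : Space N → ℝ) (dM : Space N → Fin N → ℝ) : Prop :=
  MemH10 (unitCell N) M dM ∧
  ∀ φ : Space N → ℝ, IsTestFunction (unitCell N) φ →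
    -∫ y in unitCell N, ∑ i, ∑ j, k y i j * dM y j * partialDeriv i φ y =
      (∫ y in unitCell N,
        (homogenized k dM1 α β - k y α β - ∑ j, k y α j * dM1 β y j) * φ y) +
      ∫ y in unitCell N, ∑ i, k y i β * M1 α y * partialDeriv i φ y

/-! ### Two-scale expansions -/

/-- The direction `∂/∂x_i` in the product of the macroscopic and the microscopic space. -/
def macroVec (i : Fin N) : Space N × Space N := (unitVec i, 0)

/-- The direction `∂/∂y_i` in the product of the macroscopic and the microscopic space. -/
def microVec (i : Fin N) : Space N × Space N := (0, unitVec i)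

/-- The expansion `T0(x,y) + ε T1(x,y) + ε² T2(x,y) + ⋯`, `y = x/ε`, solves
`-∂_i (k_ij(x/ε) ∂_j T) = h` formally on `U`: after replacing `∂/∂x_i` by
`∂/∂x_i + ε⁻¹ ∂/∂y_i`, the terms of orders `ε⁻²`, `ε⁻¹` and `ε⁰` match, in the sense of
distributions on `U × Q`. Here `x0, x1` and `y0, y1, y2` are the weak gradients
in `x` and in `y`. -/
def IsFormalExpansion (U : Set (Space N)) (k : Space N → Matrix (Fin N) (Fin N) ℝ)
    (h : Space N → ℝ) (T0 T1 T2 : Space N × Space N → ℝ) : Prop :=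
  ∃ x0 x1 y0 y1 y2 : Fin N → Space N × Space N → ℝ,
    (∀ j, HasWeakDeriv (U ×ˢ unitCell N) (macroVec j) T0 (x0 j)) ∧
    (∀ j, HasWeakDeriv (U ×ˢ unitCell N) (macroVec j) T1 (x1 j)) ∧
    (∀ j, HasWeakDeriv (U ×ˢ unitCell N) (microVec j) T0 (y0 j)) ∧
    (∀ j, HasWeakDeriv (U ×ˢ unitCell N) (microVec j) T1 (y1 j)) ∧
    (∀ j, HasWeakDeriv (U ×ˢ unitCell N) (microVec j) T2 (y2 j)) ∧
    ∀ φ : Space N × Space N → ℝ, IsTestFunction (U ×ˢ unitCell N) φ →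
      -- order `ε⁻²`
      ∫ p in U ×ˢ unitCell N, ∑ i, ∑ j, k p.2 i j * y0 j p * fderiv ℝ φ p (microVec i) = 0 ∧
      -- order `ε⁻¹`
      ∫ p in U ×ˢ unitCell N, ∑ i, ∑ j,
        (k p.2 i j * (x0 j p + y1 j p) * fderiv ℝ φ p (microVec i) +
          k p.2 i j * y0 j p * fderiv ℝ φ p (macroVec i)) = 0 ∧
      -- order `ε⁰`
      ∫ p in U ×ˢ unitCell N, ∑ i, ∑ j,
        (k p.2 i j * (x0 j p + y1 j p) * fderiv ℝ φ p (macroVec i) +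
          k p.2 i j * (x1 j p + y2 j p) * fderiv ℝ φ p (microVec i)) =
        ∫ p in U ×ˢ unitCell N, h p.1 * φ p

/-- The first-order term `M_α(y) ∂_α T0(x)`. -/
def firstOrderTerm (M1 : Fin N → Space N → ℝ) (dT0 : Space N → Fin N → ℝ)
    (p : Space N × Space N) : ℝ :=
  ∑ α, M1 α p.2 * dT0 p.1 α

/-- The second-order term `M_αβ(y) ∂²_αβ T0(x)`. -/
def secondOrderTerm (M2 : Fin N → Fin N → Space N → ℝ) (d2T0 : Space N → Fin N → Fin N → ℝ)
    (p : Space N × Space N) : ℝ :=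
  ∑ α, ∑ β, M2 α β p.2 * d2T0 p.1 α β

/-- The componentwise fractional part: the representative of `y` modulo `ℤᴺ` in `[0,1)ᴺ`. -/
def fracPart (y : Space N) : Space N := WithLp.toLp 2 fun i => Int.fract (y i)

/-- The second-order two-scale function
`T0 + ε M_α(x/ε) ∂_α T0 + ε² M_αβ(x/ε) ∂²_αβ T0`, the cell functions being extended
1-periodically from the unit cell. -/
def sots (ε : ℝ) (M1 : Fin N → Space N → ℝ) (M2 : Fin N → Fin N → Space N → ℝ)
    (T0 : Space N → ℝ) (dT0 : Space N → Fin N → ℝ) (d2T0 : Space N → Fin N → Fin N → ℝ)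
    (x : Space N) : ℝ :=
  T0 x + ε * firstOrderTerm M1 dT0 (x, fracPart (ε⁻¹ • x)) +
    ε ^ 2 * secondOrderTerm M2 d2T0 (x, fracPart (ε⁻¹ • x))

/-- The union of the open cells `ε (z + Q)`, `z ∈ ℤᴺ`. -/
def openCells (N : ℕ) (ε : ℝ) : Set (Space N) := {x | ∀ i, ∀ m : ℤ, x i ≠ ε * m}

/-- The norm `‖φ‖_{L²} + ε ‖∇φ‖_{L²}`, adapted to the cell size `ε`. -/
def scaledNorm (ε : ℝ) (φ : Space N → ℝ) : ℝ :=
  Real.sqrt (∫ x, φ x ^ 2) + ε * Real.sqrt (∫ x, ‖fderiv ℝ φ x‖ ^ 2)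

end

/-!
# Second-order two-scale expansion for heat conduction in locally periodic media

Everything happens inside one subdomain at a time: a test function supported in `Ω_s` sees only the
coefficient of `Ω_s` and no boundary data (`IsWeakSolution.integral_eq_of_test`).

*Cell functions.* The cell problems are Dirichlet problems in divergence form with right-hand side
`f - ∂ᵢ Fᵢ`, `f, Fᵢ ∈ L²(Q)`. The pairs `(u, ∇u)` with `u ∈ H¹₀(Q)` form a closed subspace of
`L²(Q) × L²(Q)ᴺ`, on which the energy form is coercive by the Poincaré inequality, and Lax-Milgram
applies (`IsElliptic.exists_dirichlet_solution`). All later computations use the cell problems only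
through two fluxes: `P_iα = k_iα + k_ij ∂ⱼ M_α` (`firstFlux`) has divergence zero, and
`W_iαβ = k_iβ M_α + k_ij ∂ⱼ M_αβ` (`secondFlux`) has divergence `k̂_αβ - P_αβ`.

*Homogenized matrix.* Testing the first cell problem with the cell functions shows that `k̂` is the
Gram matrix of the corrected gradients `e_j + ∇M_j` in the energy inner product
(`homogenized_eq_cellEnergy`), hence symmetric. The lower bound follows since `∇M_j` has mean zero,
the upper bound since `k̂_ij` is the mean of `k_ij` minus the Gram matrix of the `∇M_j`
(`homogenized_eq_sub`).

*Second derivatives.* On `Ω_s` the homogenized equation has constant coefficients. For a test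
function `v`, two integrations by parts give `γ₀ ‖∂ᵢ∂ₘ v‖ ≤ ‖k̂_ij ∂ᵢ∂ⱼ v‖`
(`norm_second_deriv_le`). Constant coefficients commute with mollification, so the estimate passes
to the products `η T0` of the solution with cut-off functions; Riesz representation turns it into
second weak derivatives in `L²`, which are glued over a compact exhaustion
(`exists_second_weakGrad`).

*Formal expansion.* On `Ω_s × Q` the fluxes of orders `ε⁻¹`, `ε⁰`, `ε¹` are `0`, `P_iα ∂_α T0` and
`W_iαβ ∂²_αβ T0`. Products `a(x) b(y)` inherit the weak identities of their factors
(`sum_integral_tensor_left`, `sum_integral_tensor_right`). The order `ε⁰` then reads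
`∂²_αi T0 P_iα + ∂²_αβ T0 (k̂_αβ - P_αβ) = -h`, where the terms with `P` cancel because the second
derivatives of `T0` are symmetric, and the homogenized equation is left (`isFormalExpansion`).

*Truncation.* Functions in `H¹₀(Q)` stay weakly differentiable after periodic extension
(`MemH10.integral_oscillate`), which gives the weak gradient of the truncated expansion. If `φ` is
supported in the open cells, then so is `∂_α T0 φ`, and the cell problems may be rescaled and tested
with it (`oscillate_integral_eq_of_test`). The same cancellation as above leaves an exact formula
for the residual (`integral_sotsGrad_sub_eq`), with one term of order `ε²` paired with `∇φ` and one
of order `ε` paired with `φ`. Oscillating functions are bounded in `L²` on compact sets uniformly in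
`ε ≤ 1` (`exists_eLpNorm_oscillate_le`), and the estimate follows from Cauchy-Schwarz.
-/

set_option linter.unusedSectionVars false

variable {N : ℕ}

/-! ### Test functions and integration by parts -/

section Basic

variable {E : Type*} [NormedAddCommGroup E] [NormedSpace ℝ E]

/-- `ψ ∈ C_c¹(U)`. -/
structure IsC1TestFunction (U : Set E) (ψ : E → ℝ) : Prop where
  contDiff : ContDiff ℝ 1 ψ
  compact : HasCompactSupport ψ
  support_subset : tsupport ψ ⊆ U

theorem IsTestFunction.toC1 {U : Set E} {φ : E → ℝ} (h : IsTestFunction U φ) :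
    IsC1TestFunction U φ :=
  ⟨h.smooth.of_le (by exact_mod_cast le_top), h.compact, h.support_subset⟩

theorem IsTestFunction.mono {U V : Set E} {φ : E → ℝ} (h : IsTestFunction U φ) (hUV : U ⊆ V) :
    IsTestFunction V φ :=
  ⟨h.smooth, h.compact, h.support_subset.trans hUV⟩

theorem IsC1TestFunction.mono {U V : Set E} {φ : E → ℝ} (h : IsC1TestFunction U φ)
    (hUV : U ⊆ V) : IsC1TestFunction V φ :=
  ⟨h.contDiff, h.compact, h.support_subset.trans hUV⟩

theorem IsC1TestFunction.continuous {U : Set E} {φ : E → ℝ} (h : IsC1TestFunction U φ) :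
    Continuous φ := h.contDiff.continuous

theorem IsC1TestFunction.eq_zero {U : Set E} {φ : E → ℝ} (h : IsC1TestFunction U φ) {x : E}
    (hx : x ∉ U) : φ x = 0 :=
  image_eq_zero_of_notMem_tsupport fun h' => hx (h.support_subset h')

theorem IsC1TestFunction.fderiv_eq_zero {U : Set E} {φ : E → ℝ} (h : IsC1TestFunction U φ)
    {x : E} (hx : x ∉ U) : fderiv ℝ φ x = 0 :=
  fderiv_of_notMem_tsupport (𝕜 := ℝ) fun h' => hx (h.support_subset h')

theorem IsC1TestFunction.continuous_fderiv_apply {U : Set E} {φ : E → ℝ}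
    (h : IsC1TestFunction U φ) (v : E) : Continuous fun x => fderiv ℝ φ x v :=
  (h.contDiff.continuous_fderiv (by simp)).clm_apply continuous_const

theorem tsupport_fderiv_apply_subset' (φ : E → ℝ) (v : E) :
    tsupport (fun x => fderiv ℝ φ x v) ⊆ tsupport φ := by
  refine closure_minimal (fun x hx => ?_) (isClosed_tsupport φ)
  by_contra h
  exact hx (by simp [fderiv_of_notMem_tsupport (𝕜 := ℝ) h])

theorem IsC1TestFunction.hasCompactSupport_fderiv_apply {U : Set E} {φ : E → ℝ}
    (h : IsC1TestFunction U φ) (v : E) : HasCompactSupport fun x => fderiv ℝ φ x v :=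
  h.compact.mono' ((subset_tsupport _).trans (tsupport_fderiv_apply_subset' φ v))

theorem IsTestFunction.fderiv_apply {U : Set E} {φ : E → ℝ} (h : IsTestFunction U φ) (v : E) :
    IsTestFunction U fun x => fderiv ℝ φ x v :=
  ⟨(h.smooth.fderiv_right (m := ∞) (by simp)).clm_apply contDiff_const,
    h.toC1.hasCompactSupport_fderiv_apply v,
    (tsupport_fderiv_apply_subset' φ v).trans h.support_subset⟩

theorem IsTestFunction.zero (U : Set E) : IsTestFunction U (fun _ => (0 : ℝ)) := by
  refine ⟨contDiff_const, ?_, ?_⟩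
  · exact HasCompactSupport.zero
  · have : tsupport (fun _ : E => (0 : ℝ)) = ∅ := tsupport_eq_empty_iff.2 rfl
    simp [this]

theorem IsTestFunction.add {U : Set E} {φ ψ : E → ℝ} (h : IsTestFunction U φ)
    (h' : IsTestFunction U ψ) : IsTestFunction U (fun x => φ x + ψ x) :=
  ⟨h.smooth.add h'.smooth, h.compact.add h'.compact,
    (tsupport_add φ ψ).trans (union_subset h.support_subset h'.support_subset)⟩

theorem IsTestFunction.mul_left {U : Set E} {φ η : E → ℝ} (h : IsTestFunction U φ)
    (hη : ContDiff ℝ ∞ η) : IsTestFunction U (fun x => η x * φ x) :=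
  ⟨hη.mul h.smooth, h.compact.mul_left, (tsupport_mul_subset_right).trans h.support_subset⟩

theorem IsTestFunction.const_mul {U : Set E} {φ : E → ℝ} (h : IsTestFunction U φ) (c : ℝ) :
    IsTestFunction U (fun x => c * φ x) :=
  h.mul_left contDiff_const

theorem IsTestFunction.sub {U : Set E} {φ ψ : E → ℝ} (h : IsTestFunction U φ)
    (h' : IsTestFunction U ψ) : IsTestFunction U (fun x => φ x - ψ x) := by
  simpa [sub_eq_add_neg] using h.add (h'.const_mul (-1))

theorem IsTestFunction.fderiv_fderiv_comm {U : Set E} {φ : E → ℝ} (h : IsTestFunction U φ)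
    (x v w : E) : fderiv ℝ (fun x => fderiv ℝ φ x w) x v =
      fderiv ℝ (fun x => fderiv ℝ φ x v) x w := by
  have hd : DifferentiableAt ℝ (fderiv ℝ φ) x :=
    ((contDiff_infty.1 h.smooth 2).fderiv_right (m := 1) (by norm_num)).differentiable
      (by simp) x
  rw [fderiv_clm_apply hd (differentiableAt_const _),
    fderiv_clm_apply hd (differentiableAt_const _)]
  simp only [fderiv_fun_const, Pi.zero_apply, ContinuousLinearMap.comp_zero, zero_add,
    ContinuousLinearMap.flip_apply]
  exact ((contDiff_infty.1 h.smooth 2).contDiffAt.isSymmSndFDerivAt (by simp)).eq v w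

/-- The product rule for `a ψ`, where `a` is `C¹` only on `U` and `ψ ∈ C_c¹(U)`; it holds at every
point, since both sides vanish off the support of `ψ`. -/
theorem fderiv_mul_test {U : Set E} (hU : IsOpen U) {a ψ : E → ℝ} (ha : ContDiffOn ℝ 1 a U)
    (hψ : IsC1TestFunction U ψ) (x v : E) :
    fderiv ℝ (fun x => a x * ψ x) x v = a x * fderiv ℝ ψ x v + fderiv ℝ a x v * ψ x := by
  by_cases hx : x ∈ tsupport ψ
  · have hxU := hψ.support_subset hx
    have h1 : DifferentiableAt ℝ a x :=
      ((ha.differentiableOn (by simp)) x hxU).differentiableAt (hU.mem_nhds hxU)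
    have h2 : DifferentiableAt ℝ ψ x := hψ.contDiff.differentiable (by simp) x
    rw [fderiv_fun_mul h1 h2]
    simp [mul_comm]
  · have h1 : x ∉ tsupport (fun x => a x * ψ x) := fun h => hx (tsupport_mul_subset_right h)
    rw [fderiv_of_notMem_tsupport (𝕜 := ℝ) h1, fderiv_of_notMem_tsupport (𝕜 := ℝ) hx,
      image_eq_zero_of_notMem_tsupport hx]
    simp

theorem IsC1TestFunction.mul_contDiffOn {U : Set E} (hU : IsOpen U) {a ψ : E → ℝ}
    (ha : ContDiffOn ℝ 1 a U) (hψ : IsC1TestFunction U ψ) :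
    IsC1TestFunction U (fun x => a x * ψ x) := by
  have hsub : tsupport (fun x => a x * ψ x) ⊆ tsupport ψ := tsupport_mul_subset_right
  refine ⟨contDiff_iff_contDiffAt.2 fun x => ?_, hψ.compact.mul_left, hsub.trans hψ.support_subset⟩
  by_cases hx : x ∈ tsupport fun x => a x * ψ x
  · have hxU := hψ.support_subset (hsub hx)
    exact (ha.contDiffAt (hU.mem_nhds hxU)).mul hψ.contDiff.contDiffAt
  · exact (contDiffAt_const (c := (0 : ℝ))).congr_of_eventuallyEq
      (notMem_tsupport_iff_eventuallyEq.1 hx)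

section Measure

variable [MeasurableSpace E] [BorelSpace E] {μ : Measure E}

theorem integrable_mul_of_tsupport {f φ : E → ℝ} (hf : IntegrableOn f (tsupport φ) μ)
    (hφ : Continuous φ) (hc : HasCompactSupport φ) : Integrable (fun x => f x * φ x) μ := by
  refine (integrableOn_iff_integrable_of_support_subset (s := tsupport φ) ?_).1
    (hf.mul_continuousOn hφ.continuousOn hc)
  intro x hx
  exact subset_tsupport φ (fun h => hx (by simp [h]))

theorem integrable_mul_of_locallyIntegrableOn [IsFiniteMeasureOnCompacts μ] {U : Set E}
    {f φ : E → ℝ} (hf : LocallyIntegrableOn f U μ) (hφ : Continuous φ) (hc : HasCompactSupport φ)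
    (hs : tsupport φ ⊆ U) : Integrable (fun x => f x * φ x) μ :=
  integrable_mul_of_tsupport (hf.integrableOn_compact_subset hs hc) hφ hc

theorem setIntegral_eq_of_tsupport {U : Set E} {φ : E → ℝ} (hs : tsupport φ ⊆ U) (f : E → ℝ) :
    ∫ x in U, f x * φ x ∂μ = ∫ x, f x * φ x ∂μ :=
  setIntegral_eq_integral_of_forall_compl_eq_zero fun x hx => by
    rw [image_eq_zero_of_notMem_tsupport fun h => hx (hs h), mul_zero]

theorem integral_fderiv_eq_zero_of_C1 [FiniteDimensional ℝ E] [μ.IsAddHaarMeasure] {ψ : E → ℝ}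
    (hψ : ContDiff ℝ 1 ψ) (hc : HasCompactSupport ψ) (v : E) :
    ∫ x, fderiv ℝ ψ x v ∂μ = 0 := by
  have h0 : IsC1TestFunction univ ψ := ⟨hψ, hc, subset_univ _⟩
  have := integral_mul_fderiv_eq_neg_fderiv_mul_of_integrable (μ := μ) (𝕜 := ℝ)
    (f := fun _ : E => (1 : ℝ)) (g := ψ) (v := v) (by simp) ?_ ?_ (by simp)
    (fun x _ => hψ.differentiable (by simp) x)
  · simpa using this
  · simpa using (h0.continuous_fderiv_apply v).integrable_of_hasCompactSupport
      (h0.hasCompactSupport_fderiv_apply v)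
  · simpa using h0.continuous.integrable_of_hasCompactSupport hc

theorem integral_mul_fderiv_of_contDiffOn [FiniteDimensional ℝ E] [μ.IsAddHaarMeasure] {U : Set E}
    (hU : IsOpen U) {a ψ : E → ℝ} (ha : ContDiffOn ℝ 1 a U) (hψ : IsC1TestFunction U ψ) (v : E) :
    ∫ x, a x * fderiv ℝ ψ x v ∂μ = -∫ x, fderiv ℝ a x v * ψ x ∂μ := by
  have h1 := hψ.mul_contDiffOn hU ha
  have h2 := integral_fderiv_eq_zero_of_C1 (μ := μ) h1.contDiff h1.compact v
  simp_rw [fderiv_mul_test hU ha hψ] at h2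
  have hca : LocallyIntegrableOn a U μ := ha.continuousOn.locallyIntegrableOn hU.measurableSet
  have hcd : LocallyIntegrableOn (fun x => fderiv ℝ a x v) U μ :=
    ((ha.continuousOn_fderiv_of_isOpen hU (by simp)).clm_apply
      continuousOn_const).locallyIntegrableOn hU.measurableSet
  rw [integral_add] at h2
  · linarith
  · exact integrable_mul_of_locallyIntegrableOn hca (hψ.continuous_fderiv_apply v)
      (hψ.hasCompactSupport_fderiv_apply v)
      ((tsupport_fderiv_apply_subset' ψ v).trans hψ.support_subset)
  · exact integrable_mul_of_locallyIntegrableOn hcd hψ.continuous hψ.compact hψ.support_subset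

end Measure

end Basic

/-! ### Weak derivatives -/

section WeakDeriv

variable {E : Type*} [NormedAddCommGroup E] [NormedSpace ℝ E]

section

variable [MeasureSpace E] {U V : Set E} {v : E} {u u' g g' : E → ℝ}

theorem HasWeakDeriv.mul_right_integrable [BorelSpace E]
    [IsFiniteMeasureOnCompacts (volume : Measure E)] (h : HasWeakDeriv U v u g) {φ : E → ℝ}
    (hφ : IsC1TestFunction U φ) : Integrable (fun x => g x * φ x) :=
  integrable_mul_of_locallyIntegrableOn h.locallyIntegrable_deriv hφ.continuous hφ.compact
    hφ.support_subset

theorem HasWeakDeriv.congr (h : HasWeakDeriv U v u g) (hu : u =ᵐ[volume.restrict U] u')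
    (hg : g =ᵐ[volume.restrict U] g') : HasWeakDeriv U v u' g' := by
  refine ⟨h.locallyIntegrable.congr hu, h.locallyIntegrable_deriv.congr hg, fun φ hφ => ?_⟩
  have e1 : ∫ x in U, u' x * fderiv ℝ φ x v = ∫ x in U, u x * fderiv ℝ φ x v :=
    integral_congr_ae (by filter_upwards [hu] with x hx; rw [hx])
  have e2 : ∫ x in U, g' x * φ x = ∫ x in U, g x * φ x :=
    integral_congr_ae (by filter_upwards [hg] with x hx; rw [hx])
  rw [e1, e2, h.integral_eq φ hφ]

theorem HasWeakDeriv.integral_eq' [BorelSpace E] (h : HasWeakDeriv U v u g) {φ : E → ℝ}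
    (hφ : IsTestFunction U φ) : ∫ x, u x * fderiv ℝ φ x v = -∫ x, g x * φ x := by
  rw [← setIntegral_eq_of_tsupport hφ.support_subset,
    ← setIntegral_eq_of_tsupport ((tsupport_fderiv_apply_subset' φ v).trans hφ.support_subset)]
  exact h.integral_eq φ hφ

theorem HasWeakDeriv.of_integral_eq [BorelSpace E] (hu : LocallyIntegrableOn u U)
    (hg : LocallyIntegrableOn g U)
    (h : ∀ φ : E → ℝ, IsTestFunction U φ → ∫ x, u x * fderiv ℝ φ x v = -∫ x, g x * φ x) :
    HasWeakDeriv U v u g := by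
  refine ⟨hu, hg, fun φ hφ => ?_⟩
  rw [setIntegral_eq_of_tsupport hφ.support_subset,
    setIntegral_eq_of_tsupport ((tsupport_fderiv_apply_subset' φ v).trans hφ.support_subset)]
  exact h φ hφ

theorem HasWeakDeriv.mono [BorelSpace E] (h : HasWeakDeriv U v u g) (hVU : V ⊆ U) :
    HasWeakDeriv V v u g :=
  .of_integral_eq (h.locallyIntegrable.mono_set hVU) (h.locallyIntegrable_deriv.mono_set hVU)
    fun _ hφ => h.integral_eq' (hφ.mono hVU)

variable [BorelSpace E] [IsFiniteMeasureOnCompacts (volume : Measure E)]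

theorem HasWeakDeriv.add (h : HasWeakDeriv U v u g) (h' : HasWeakDeriv U v u' g') :
    HasWeakDeriv U v (fun x => u x + u' x) (fun x => g x + g' x) := by
  refine .of_integral_eq (h.locallyIntegrable.add h'.locallyIntegrable)
    (h.locallyIntegrable_deriv.add h'.locallyIntegrable_deriv) fun φ hφ => ?_
  simp_rw [add_mul]
  have hd := (hφ.fderiv_apply v)
  rw [integral_add, integral_add, h.integral_eq' hφ, h'.integral_eq' hφ]
  · ring
  · exact h.mul_right_integrable hφ.toC1
  · exact h'.mul_right_integrable hφ.toC1
  · exact integrable_mul_of_locallyIntegrableOn h.locallyIntegrable hd.toC1.continuous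
      hd.compact hd.support_subset
  · exact integrable_mul_of_locallyIntegrableOn h'.locallyIntegrable hd.toC1.continuous
      hd.compact hd.support_subset

theorem HasWeakDeriv.const_mul (h : HasWeakDeriv U v u g) (c : ℝ) :
    HasWeakDeriv U v (fun x => c * u x) (fun x => c * g x) := by
  refine .of_integral_eq (h.locallyIntegrable.smul c)
    (h.locallyIntegrable_deriv.smul c) fun φ hφ => ?_
  simp_rw [mul_assoc, integral_const_mul, h.integral_eq' hφ]
  ring

theorem hasWeakDeriv_zero : HasWeakDeriv U v (fun _ => 0) (fun _ => 0) :=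
  .of_integral_eq locallyIntegrableOn_zero locallyIntegrableOn_zero (by simp)

theorem HasWeakDeriv.sum {ι : Type*} (s : Finset ι) {u g : ι → E → ℝ}
    (h : ∀ i ∈ s, HasWeakDeriv U v (u i) (g i)) :
    HasWeakDeriv U v (fun x => ∑ i ∈ s, u i x) (fun x => ∑ i ∈ s, g i x) := by
  classical
  induction s using Finset.induction_on with
  | empty => simpa using hasWeakDeriv_zero
  | insert a s ha ih =>
    simp_rw [Finset.sum_insert ha]
    exact (h a (by simp)).add (ih fun i hi => h i (by simp [hi]))

end

section

variable [MeasureSpace E] [BorelSpace E] [FiniteDimensional ℝ E]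
  [(volume : Measure E).IsAddHaarMeasure] {U : Set E} {v w : E} {u g g' : E → ℝ}

theorem HasWeakDeriv.unique (hU : IsOpen U) (h : HasWeakDeriv U v u g)
    (h' : HasWeakDeriv U v u g') : g =ᵐ[volume.restrict U] g' := by
  have h0 := hU.ae_eq_zero_of_integral_contDiff_smul_eq_zero (μ := volume)
    (h.locallyIntegrable_deriv.sub h'.locallyIntegrable_deriv) fun φ hφ hc hs => ?_
  · rw [EventuallyEq, ae_restrict_iff' hU.measurableSet]
    filter_upwards [h0] with x hx hxU
    exact sub_eq_zero.1 (hx hxU)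
  · have hφ' : IsTestFunction U φ := ⟨hφ, hc, hs⟩
    have e1 := h.integral_eq' hφ'
    have e2 := h'.integral_eq' hφ'
    simp only [smul_eq_mul, Pi.sub_apply, mul_sub]
    simp_rw [mul_comm (φ _)]
    rw [integral_sub (h.mul_right_integrable hφ'.toC1) (h'.mul_right_integrable hφ'.toC1)]
    linarith

theorem HasWeakDeriv.of_contDiffOn (hU : IsOpen U) (ha : ContDiffOn ℝ 1 u U) (v : E) :
    HasWeakDeriv U v u (fun x => fderiv ℝ u x v) := by
  refine .of_integral_eq (ha.continuousOn.locallyIntegrableOn hU.measurableSet)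
    (((ha.continuousOn_fderiv_of_isOpen hU (by simp)).clm_apply
      continuousOn_const).locallyIntegrableOn hU.measurableSet) fun φ hφ => ?_
  exact integral_mul_fderiv_of_contDiffOn hU ha hφ.toC1 v

/-- Mixed second weak derivatives commute. -/
theorem HasWeakDeriv.ae_eq_swap (hU : IsOpen U) {gv gw gvw gwv : E → ℝ}
    (hv : HasWeakDeriv U v u gv) (hw : HasWeakDeriv U w u gw)
    (hvw : HasWeakDeriv U w gv gvw) (hwv : HasWeakDeriv U v gw gwv) :
    gvw =ᵐ[volume.restrict U] gwv := by
  refine hvw.unique hU (.of_integral_eq hvw.locallyIntegrable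
    hwv.locallyIntegrable_deriv fun φ hφ => ?_)
  have e1 := hv.integral_eq' (hφ.fderiv_apply w)
  have e2 := hw.integral_eq' (hφ.fderiv_apply v)
  have e3 := hwv.integral_eq' hφ
  simp_rw [fun x => hφ.fderiv_fderiv_comm x v w] at e1
  linarith

end

end WeakDeriv

/-! ### Square integrable functions -/

section L2

variable {X : Type*} [MeasurableSpace X] {μ : Measure X}

theorem memLp_two_integrable_mul {f g : X → ℝ} (hf : MemLp f 2 μ) (hg : MemLp g 2 μ) :
    Integrable (fun x => f x * g x) μ :=
  hf.integrable_mul hg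

theorem inner_toLp_eq {f g : X → ℝ} (hf : MemLp f 2 μ) (hg : MemLp g 2 μ) :
    inner ℝ (hf.toLp f) (hg.toLp g) = ∫ x, f x * g x ∂μ := by
  rw [L2.inner_def]
  refine integral_congr_ae ?_
  filter_upwards [hf.coeFn_toLp, hg.coeFn_toLp] with x h1 h2
  rw [h1, h2]
  simp [mul_comm]

theorem norm_toLp_eq {f : X → ℝ} (hf : MemLp f 2 μ) :
    ‖hf.toLp f‖ = Real.sqrt (∫ x, f x ^ 2 ∂μ) := by
  rw [eq_comm, Real.sqrt_eq_iff_mul_self_eq (integral_nonneg fun x => sq_nonneg _) (norm_nonneg _),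
    ← real_inner_self_eq_norm_mul_norm, inner_toLp_eq hf hf]
  simp_rw [sq]

/-- The Cauchy-Schwarz inequality. -/
theorem abs_integral_mul_le {f g : X → ℝ} (hf : MemLp f 2 μ) (hg : MemLp g 2 μ) :
    |∫ x, f x * g x ∂μ| ≤ Real.sqrt (∫ x, f x ^ 2 ∂μ) * Real.sqrt (∫ x, g x ^ 2 ∂μ) := by
  rw [← inner_toLp_eq hf hg, ← norm_toLp_eq hf, ← norm_toLp_eq hg]
  exact abs_real_inner_le_norm _ _

theorem tendsto_integral_mul_of_eLpNorm {φ : ℕ → X → ℝ} {u f : X → ℝ}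
    (hφ : ∀ n, MemLp (φ n) 2 μ) (hu : MemLp u 2 μ) (hf : MemLp f 2 μ)
    (h : Tendsto (fun n => eLpNorm (fun x => φ n x - u x) 2 μ) atTop (𝓝 0)) :
    Tendsto (fun n => ∫ x, φ n x * f x ∂μ) atTop (𝓝 (∫ x, u x * f x ∂μ)) := by
  have h1 := (Lp.tendsto_Lp_iff_tendsto_eLpNorm'' φ hφ u hu).2 h
  simp_rw [← inner_toLp_eq (hφ _) hf, ← inner_toLp_eq hu hf]
  exact h1.inner tendsto_const_nhds

theorem tendsto_integral_sq_of_eLpNorm {φ : ℕ → X → ℝ} {u : X → ℝ}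
    (hφ : ∀ n, MemLp (φ n) 2 μ) (hu : MemLp u 2 μ)
    (h : Tendsto (fun n => eLpNorm (fun x => φ n x - u x) 2 μ) atTop (𝓝 0)) :
    Tendsto (fun n => ∫ x, φ n x ^ 2 ∂μ) atTop (𝓝 (∫ x, u x ^ 2 ∂μ)) := by
  have h1 := (Lp.tendsto_Lp_iff_tendsto_eLpNorm'' φ hφ u hu).2 h
  simp_rw [sq, ← inner_toLp_eq (hφ _) (hφ _), ← inner_toLp_eq hu hu]
  exact h1.inner h1

theorem MeasureTheory.MemLp.mul_bdd {f c : X → ℝ} {C : ℝ} (hf : MemLp f 2 μ)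
    (hc : AEStronglyMeasurable c μ)
    (hC : ∀ᵐ x ∂μ, |c x| ≤ C) : MemLp (fun x => c x * f x) 2 μ :=
  hf.of_le_mul (hc.mul hf.1) (c := C) (by
    filter_upwards [hC] with x hx
    rw [norm_mul]
    exact mul_le_mul_of_nonneg_right hx (norm_nonneg _))

theorem memLp_two_sum {ι : Type*} (s : Finset ι) {f : ι → X → ℝ}
    (h : ∀ i ∈ s, MemLp (f i) 2 μ) : MemLp (fun x => ∑ i ∈ s, f i x) 2 μ :=
  memLp_finsetSum s h

end L2

theorem IsC1TestFunction.memLp {E : Type*} [NormedAddCommGroup E] [NormedSpace ℝ E]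
    [MeasurableSpace E] [BorelSpace E] {μ : Measure E} [IsFiniteMeasureOnCompacts μ] {U : Set E}
    {φ : E → ℝ} (h : IsC1TestFunction U φ) : MemLp φ 2 μ :=
  h.continuous.memLp_of_hasCompactSupport h.compact

theorem IsC1TestFunction.memLp_fderiv {E : Type*} [NormedAddCommGroup E] [NormedSpace ℝ E]
    [MeasurableSpace E] [BorelSpace E] {μ : Measure E} [IsFiniteMeasureOnCompacts μ] {U : Set E}
    {φ : E → ℝ} (h : IsC1TestFunction U φ) (v : E) : MemLp (fun x => fderiv ℝ φ x v) 2 μ :=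
  (h.continuous_fderiv_apply v).memLp_of_hasCompactSupport (h.hasCompactSupport_fderiv_apply v)

theorem memLp_two_of_continuous_of_isBounded {U : Set (Space N)} (hU : Bornology.IsBounded U)
    {f : Space N → ℝ} (hf : Continuous f) : MemLp f 2 (volume.restrict U) := by
  have hK : IsCompact (closure U) := hU.isCompact_closure
  obtain ⟨C, hC⟩ := hK.exists_bound_of_continuousOn hf.continuousOn
  have : IsFiniteMeasure ((volume : Measure (Space N)).restrict (closure U)) :=
    ⟨by simpa using hK.measure_lt_top⟩
  exact (MemLp.of_bound (μ := volume.restrict (closure U)) hf.aestronglyMeasurable C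
    ((ae_restrict_iff' isClosed_closure.measurableSet).2
      (Eventually.of_forall hC))).mono_measure (Measure.restrict_mono subset_closure le_rfl)

theorem locallyIntegrableOn_of_memLp_two {U : Set (Space N)} {f : Space N → ℝ}
    (hf : MemLp f 2 (volume.restrict U)) : LocallyIntegrableOn f U := by
  intro x hx
  obtain ⟨K, hK, hxK⟩ := exists_compact_mem_nhds x
  refine ⟨U ∩ K, inter_mem self_mem_nhdsWithin (mem_nhdsWithin_of_mem_nhds hxK), ?_⟩
  have : IsFiniteMeasure ((volume : Measure (Space N)).restrict (U ∩ K)) :=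
    ⟨by simpa using (measure_mono inter_subset_right).trans_lt hK.measure_lt_top⟩
  exact (hf.mono_measure (Measure.restrict_mono inter_subset_left le_rfl)).integrable
    (by norm_num)

/-! ### The space `H¹₀` -/

/-- Integration by parts for `u ∈ H¹₀(U)` against `C¹` functions that need not vanish on the
boundary. -/
theorem MemH10.integral_mul_partialDeriv {U : Set (Space N)}
    (hUb : Bornology.IsBounded U) {u : Space N → ℝ} {g : Space N → Fin N → ℝ} (h : MemH10 U u g)
    {ψ : Space N → ℝ} (hψ : ContDiff ℝ 1 ψ) (i : Fin N) :
    ∫ x in U, u x * partialDeriv i ψ x = -∫ x in U, g x i * ψ x := by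
  obtain ⟨φ, hφ, h1, h2⟩ := h.approx
  have hd : Continuous (partialDeriv i ψ) :=
    (hψ.continuous_fderiv (by simp)).clm_apply continuous_const
  have t1 := tendsto_integral_mul_of_eLpNorm (fun n => (hφ n).toC1.memLp) h.memLp
    (memLp_two_of_continuous_of_isBounded hUb hd) h1
  have t2 := tendsto_integral_mul_of_eLpNorm (fun n => (hφ n).toC1.memLp_fderiv _) (h.memLp_grad i)
    (memLp_two_of_continuous_of_isBounded hUb hψ.continuous) (h2 i)
  refine tendsto_nhds_unique t1 ((t2.neg).congr fun n => ?_)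
  have := integral_mul_fderiv_of_contDiffOn (μ := volume) isOpen_univ hψ.contDiffOn
    ((hφ n).toC1.mono (subset_univ _)) (unitVec i)
  simp_rw [mul_comm (φ n _), mul_comm (fderiv ℝ (φ n) _ (unitVec i))]
  rw [setIntegral_eq_of_tsupport (hφ n).support_subset, setIntegral_eq_of_tsupport
    ((tsupport_fderiv_apply_subset' (φ n) (unitVec i)).trans (hφ n).support_subset)]
  unfold partialDeriv
  linarith

theorem MemH10.integral_grad_eq_zero {U : Set (Space N)}
    (hUb : Bornology.IsBounded U) {u : Space N → ℝ} {g : Space N → Fin N → ℝ} (h : MemH10 U u g)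
    (i : Fin N) : ∫ x in U, g x i = 0 := by
  have := h.integral_mul_partialDeriv hUb (ψ := fun _ => 1) contDiff_const i
  simpa [partialDeriv] using this

/-- An identity that holds for all test functions holds on `H¹₀`. -/
theorem MemH10.integral_eq_of_test {U : Set (Space N)} {F : Fin N → Space N → ℝ}
    {f : Space N → ℝ} (hF : ∀ i, MemLp (F i) 2 (volume.restrict U))
    (hf : MemLp f 2 (volume.restrict U))
    (hw : ∀ φ, IsTestFunction U φ →
      ∫ x in U, ∑ i, F i x * partialDeriv i φ x = ∫ x in U, f x * φ x)
    {v : Space N → ℝ} {dv : Space N → Fin N → ℝ} (h : MemH10 U v dv) :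
    ∫ x in U, ∑ i, F i x * dv x i = ∫ x in U, f x * v x := by
  obtain ⟨φ, hφ, h1, h2⟩ := h.approx
  have t1 := tendsto_integral_mul_of_eLpNorm (fun n => (hφ n).toC1.memLp) h.memLp hf h1
  have t2 := tendsto_finsetSum Finset.univ fun i _ =>
    tendsto_integral_mul_of_eLpNorm (fun n => (hφ n).toC1.memLp_fderiv (unitVec i))
      (h.memLp_grad i) (hF i) (h2 i)
  have e2 : ∫ x in U, ∑ i, F i x * dv x i = ∑ i, ∫ x in U, dv x i * F i x := by
    rw [integral_finsetSum _ fun i _ => memLp_two_integrable_mul (hF i) (h.memLp_grad i)]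
    simp_rw [mul_comm]
  rw [e2]
  simp_rw [mul_comm (f _)]
  refine tendsto_nhds_unique t2 (t1.congr fun n => ?_)
  rw [← integral_finsetSum _ fun i _ =>
    memLp_two_integrable_mul ((hφ n).toC1.memLp_fderiv (unitVec i)) (hF i)]
  simp_rw [mul_comm (φ n _)]
  rw [← hw _ (hφ n)]
  simp_rw [mul_comm (F _ _)]
  rfl

theorem MemH10.sub {U : Set (Space N)} {u v : Space N → ℝ} {du dv : Space N → Fin N → ℝ}
    (hu : MemH10 U u du) (hv : MemH10 U v dv) :
    MemH10 U (fun x => u x - v x) (fun x i => du x i - dv x i) := by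
  obtain ⟨φ, hφ, h1, h2⟩ := hu.approx
  obtain ⟨ψ, hψ, h1', h2'⟩ := hv.approx
  have key : ∀ {f f' : Space N → ℝ} {p p' : ℕ → Space N → ℝ},
      MemLp f 2 (volume.restrict U) → MemLp f' 2 (volume.restrict U) →
      (∀ n, MemLp (p n) 2 (volume.restrict U)) → (∀ n, MemLp (p' n) 2 (volume.restrict U)) →
      Tendsto (fun n => eLpNorm (fun x => p n x - f x) 2 (volume.restrict U)) atTop (𝓝 0) →
      Tendsto (fun n => eLpNorm (fun x => p' n x - f' x) 2 (volume.restrict U)) atTop (𝓝 0) →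
      Tendsto (fun n => eLpNorm (fun x => (p n x - p' n x) - (f x - f' x)) 2 (volume.restrict U))
        atTop (𝓝 0) := by
    intro f f' p p' hf hf' hp hp' t t'
    refine tendsto_of_tendsto_of_tendsto_of_le_of_le tendsto_const_nhds
      (by simpa using t.add t') (fun _ => zero_le) fun n => ?_
    have : (fun x => (p n x - p' n x) - (f x - f' x)) =
      (fun x => p n x - f x) - fun x => p' n x - f' x := by ext x; simp; ring
    rw [this]
    exact eLpNorm_sub_le ((hp n).sub hf).1 ((hp' n).sub hf').1 (by norm_num)
  refine ⟨hu.memLp.sub hv.memLp, fun i => (hu.memLp_grad i).sub (hv.memLp_grad i),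
    fun n x => φ n x - ψ n x, fun n => (hφ n).sub (hψ n),
    key hu.memLp hv.memLp (fun n => (hφ n).toC1.memLp) (fun n => (hψ n).toC1.memLp) h1 h1',
    fun i => ?_⟩
  have := key (hu.memLp_grad i) (hv.memLp_grad i)
    (fun n => (hφ n).toC1.memLp_fderiv (unitVec i))
    (fun n => (hψ n).toC1.memLp_fderiv (unitVec i)) (h2 i) (h2' i)
  refine this.congr fun n => ?_
  congr 1
  ext x
  unfold partialDeriv
  rw [fderiv_fun_sub ((hφ n).toC1.contDiff.differentiable (by simp) x)
    ((hψ n).toC1.contDiff.differentiable (by simp) x)]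
  simp

/-- The Poincaré inequality for test functions: integrate `∂ᵢ(xᵢ φ²)`. -/
theorem poincare_test {U : Set (Space N)} {R : ℝ} (hR : ∀ x ∈ U, ‖x‖ ≤ R) (i : Fin N)
    {φ : Space N → ℝ} (hφ : IsTestFunction U φ) :
    ∫ x in U, φ x ^ 2 ≤ 4 * R ^ 2 * ∫ x in U, partialDeriv i φ x ^ 2 := by
  have hsq : IsTestFunction U (fun x => φ x * φ x) := hφ.mul_left hφ.smooth
  have hcoord : ContDiff ℝ 1 fun x : Space N => x i := by fun_prop
  have e := integral_mul_fderiv_of_contDiffOn (μ := volume) isOpen_univ hcoord.contDiffOn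
    (hsq.toC1.mono (subset_univ _)) (unitVec i)
  have hd : ∀ x : Space N, fderiv ℝ (fun x : Space N => x i) x (unitVec i) = 1 := by
    intro x
    have : (fun x : Space N => x i) = EuclideanSpace.proj (𝕜 := ℝ) i := rfl
    rw [this, ContinuousLinearMap.fderiv]
    simp [unitVec]
  have hφd := hφ.toC1.contDiff.differentiable (by simp)
  have hd2 : ∀ x, fderiv ℝ (fun x => φ x * φ x) x (unitVec i) =
      2 * (φ x * partialDeriv i φ x) := by
    intro x
    rw [fderiv_fun_mul (hφd x) (hφd x)]
    simp [partialDeriv]; ring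
  simp_rw [hd, hd2, one_mul] at e
  have m1 : MemLp φ 2 volume := hφ.toC1.memLp
  have m2 : MemLp (partialDeriv i φ) 2 volume := hφ.toC1.memLp_fderiv _
  have z1 : ∫ x in U, φ x ^ 2 = ∫ x, φ x * φ x := by
    simp_rw [sq]; exact setIntegral_eq_of_tsupport hφ.support_subset _
  have z2 : ∫ x in U, partialDeriv i φ x ^ 2 = ∫ x, partialDeriv i φ x ^ 2 := by
    simp_rw [sq]
    exact setIntegral_eq_of_tsupport
      ((tsupport_fderiv_apply_subset' φ _).trans hφ.support_subset) _
  rw [z1, z2]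
  have i1 : Integrable fun x => φ x * φ x := memLp_two_integrable_mul m1 m1
  have i2 : Integrable fun x => partialDeriv i φ x ^ 2 := m2.integrable_sq
  have le : -∫ x : Space N, x i * (2 * (φ x * partialDeriv i φ x)) ≤
      ∫ x, (1 / 2 * (φ x * φ x) + 2 * R ^ 2 * partialDeriv i φ x ^ 2) := by
    rw [← integral_neg]
    refine integral_mono ?_ ((i1.const_mul _).add (i2.const_mul _)) fun x => ?_
    · refine (Continuous.integrable_of_hasCompactSupport ?_ ?_).neg
      · exact hcoord.continuous.mul (continuous_const.mul
          (hφ.toC1.continuous.mul (hφ.toC1.continuous_fderiv_apply _)))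
      · exact ((hφ.compact.mul_right).mul_left).mul_left
    · by_cases hx : x ∈ U
      · have h1 : x i ^ 2 ≤ R ^ 2 := by
          have := (PiLp.norm_apply_le x i).trans (hR x hx)
          rw [Real.norm_eq_abs] at this
          exact sq_le_sq' (by linarith [abs_le.1 this]) (abs_le.1 this).2
        have h2 := mul_le_mul_of_nonneg_right h1 (sq_nonneg (partialDeriv i φ x))
        -- Young's inequality: `-2 xᵢ φ ∂ᵢφ ≤ φ² / 2 + 2 xᵢ² (∂ᵢφ)²`
        have h3 := sq_nonneg (φ x + 2 * x i * partialDeriv i φ x)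
        simp only
        nlinarith
      · simp [hφ.toC1.eq_zero hx, partialDeriv, hφ.toC1.fderiv_eq_zero hx]
  rw [integral_add (i1.const_mul _) (i2.const_mul _), integral_const_mul, integral_const_mul] at le
  linarith

/-- The Poincaré inequality on `H¹₀` of a bounded set. -/
theorem MemH10.poincare {U : Set (Space N)} {R : ℝ} (hR : ∀ x ∈ U, ‖x‖ ≤ R) (i : Fin N)
    {u : Space N → ℝ} {g : Space N → Fin N → ℝ} (h : MemH10 U u g) :
    ∫ x in U, u x ^ 2 ≤ 4 * R ^ 2 * ∫ x in U, g x i ^ 2 := by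
  obtain ⟨φ, hφ, h1, h2⟩ := h.approx
  exact le_of_tendsto_of_tendsto'
    (tendsto_integral_sq_of_eLpNorm (fun n => (hφ n).toC1.memLp) h.memLp h1)
    ((tendsto_integral_sq_of_eLpNorm (fun n => (hφ n).toC1.memLp_fderiv (unitVec i))
      (h.memLp_grad i) (h2 i)).const_mul _)
    fun n => poincare_test hR i (hφ n)

/-! ### Mollification -/

/-- A sequence of mollifiers; the `n`-th one has support of radius `2 / (n + 1)`. -/
noncomputable def mollifier (N : ℕ) (n : ℕ) : ContDiffBump (0 : Space N) where
  rIn := 1 / (n + 1)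
  rOut := 2 * (1 / (n + 1))
  rIn_pos := by positivity
  rIn_lt_rOut := by
    have : (0 : ℝ) < 1 / (n + 1) := by positivity
    linarith

theorem tendsto_mollifier_rOut : Tendsto (fun n => (mollifier N n).rOut) atTop (𝓝 0) := by
  have := (tendsto_one_div_add_atTop_nhds_zero_nat (𝕜 := ℝ)).const_mul 2
  simpa [mollifier] using this

/-- The convolution of `u` with the `n`-th mollifier. -/
noncomputable def mollify (n : ℕ) (u : Space N → ℝ) (x : Space N) : ℝ :=
  ∫ t, (mollifier N n).normed volume t * u (x - t)

theorem mollify_eq_convolution (n : ℕ) (u : Space N → ℝ) :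
    mollify n u = convolution ((mollifier N n).normed volume) u
      (ContinuousLinearMap.lsmul ℝ ℝ) volume := by
  ext x; rfl

theorem mollify_eq_swap (n : ℕ) (u : Space N → ℝ) (x : Space N) :
    mollify n u x = ∫ t, u t * (mollifier N n).normed volume (x - t) := by
  rw [mollify_eq_convolution, convolution_eq_swap]
  simp [mul_comm]

theorem contDiff_mollify (n : ℕ) {u : Space N → ℝ} (hu : LocallyIntegrable u) :
    ContDiff ℝ ∞ (mollify n u) := by
  rw [mollify_eq_convolution]
  exact (mollifier N n).hasCompactSupport_normed.contDiff_convolution_left _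
    (mollifier N n).contDiff_normed hu

theorem hasCompactSupport_mollify (n : ℕ) {u : Space N → ℝ} (hu : HasCompactSupport u) :
    HasCompactSupport (mollify n u) := by
  rw [mollify_eq_convolution]
  exact (mollifier N n).hasCompactSupport_normed.convolution _ hu

theorem tsupport_mollify_subset (n : ℕ) {u : Space N → ℝ} :
    tsupport (mollify n u) ⊆ Metric.cthickening ((mollifier N n).rOut) (tsupport u) := by
  refine closure_minimal (fun x hx => ?_) Metric.isClosed_cthickening
  rw [mollify_eq_convolution] at hx
  obtain ⟨a, ha, b, hb, rfl⟩ := support_convolution_subset _ hx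
  rw [ContDiffBump.support_normed_eq, mem_ball_zero_iff] at ha
  refine Metric.mem_cthickening_of_dist_le _ b _ _ (subset_tsupport _ hb) ?_
  simpa using ha.le

theorem fderiv_mollify_of_contDiff (n : ℕ) {u : Space N → ℝ} (hu : ContDiff ℝ 1 u)
    (hc : HasCompactSupport u) (x v : Space N) :
    fderiv ℝ (mollify n u) x v = mollify n (fun y => fderiv ℝ u y v) x := by
  have hl : LocallyIntegrable ((mollifier N n).normed volume) (volume : Measure (Space N)) :=
    (mollifier N n).continuous_normed.locallyIntegrable
  rw [mollify_eq_convolution, mollify_eq_convolution,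
    (hc.hasFDerivAt_convolution_right (ContinuousLinearMap.lsmul ℝ ℝ) hl hu x).fderiv,
    convolution_precompR_apply _ hl (hc.fderiv ℝ) (hu.continuous_fderiv (by simp))]

/-- Mollifications of `f ∈ C_c` converge uniformly and have supports in a fixed compact set, so they
converge in `L²`. -/
theorem tendsto_eLpNorm_mollify_sub {U : Set (Space N)} {f : Space N → ℝ} (hf : Continuous f)
    (hc : HasCompactSupport f) :
    Tendsto (fun n => eLpNorm (fun x => mollify n f x - f x) 2 (volume.restrict U))
      atTop (𝓝 0) := by
  set K : Set (Space N) := Metric.cthickening 2 (tsupport f) with hK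
  have hKc : IsCompact K := hc.isCompact.cthickening
  have hvol : (volume.restrict K) univ ^ (2 : ENNReal).toReal⁻¹ ≠ ⊤ := by
    refine (ENNReal.rpow_lt_top_of_nonneg (by norm_num) ?_).ne
    simpa using hKc.measure_lt_top.ne
  set V := (volume.restrict K) univ ^ (2 : ENNReal).toReal⁻¹
  have hz : ∀ n, ∀ x ∉ K, mollify n f x - f x = 0 := by
    intro n x hx
    have h1 : x ∉ tsupport f := fun h => hx (Metric.self_subset_cthickening _ h)
    have h2 : x ∉ tsupport (mollify n f) := fun h => hx
      (Metric.cthickening_mono (by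
        simp only [mollifier]
        have : (1 : ℝ) / (n + 1) ≤ 1 := by
          rw [div_le_one (by positivity)]; linarith [n.cast_nonneg (α := ℝ)]
        linarith) _ (tsupport_mollify_subset n h))
    rw [image_eq_zero_of_notMem_tsupport h1, image_eq_zero_of_notMem_tsupport h2, sub_zero]
  have hb : ∀ δ > 0, ∀ᶠ n in atTop, ∀ x, |mollify n f x - f x| ≤ δ := by
    intro δ hδ
    obtain ⟨r, hr, hr'⟩ := Metric.uniformContinuous_iff.1
      (hc.uniformContinuous_of_continuous hf) δ hδ
    filter_upwards [(tendsto_order.1 (tendsto_mollifier_rOut (N := N))).2 r hr] with n hn x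
    rw [mollify_eq_convolution, ← Real.dist_eq]
    exact ContDiffBump.dist_normed_convolution_le hf.aestronglyMeasurable
      fun y hy => (hr' ((Metric.mem_ball.1 hy).trans hn)).le
  have hle : ∀ δ > 0, ∀ᶠ n in atTop,
      eLpNorm (fun x => mollify n f x - f x) 2 (volume.restrict U) ≤ V * ENNReal.ofReal δ := by
    intro δ hδ
    filter_upwards [hb δ hδ] with n hn
    calc _ ≤ eLpNorm (fun x => mollify n f x - f x) 2 volume :=
          eLpNorm_mono_measure _ Measure.restrict_le_self
      _ = eLpNorm (K.indicator fun x => mollify n f x - f x) 2 volume := by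
          congr 1; ext x
          by_cases hx : x ∈ K
          · simp [hx]
          · simp [hx, hz n x hx]
      _ = eLpNorm (fun x => mollify n f x - f x) 2 (volume.restrict K) :=
          eLpNorm_indicator_eq_eLpNorm_restrict hKc.measurableSet
      _ ≤ _ := eLpNorm_le_of_ae_bound (Eventually.of_forall hn)
  rw [ENNReal.tendsto_nhds_zero]
  intro ε hε
  have ht : Tendsto (fun δ : ℝ => V * ENNReal.ofReal δ) (𝓝[>] 0) (𝓝 0) := by
    have : Tendsto (fun δ : ℝ => V * ENNReal.ofReal δ) (𝓝 0) (𝓝 (V * ENNReal.ofReal 0)) :=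
      ENNReal.Tendsto.const_mul (ENNReal.continuous_ofReal.tendsto 0) (Or.inr hvol)
    simpa using this.mono_left nhdsWithin_le_nhds
  obtain ⟨δ, h1, h2⟩ := ((ENNReal.tendsto_nhds_zero.1 ht ε hε).and self_mem_nhdsWithin).exists
  filter_upwards [hle δ h2] with n hn
  exact hn.trans h1

/-- `C_c¹` functions belong to `H¹₀`: they are approximated by their mollifications. -/
theorem IsC1TestFunction.memH10 {U : Set (Space N)} (hU : IsOpen U) {ψ : Space N → ℝ}
    (hψ : IsC1TestFunction U ψ) : MemH10 U ψ (fun x i => partialDeriv i ψ x) := by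
  obtain ⟨δ, hδ, hδU⟩ := hψ.compact.isCompact.exists_cthickening_subset_open hU hψ.support_subset
  obtain ⟨n₀, hn₀⟩ := eventually_atTop.1
    ((tendsto_order.1 (tendsto_mollifier_rOut (N := N))).2 δ hδ)
  refine ⟨hψ.memLp, fun i => hψ.memLp_fderiv _, fun n => mollify (n + n₀) ψ, fun n => ?_,
    ?_, fun i => ?_⟩
  · exact ⟨contDiff_mollify _ hψ.continuous.locallyIntegrable,
      hasCompactSupport_mollify _ hψ.compact, ((tsupport_mollify_subset _).trans
        (Metric.cthickening_mono (hn₀ _ (by omega)).le _)).trans hδU⟩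
  · exact (tendsto_eLpNorm_mollify_sub hψ.continuous hψ.compact).comp (tendsto_add_atTop_nat n₀)
  · have := (tendsto_eLpNorm_mollify_sub (U := U) (hψ.continuous_fderiv_apply (unitVec i))
      (hψ.hasCompactSupport_fderiv_apply _)).comp (tendsto_add_atTop_nat n₀)
    refine this.congr fun n => ?_
    simp only [Function.comp, partialDeriv, fderiv_mollify_of_contDiff _ hψ.contDiff hψ.compact]

/-- A weak identity for test functions extends to `C_c¹` functions. -/
theorem IsC1TestFunction.integral_eq_of_test {U : Set (Space N)} (hU : IsOpen U)
    {F : Fin N → Space N → ℝ} {f : Space N → ℝ} (hF : ∀ i, MemLp (F i) 2 (volume.restrict U))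
    (hf : MemLp f 2 (volume.restrict U))
    (hw : ∀ φ, IsTestFunction U φ →
      ∫ x in U, ∑ i, F i x * partialDeriv i φ x = ∫ x in U, f x * φ x)
    {ψ : Space N → ℝ} (hψ : IsC1TestFunction U ψ) :
    ∫ x in U, ∑ i, F i x * partialDeriv i ψ x = ∫ x in U, f x * ψ x :=
  (hψ.memH10 hU).integral_eq_of_test hF hf hw

/-! ### Functions in `H¹(Ω)` and weak solutions -/

theorem MemH1Trace.hasWeakGrad {Ω V : Set (Space N)}
    (hΩ : Bornology.IsBounded Ω) (hVΩ : V ⊆ Ω) {u : Space N → ℝ}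
    {g : Space N → Fin N → ℝ} {t : Space N → ℝ} (h : MemH1Trace Ω u g t) : HasWeakGrad V u g := by
  intro i
  refine .of_integral_eq ((locallyIntegrableOn_of_memLp_two h.memLp).mono_set hVΩ)
    ((locallyIntegrableOn_of_memLp_two (h.memLp_grad i)).mono_set hVΩ) fun ψ hψ => ?_
  have hψΩ := hψ.mono hVΩ
  obtain ⟨φ, hφ, h1, h2, -⟩ := h.approx
  have hs := (tsupport_fderiv_apply_subset' ψ (unitVec i)).trans hψΩ.support_subset
  rw [← setIntegral_eq_of_tsupport hψΩ.support_subset, ← setIntegral_eq_of_tsupport hs]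
  have hφ1 : ∀ n, ContDiff ℝ 1 (φ n) := fun n => contDiff_infty.1 (hφ n) 1
  have t1 := tendsto_integral_mul_of_eLpNorm
    (fun n => memLp_two_of_continuous_of_isBounded hΩ (hφ1 n).continuous) h.memLp
    (hψ.toC1.memLp_fderiv (unitVec i)) h1
  have t2 := tendsto_integral_mul_of_eLpNorm
    (fun n => memLp_two_of_continuous_of_isBounded hΩ
      (((hφ1 n).continuous_fderiv (by simp)).clm_apply continuous_const)) (h.memLp_grad i)
    hψ.toC1.memLp (h2 i)
  refine tendsto_nhds_unique t1 ((t2.neg).congr fun n => ?_)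
  rw [setIntegral_eq_of_tsupport hψΩ.support_subset, setIntegral_eq_of_tsupport hs]
  exact (integral_mul_fderiv_of_contDiffOn isOpen_univ (hφ1 n).contDiffOn
    (hψ.toC1.mono (subset_univ _)) (unitVec i)).symm

/-- Test functions are admissible in the weak formulation, with trace zero. -/
theorem IsTestFunction.memH1Trace {Ω : Set (Space N)} (hΩ : IsOpen Ω) {φ : Space N → ℝ}
    (hφ : IsTestFunction Ω φ) :
    MemH1Trace Ω φ (fun x i => partialDeriv i φ x) (fun _ => 0) := by
  refine ⟨hφ.toC1.memLp, fun i => hφ.toC1.memLp_fderiv _, MemLp.zero, fun _ => φ,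
    fun _ => hφ.smooth, by simp, by simp, ?_⟩
  have h0 : ∀ᵐ x ∂(surfaceMeasure N).restrict (frontier Ω), φ x - 0 = 0 := by
    refine (ae_restrict_iff' isClosed_frontier.measurableSet).2
      (Eventually.of_forall fun x hx => ?_)
    rw [sub_zero]
    refine hφ.toC1.eq_zero fun hxΩ => ?_
    rw [hΩ.frontier_eq] at hx
    exact hx.2 hxΩ
  simp_rw [eLpNorm_congr_ae h0]
  simp

theorem piecewiseCoeff_eq {K : ℕ} {Ωs : Fin K → Set (Space N)}
    (hdisj : Pairwise (fun s r => Disjoint (Ωs s) (Ωs r)))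
    (A : Fin K → Space N → Matrix (Fin N) (Fin N) ℝ) {s : Fin K} {x : Space N} (hx : x ∈ Ωs s) :
    piecewiseCoeff Ωs A x = A s x := by
  rw [piecewiseCoeff, Finset.sum_eq_single s, indicator_of_mem hx]
  · intro r _ hr
    exact indicator_of_notMem (fun hxr => (hdisj hr).le_bot ⟨hxr, hx⟩) _
  · simp

/-- Tested with `φ ∈ C_c^∞(Ω_s)`, the weak form involves only the coefficient in `Ω_s`. -/
theorem IsWeakSolution.integral_eq_of_test {K : ℕ} {Ω ΓT Γq : Set (Space N)} (hΩ : IsOpen Ω)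
    {Ωs : Fin K → Set (Space N)} (hsub : ∀ s, Ωs s ⊆ Ω)
    (hdisj : Pairwise (fun s r => Disjoint (Ωs s) (Ωs r)))
    {A : Fin K → Space N → Matrix (Fin N) (Fin N) ℝ} {h That q T : Space N → ℝ}
    {dT : Space N → Fin N → ℝ} (hT : IsWeakSolution Ω ΓT Γq (piecewiseCoeff Ωs A) h That q T dT)
    (s : Fin K) {φ : Space N → ℝ} (hφ : IsTestFunction (Ωs s) φ) :
    ∫ x in Ωs s, ∑ i, ∑ j, A s x i j * dT x j * partialDeriv i φ x =
      ∫ x in Ωs s, h x * φ x := by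
  have hφΩ := hφ.mono (hsub s)
  have e := hT.2 φ _ _ (hφΩ.memH1Trace hΩ) (ae_eq_refl _)
  have hz : ∀ x ∉ Ωs s, ∀ i, partialDeriv i φ x = 0 := fun x hx i => by
    simp [partialDeriv, hφ.toC1.fderiv_eq_zero hx]
  have e1 : ∫ x in Ωs s, ∑ i, ∑ j, A s x i j * dT x j * partialDeriv i φ x =
      ∫ x in Ω, ∑ i, ∑ j, piecewiseCoeff Ωs A x i j * dT x j * partialDeriv i φ x := by
    have : ∀ x, (∑ i, ∑ j, piecewiseCoeff Ωs A x i j * dT x j * partialDeriv i φ x) =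
        ∑ i, ∑ j, A s x i j * dT x j * partialDeriv i φ x := by
      intro x
      by_cases hx : x ∈ Ωs s
      · rw [piecewiseCoeff_eq hdisj A hx]
      · simp [hz x hx]
    simp_rw [this]
    rw [setIntegral_eq_integral_of_forall_compl_eq_zero,
      setIntegral_eq_integral_of_forall_compl_eq_zero]
    · intro x hx; simp [hz x fun h' => hx (hsub s h')]
    · intro x hx; simp [hz x hx]
  rw [e1, e, setIntegral_eq_of_tsupport hφΩ.support_subset,
    setIntegral_eq_of_tsupport hφ.support_subset]
  simp

/-! ### The Dirichlet problem in divergence form -/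

/-- `A` is, almost everywhere on `U`, symmetric with `γ₀ |ξ|² ≤ A ξ · ξ ≤ γ₁ |ξ|²`, and its entries
are measurable. -/
structure IsElliptic (U : Set (Space N)) (A : Space N → Matrix (Fin N) (Fin N) ℝ)
    (γ₀ γ₁ : ℝ) : Prop where
  measurable : ∀ i j, Measurable fun y => A y i j
  symm : ∀ᵐ y ∂volume.restrict U, (A y).IsSymm
  elliptic : ∀ᵐ y ∂volume.restrict U, ∀ ξ : Space N,
    γ₀ * ‖ξ‖ ^ 2 ≤ ∑ i, ∑ j, A y i j * ξ i * ξ j ∧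
      ∑ i, ∑ j, A y i j * ξ i * ξ j ≤ γ₁ * ‖ξ‖ ^ 2

/-- By polarization, `4 A_ij` is the difference of the values of the form at `e_i + e_j` and at
`e_i - e_j`, both of which lie between `0` and `4 γ₁`. -/
theorem abs_entry_le_of_quadratic_bounds {A : Matrix (Fin N) (Fin N) ℝ} {γ₀ γ₁ : ℝ} (h₀ : 0 ≤ γ₀)
    (hs : A.IsSymm) (h : ∀ ξ : Space N, γ₀ * ‖ξ‖ ^ 2 ≤ ∑ i, ∑ j, A i j * ξ i * ξ j ∧
      ∑ i, ∑ j, A i j * ξ i * ξ j ≤ γ₁ * ‖ξ‖ ^ 2) (i j : Fin N) : |A i j| ≤ γ₁ := by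
  have hq : ∀ (a b : ℝ), ∑ p, ∑ q, A p q * (a • unitVec i + b • unitVec j : Space N) p *
      (a • unitVec i + b • unitVec j : Space N) q =
      a ^ 2 * A i i + 2 * (a * b * A i j) + b ^ 2 * A j j := by
    intro a b
    have hsym : A j i = A i j := by
      conv_lhs => rw [← hs]
      rfl
    simp only [unitVec, PiLp.add_apply, PiLp.smul_apply, PiLp.single_apply, smul_eq_mul, mul_add,
      add_mul, Finset.sum_add_distrib, mul_ite, ite_mul, mul_one, mul_zero, zero_mul,
      Finset.sum_ite_eq', Finset.mem_univ, if_true]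
    simp [hsym]
    ring
  have hn : ∀ a b : ℝ, ‖(a • unitVec i + b • unitVec j : Space N)‖ ^ 2 ≤ 2 * (a ^ 2 + b ^ 2) := by
    intro a b
    have h1 : ‖(a • unitVec i + b • unitVec j : Space N)‖ ≤ |a| + |b| := by
      refine (norm_add_le _ _).trans ?_
      simp [norm_smul, unitVec]
    have := pow_le_pow_left₀ (norm_nonneg _) h1 2
    nlinarith [sq_abs a, sq_abs b, sq_nonneg (|a| - |b|)]
  have h1 := (h (unitVec i)).1.trans (h (unitVec i)).2
  have h2 : ‖(unitVec i : Space N)‖ = 1 := by simp [unitVec]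
  rw [h2] at h1
  have p1 := h ((1 : ℝ) • unitVec i + (1 : ℝ) • unitVec j)
  have p2 := h ((1 : ℝ) • unitVec i + (-1 : ℝ) • unitVec j)
  have n1 := hn 1 1
  have n2 := hn 1 (-1)
  rw [hq] at p1 p2
  have c1 := mul_nonneg h₀ (sq_nonneg ‖((1 : ℝ) • unitVec i + (1 : ℝ) • unitVec j : Space N)‖)
  have c2 := mul_nonneg h₀ (sq_nonneg ‖((1 : ℝ) • unitVec i + (-1 : ℝ) • unitVec j : Space N)‖)
  have hγ₁ : 0 ≤ γ₁ := by linarith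
  have d1 := mul_le_mul_of_nonneg_left n1 hγ₁
  have d2 := mul_le_mul_of_nonneg_left n2 hγ₁
  rw [_root_.abs_le]
  constructor <;> linarith

theorem IsElliptic.abs_le {U : Set (Space N)} {A : Space N → Matrix (Fin N) (Fin N) ℝ}
    {γ₀ γ₁ : ℝ} (h₀ : 0 ≤ γ₀) (hA : IsElliptic U A γ₀ γ₁) (i j : Fin N) :
    ∀ᵐ y ∂volume.restrict U, |A y i j| ≤ γ₁ := by
  filter_upwards [hA.symm, hA.elliptic] with y h1 h2
  exact abs_entry_le_of_quadratic_bounds h₀ h1 h2 i j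

theorem IsElliptic.memLp_mul {U : Set (Space N)} {A : Space N → Matrix (Fin N) (Fin N) ℝ}
    {γ₀ γ₁ : ℝ} (h₀ : 0 ≤ γ₀) (hA : IsElliptic U A γ₀ γ₁) {f : Space N → ℝ}
    (hf : MemLp f 2 (volume.restrict U)) (i j : Fin N) :
    MemLp (fun x => A x i j * f x) 2 (volume.restrict U) :=
  hf.mul_bdd (hA.measurable i j).aestronglyMeasurable (hA.abs_le h₀ i j)

section LaxMilgram

variable (U : Set (Space N))

/-- `L²(U)`. -/
abbrev L2Space : Type := Lp ℝ 2 ((volume : Measure (Space N)).restrict U)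

/-- The Hilbert space `L²(U) × L²(U)ᴺ` of functions and vector fields; the component `none` is the
function and `some i` is the `i`-th component of the field. -/
abbrev GradSpace : Type := PiLp 2 fun _ : Option (Fin N) => L2Space U

variable {U}

/-- The element of `L²(U) × L²(U)ᴺ` given by a function and a vector field. -/
noncomputable def gradVec {u : Space N → ℝ} {g : Space N → Fin N → ℝ}
    (hu : MemLp u 2 (volume.restrict U)) (hg : ∀ i, MemLp (fun x => g x i) 2 (volume.restrict U)) :
    GradSpace U :=
  WithLp.toLp 2 fun o => o.elim (hu.toLp u) fun i => (hg i).toLp fun x => g x i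

theorem IsTestFunction.memLp_grad {φ : Space N → ℝ} (h : IsTestFunction U φ) (i : Fin N) :
    MemLp (fun x => partialDeriv i φ x) 2 (volume.restrict U) :=
  h.toC1.memLp_fderiv _

theorem gradVec_congr {u u' : Space N → ℝ} {g g' : Space N → Fin N → ℝ}
    (hu : MemLp u 2 (volume.restrict U)) (hg : ∀ i, MemLp (fun x => g x i) 2 (volume.restrict U))
    (hu' : MemLp u' 2 (volume.restrict U))
    (hg' : ∀ i, MemLp (fun x => g' x i) 2 (volume.restrict U)) (h : u = u') (h' : g = g') :
    gradVec hu hg = gradVec hu' hg' := by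
  subst h h'; rfl

theorem partialDeriv_add {i : Fin N} {φ ψ : Space N → ℝ} (h : Differentiable ℝ φ)
    (h' : Differentiable ℝ ψ) (x : Space N) :
    partialDeriv i (fun x => φ x + ψ x) x = partialDeriv i φ x + partialDeriv i ψ x := by
  simp [partialDeriv, fderiv_fun_add (h x) (h' x)]

theorem partialDeriv_const_mul {i : Fin N} {φ : Space N → ℝ} (h : Differentiable ℝ φ) (c : ℝ)
    (x : Space N) : partialDeriv i (fun x => c * φ x) x = c * partialDeriv i φ x := by
  simp [partialDeriv, fderiv_const_mul (h x)]

theorem IsTestFunction.differentiable {φ : Space N → ℝ} (h : IsTestFunction U φ) :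
    Differentiable ℝ φ := h.toC1.contDiff.differentiable (by simp)

theorem gradVec_add {u u' : Space N → ℝ} {g g' : Space N → Fin N → ℝ}
    (hu : MemLp u 2 (volume.restrict U)) (hg : ∀ i, MemLp (fun x => g x i) 2 (volume.restrict U))
    (hu' : MemLp u' 2 (volume.restrict U))
    (hg' : ∀ i, MemLp (fun x => g' x i) 2 (volume.restrict U)) :
    gradVec (g := fun x i => g x i + g' x i) (hu.add hu') (fun i => (hg i).add (hg' i)) =
      gradVec hu hg + gradVec hu' hg' := by
  ext1 o
  cases o with
  | none => exact MemLp.toLp_add hu hu'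
  | some i => exact MemLp.toLp_add (hg i) (hg' i)

theorem gradVec_smul {u : Space N → ℝ} {g : Space N → Fin N → ℝ} (c : ℝ)
    (hu : MemLp u 2 (volume.restrict U)) (hg : ∀ i, MemLp (fun x => g x i) 2 (volume.restrict U)) :
    gradVec (g := fun x i => c * g x i) (hu.const_mul c) (fun i => (hg i).const_mul c) =
      c • gradVec hu hg := by
  ext1 o
  cases o with
  | none => exact MemLp.toLp_const_smul c hu
  | some i => exact MemLp.toLp_const_smul c (hg i)

variable (U) in
/-- The subspace `{(φ, ∇φ) : φ ∈ C_c^∞(U)}`. -/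
noncomputable def testGradSubmodule : Submodule ℝ (GradSpace U) where
  carrier := {F | ∃ (φ : Space N → ℝ) (h : IsTestFunction U φ),
    F = gradVec (g := fun x i => partialDeriv i φ x) h.toC1.memLp h.memLp_grad}
  zero_mem' := by
    refine ⟨fun _ => 0, .zero U, ?_⟩
    rw [← zero_smul ℝ (gradVec (U := U) (g := fun x i => partialDeriv i (fun _ => (0 : ℝ)) x)
      (IsTestFunction.zero U).toC1.memLp (IsTestFunction.zero U).memLp_grad), ← gradVec_smul]
    refine gradVec_congr _ _ _ _ (by simp) ?_
    ext x i
    simp [partialDeriv]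
  add_mem' := by
    rintro _ _ ⟨φ, h, rfl⟩ ⟨ψ, h', rfl⟩
    refine ⟨_, h.add h', ?_⟩
    rw [← gradVec_add]
    refine gradVec_congr _ _ _ _ rfl ?_
    ext x i
    exact (partialDeriv_add h.differentiable h'.differentiable x).symm
  smul_mem' := by
    rintro c _ ⟨φ, h, rfl⟩
    refine ⟨_, h.const_mul c, ?_⟩
    rw [← gradVec_smul]
    refine gradVec_congr _ _ _ _ rfl ?_
    ext x i
    exact (partialDeriv_const_mul h.differentiable c x).symm

variable (U) in
/-- `H¹₀(U)` as a closed subspace of `L²(U) × L²(U)ᴺ`. -/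
noncomputable def h10Submodule : Submodule ℝ (GradSpace U) :=
  (testGradSubmodule U).topologicalClosure

theorem gradVec_mem_h10Submodule {φ : Space N → ℝ} (h : IsTestFunction U φ) :
    gradVec (g := fun x i => partialDeriv i φ x) h.toC1.memLp h.memLp_grad ∈ h10Submodule U :=
  Submodule.le_topologicalClosure _ ⟨φ, h, rfl⟩

theorem memH10_of_mem_h10Submodule {F : GradSpace U} (hF : F ∈ h10Submodule U) :
    MemH10 U (F none) (fun x i => F (some i) x) := by
  obtain ⟨f, hf, hlim⟩ := mem_closure_iff_seq_limit.1
    (show F ∈ closure (testGradSubmodule U : Set (GradSpace U)) from hF)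
  choose φ hφ hfφ using hf
  have hcomp : ∀ o, Tendsto (fun n => f n o) atTop (𝓝 (F o)) := fun o =>
    ((PiLp.continuous_apply 2 _ o).tendsto F).comp hlim
  refine ⟨Lp.memLp _, fun i => Lp.memLp _, φ, hφ, ?_, fun i => ?_⟩
  · have := (Lp.tendsto_Lp_iff_tendsto_eLpNorm' _ _).1 (hcomp none)
    refine this.congr fun n => eLpNorm_congr_ae ?_
    rw [hfφ n]
    filter_upwards [(hφ n).toC1.memLp.coeFn_toLp] with x hx
    simp only [gradVec, Option.elim, Pi.sub_apply, hx]
  · have := (Lp.tendsto_Lp_iff_tendsto_eLpNorm' _ _).1 (hcomp (some i))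
    refine this.congr fun n => eLpNorm_congr_ae ?_
    rw [hfφ n]
    filter_upwards [((hφ n).memLp_grad i).coeFn_toLp] with x hx
    simp only [gradVec, Option.elim, Pi.sub_apply, hx]

/-- The energy form `∫_U A_ij F_j G_i` on `L²(U) × L²(U)ᴺ`. -/
noncomputable def energyForm {A : Space N → Matrix (Fin N) (Fin N) ℝ}
    (hA : ∀ i j, MemLp (fun x => A x i j) ⊤ (volume.restrict U)) :
    GradSpace U →L[ℝ] GradSpace U →L[ℝ] ℝ :=
  ∑ i, ∑ j, ((ContinuousLinearMap.mul ℝ ℝ).lpPairing (volume.restrict U) 2 2).bilinearComp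
    (((ContinuousLinearMap.mul ℝ ℝ).holderL (volume.restrict U) ⊤ 2 2 ((hA i j).toLp _)) ∘L
      PiLp.proj 2 (fun _ : Option (Fin N) => L2Space U) (some j))
    (PiLp.proj 2 (fun _ : Option (Fin N) => L2Space U) (some i))

theorem energyForm_apply {A : Space N → Matrix (Fin N) (Fin N) ℝ}
    (hA : ∀ i j, MemLp (fun x => A x i j) ⊤ (volume.restrict U)) (F G : GradSpace U) :
    energyForm hA F G = ∑ i, ∑ j, ∫ x in U, A x i j * F (some j) x * G (some i) x := by
  simp only [energyForm, _root_.sum_apply]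
  refine Finset.sum_congr rfl fun i _ => Finset.sum_congr rfl fun j _ => ?_
  rw [ContinuousLinearMap.bilinearComp_apply, ContinuousLinearMap.lpPairing_eq_integral]
  refine integral_congr_ae ?_
  filter_upwards
    [(ContinuousLinearMap.mul ℝ ℝ).coeFn_holder (r := 2) ((hA i j).toLp _) (F (some j)),
    (hA i j).coeFn_toLp] with x h1 h2
  have h3 : (((ContinuousLinearMap.mul ℝ ℝ).holderL (volume.restrict U) ⊤ 2 2 ((hA i j).toLp _)) ∘L
      PiLp.proj 2 (fun _ : Option (Fin N) => L2Space U) (some j)) F x =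
      A x i j * F (some j) x := by
    rw [← h2]; exact h1
  rw [h3]; rfl

theorem IsElliptic.energy_ge {A : Space N → Matrix (Fin N) (Fin N) ℝ} {γ₀ γ₁ : ℝ} (h₀ : 0 ≤ γ₀)
    (hA : IsElliptic U A γ₀ γ₁) {g : Space N → Fin N → ℝ}
    (hg : ∀ i, MemLp (fun x => g x i) 2 (volume.restrict U)) :
    γ₀ * ∑ i, ∫ x in U, g x i ^ 2 ≤ ∫ x in U, ∑ i, ∑ j, A x i j * g x j * g x i := by
  rw [← integral_finsetSum _ fun i _ => (hg i).integrable_sq, ← integral_const_mul]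
  refine integral_mono_ae ((integrable_finsetSum _ fun i _ => (hg i).integrable_sq).const_mul _)
    (integrable_finsetSum _ fun i _ => integrable_finsetSum _ fun j _ =>
      memLp_two_integrable_mul (hA.memLp_mul h₀ (hg j) i j) (hg i)) ?_
  filter_upwards [hA.elliptic] with x hx
  have := (hx (WithLp.toLp 2 (g x))).1
  rw [EuclideanSpace.norm_sq_eq] at this
  simp only [Real.norm_eq_abs, sq_abs] at this
  refine this.trans (le_of_eq ?_)
  refine Finset.sum_congr rfl fun i _ => Finset.sum_congr rfl fun j _ => by ring

theorem norm_sq_eq_integral (f : L2Space U) : ‖f‖ ^ 2 = ∫ x in U, f x ^ 2 := by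
  have h := norm_toLp_eq (Lp.memLp f)
  rw [Lp.toLp_coeFn] at h
  rw [h, Real.sq_sqrt (integral_nonneg fun x => sq_nonneg _)]

/-- Existence of a weak solution `u ∈ H¹₀(U)` of `-∂ᵢ(A_ij ∂ⱼ u) = f - ∂ᵢ Fᵢ` on a bounded set, by
the Lax-Milgram theorem. The index `i₀` provides the direction for the Poincaré inequality, which
fails for `N = 0`. -/
theorem IsElliptic.exists_dirichlet_solution {R : ℝ} (hR : ∀ x ∈ U, ‖x‖ ≤ R) (i₀ : Fin N)
    {A : Space N → Matrix (Fin N) (Fin N) ℝ} {γ₀ γ₁ : ℝ} (h₀ : 0 < γ₀) (hA : IsElliptic U A γ₀ γ₁)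
    {f : Space N → ℝ} {F : Space N → Fin N → ℝ} (hf : MemLp f 2 (volume.restrict U))
    (hF : ∀ i, MemLp (fun x => F x i) 2 (volume.restrict U)) :
    ∃ (u : Space N → ℝ) (du : Space N → Fin N → ℝ), MemH10 U u du ∧
      ∀ φ, IsTestFunction U φ →
        ∫ x in U, ∑ i, ∑ j, A x i j * du x j * partialDeriv i φ x =
          (∫ x in U, f x * φ x) + ∫ x in U, ∑ i, F x i * partialDeriv i φ x := by
  have hA' : ∀ i j, MemLp (fun x => A x i j) ⊤ (volume.restrict U) := fun i j =>
    memLp_top_of_bound (hA.measurable i j).aestronglyMeasurable γ₁ (hA.abs_le h₀.le i j)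
  let H := h10Submodule U
  have : CompleteSpace H := (Submodule.isClosed_topologicalClosure _).completeSpace_coe
  let B : H →L[ℝ] H →L[ℝ] ℝ := (energyForm hA').bilinearComp H.subtypeL H.subtypeL
  have hB : ∀ v w : H, B v w = ∑ i, ∑ j, ∫ x in U, A x i j * v.1 (some j) x * w.1 (some i) x :=
    fun v w => energyForm_apply hA' v.1 w.1
  have hint : ∀ (v w : GradSpace U) i j,
      Integrable (fun x => A x i j * v (some j) x * w (some i) x) (volume.restrict U) :=
    fun v w i j =>
      memLp_two_integrable_mul (hA.memLp_mul h₀.le (Lp.memLp (v (some j))) i j) (Lp.memLp _)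
  have hcoer : IsCoercive B := by
    -- `‖u‖² + ‖∇u‖² ≤ (1 + 4 R²) ‖∇u‖²` by the Poincaré inequality
    refine ⟨γ₀ / (1 + 4 * R ^ 2), by positivity, fun v => ?_⟩
    have hv := memH10_of_mem_h10Submodule v.2
    have h1 := hA.energy_ge h₀.le hv.memLp_grad
    have h2 := hv.poincare hR i₀
    simp_rw [← norm_sq_eq_integral] at h1 h2
    have h3 : ‖v.1 (some i₀)‖ ^ 2 ≤ ∑ i, ‖v.1 (some i)‖ ^ 2 :=
      Finset.single_le_sum (f := fun i => ‖v.1 (some i)‖ ^ 2) (fun i _ => sq_nonneg _)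
        (Finset.mem_univ i₀)
    have h4 : ‖v‖ * ‖v‖ = ‖v.1 none‖ ^ 2 + ∑ i, ‖v.1 (some i)‖ ^ 2 := by
      rw [← sq, Submodule.coe_norm, PiLp.norm_sq_eq_of_L2, Fintype.sum_option]
    have h5 : B v v = ∫ x in U, ∑ i, ∑ j, A x i j * v.1 (some j) x * v.1 (some i) x := by
      rw [hB, integral_finsetSum _ fun i _ => integrable_finsetSum _ fun j _ => hint _ _ i j]
      exact Finset.sum_congr rfl fun i _ => (integral_finsetSum _ fun j _ => hint _ _ i j).symm
    rw [mul_assoc, h4, h5]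
    refine le_trans ?_ h1
    rw [div_mul_eq_mul_div, div_le_iff₀ (by positivity), mul_assoc]
    refine mul_le_mul_of_nonneg_left ?_ h₀.le
    have := mul_le_mul_of_nonneg_left h3 (by positivity : 0 ≤ 4 * R ^ 2)
    linarith
  let ℓ : H →L[ℝ] ℝ := (innerSL ℝ (gradVec hf hF)) ∘L H.subtypeL
  let w : H := (InnerProductSpace.toDual ℝ H).symm ℓ
  let u : H := hcoer.continuousLinearEquivOfBilin.symm w
  have hu : ∀ v : H, B u v = inner ℝ (gradVec hf hF) v.1 := by
    intro v
    rw [← hcoer.continuousLinearEquivOfBilin_apply, ContinuousLinearEquiv.apply_symm_apply,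
      InnerProductSpace.toDual_symm_apply]
    rfl
  refine ⟨_, _, memH10_of_mem_h10Submodule u.2, fun φ hφ => ?_⟩
  have e := hu ⟨_, gradVec_mem_h10Submodule hφ⟩
  rw [hB, PiLp.inner_apply, Fintype.sum_option] at e
  simp only [gradVec, Option.elim] at e
  simp_rw [inner_toLp_eq] at e
  have hint' : ∀ i j, Integrable (fun x => A x i j * u.1 (some j) x * partialDeriv i φ x)
      (volume.restrict U) := fun i j =>
    memLp_two_integrable_mul (hA.memLp_mul h₀.le (Lp.memLp (u.1 (some j))) i j) (hφ.memLp_grad i)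
  rw [integral_finsetSum _ fun i _ => integrable_finsetSum _ fun j _ => hint' i j,
    integral_finsetSum _ fun i _ => memLp_two_integrable_mul (hF i) (hφ.memLp_grad i), ← e]
  refine Finset.sum_congr rfl fun i _ => ?_
  rw [integral_finsetSum _ fun j _ => hint' i j]
  refine Finset.sum_congr rfl fun j _ => integral_congr_ae ?_
  filter_upwards [(hφ.memLp_grad i).coeFn_toLp] with x hx
  rw [hx]

/-- Uniqueness for the Dirichlet problem: the difference of two solutions is an admissible test
function, so its energy vanishes. -/
theorem IsElliptic.dirichlet_unique {R : ℝ} (hR : ∀ x ∈ U, ‖x‖ ≤ R) (i₀ : Fin N)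
    {A : Space N → Matrix (Fin N) (Fin N) ℝ} {γ₀ γ₁ : ℝ} (h₀ : 0 < γ₀) (hA : IsElliptic U A γ₀ γ₁)
    {u v : Space N → ℝ} {du dv : Space N → Fin N → ℝ} (hu : MemH10 U u du) (hv : MemH10 U v dv)
    (h : ∀ φ, IsTestFunction U φ →
      ∫ x in U, ∑ i, ∑ j, A x i j * du x j * partialDeriv i φ x =
        ∫ x in U, ∑ i, ∑ j, A x i j * dv x j * partialDeriv i φ x) :
    u =ᵐ[volume.restrict U] v ∧ du =ᵐ[volume.restrict U] dv := by
  have hw := hu.sub hv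
  have hm : ∀ {g : Space N → Fin N → ℝ}, (∀ i, MemLp (fun x => g x i) 2 (volume.restrict U)) →
      ∀ i, MemLp (fun x => ∑ j, A x i j * g x j) 2 (volume.restrict U) := fun hg i =>
    memLp_two_sum _ fun j _ => hA.memLp_mul h₀.le (hg j) i j
  have e := hw.integral_eq_of_test (F := fun i x => ∑ j, A x i j * (du x j - dv x j))
    (f := fun _ => 0) (hm hw.memLp_grad) MemLp.zero fun φ hφ => by
      have hi : ∀ {g : Space N → Fin N → ℝ},
          (∀ i, MemLp (fun x => g x i) 2 (volume.restrict U)) →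
          Integrable (fun x => ∑ i, ∑ j, A x i j * g x j * partialDeriv i φ x)
            (volume.restrict U) := fun hg =>
        integrable_finsetSum _ fun i _ => integrable_finsetSum _ fun j _ =>
          memLp_two_integrable_mul (hA.memLp_mul h₀.le (hg j) i j) (hφ.memLp_grad i)
      have := sub_eq_zero.2 (h φ hφ)
      rw [← integral_sub (hi hu.memLp_grad) (hi hv.memLp_grad)] at this
      simp only [zero_mul, integral_zero]
      rw [← this]
      congr 1; ext x
      rw [← Finset.sum_sub_distrib]
      refine Finset.sum_congr rfl fun i _ => ?_
      rw [← Finset.sum_sub_distrib, Finset.sum_mul]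
      exact Finset.sum_congr rfl fun j _ => by ring
  have hE := hA.energy_ge h₀.le hw.memLp_grad
  simp_rw [← Finset.sum_mul] at hE
  simp only [zero_mul, integral_zero] at e
  rw [e] at hE
  have hsum : ∑ i, ∫ x in U, (du x i - dv x i) ^ 2 ≤ 0 := by
    by_contra hc
    push Not at hc
    linarith [mul_pos h₀ hc]
  have hnn : ∀ i, 0 ≤ ∫ x in U, (du x i - dv x i) ^ 2 := fun i =>
    integral_nonneg fun x => sq_nonneg _
  have hz : ∀ i, ∫ x in U, (du x i - dv x i) ^ 2 = 0 := fun i =>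
    le_antisymm ((Finset.single_le_sum (fun i _ => hnn i) (Finset.mem_univ i)).trans hsum) (hnn i)
  have hzero : ∀ {g : Space N → ℝ}, MemLp g 2 (volume.restrict U) → ∫ x in U, g x ^ 2 ≤ 0 →
      ∀ᵐ x ∂volume.restrict U, g x = 0 := by
    intro g hg hle
    have h0 := (integral_eq_zero_iff_of_nonneg (fun x => sq_nonneg (g x)) hg.integrable_sq).1
      (le_antisymm hle (integral_nonneg fun x => sq_nonneg _))
    filter_upwards [h0] with x hx
    simpa using hx
  refine ⟨?_, ?_⟩
  · have := hw.poincare hR i₀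
    rw [hz i₀, mul_zero] at this
    filter_upwards [hzero hw.memLp this] with x hx
    exact sub_eq_zero.1 hx
  · have : ∀ᵐ x ∂volume.restrict U, ∀ i, du x i - dv x i = 0 :=
      ae_all_iff.2 fun i => hzero (hw.memLp_grad i) (hz i).le
    filter_upwards [this] with x hx
    ext i
    exact sub_eq_zero.1 (hx i)

end LaxMilgram

/-! ### The unit cell -/

theorem isOpen_unitCell : IsOpen (unitCell N) := by
  have : unitCell N = ⋂ i, {y : Space N | 0 < y i ∧ y i < 1} := by
    ext y; simp [unitCell]
  rw [this]
  refine isOpen_iInter_of_finite fun i => ?_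
  have hc : Continuous fun y : Space N => y i := by fun_prop
  exact (isOpen_lt continuous_const hc).inter (isOpen_lt hc continuous_const)

theorem norm_le_of_mem_unitCell {y : Space N} (hy : y ∈ unitCell N) : ‖y‖ ≤ Real.sqrt N := by
  rw [EuclideanSpace.norm_eq]
  refine Real.sqrt_le_sqrt ?_
  calc ∑ i, ‖y i‖ ^ 2 ≤ ∑ _i : Fin N, (1 : ℝ) := by
        refine Finset.sum_le_sum fun i _ => ?_
        rw [Real.norm_eq_abs, sq_abs]
        nlinarith [(hy i).1, (hy i).2]
    _ = N := by simp

theorem isBounded_unitCell : Bornology.IsBounded (unitCell N) :=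
  (Metric.isBounded_closedBall (x := (0 : Space N)) (r := Real.sqrt N)).subset fun y hy => by
    simpa using norm_le_of_mem_unitCell hy

theorem volume_unitCell : volume (unitCell N) = 1 := by
  have h1 : unitCell N =
      (WithLp.ofLp : Space N → Fin N → ℝ) ⁻¹' (Set.pi univ fun _ => Ioo 0 1) := by
    ext y; simp [unitCell]
  rw [h1, (PiLp.volume_preserving_ofLp (Fin N)).measure_preimage
    (MeasurableSet.univ_pi fun _ => measurableSet_Ioo).nullMeasurableSet, Real.volume_pi_Ioo]
  simp

instance isProbabilityMeasure_unitCell : IsProbabilityMeasure (volume.restrict (unitCell N)) :=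
  ⟨by simp [volume_unitCell]⟩

/-! ### Cell functions -/

section Cell

variable {k : Space N → Matrix (Fin N) (Fin N) ℝ} {γ₀ γ₁ : ℝ}

/-- The first-order flux `k_iα + k_ij ∂_j M_α`. -/
def firstFlux (k : Space N → Matrix (Fin N) (Fin N) ℝ) (dM1 : Fin N → Space N → Fin N → ℝ)
    (i α : Fin N) (y : Space N) : ℝ :=
  k y i α + ∑ j, k y i j * dM1 α y j

/-- The second-order flux `k_iβ M_α + k_ij ∂_j M_αβ`. -/
def secondFlux (k : Space N → Matrix (Fin N) (Fin N) ℝ) (M1 : Fin N → Space N → ℝ)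
    (dM2 : Fin N → Fin N → Space N → Fin N → ℝ) (i α β : Fin N) (y : Space N) : ℝ :=
  k y i β * M1 α y + ∑ j, k y i j * dM2 α β y j

theorem IsElliptic.memLp_entry (h₀ : 0 ≤ γ₀) (hk : IsElliptic (unitCell N) k γ₀ γ₁) (i j : Fin N) :
    MemLp (fun y => k y i j) 2 (volume.restrict (unitCell N)) :=
  .of_bound (hk.measurable i j).aestronglyMeasurable γ₁ (hk.abs_le h₀ i j)

theorem memLp_firstFlux (h₀ : 0 ≤ γ₀) (hk : IsElliptic (unitCell N) k γ₀ γ₁)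
    {dM1 : Fin N → Space N → Fin N → ℝ}
    (hd : ∀ α i, MemLp (fun x => dM1 α x i) 2 (volume.restrict (unitCell N))) (i α : Fin N) :
    MemLp (firstFlux k dM1 i α) 2 (volume.restrict (unitCell N)) :=
  (hk.memLp_entry h₀ i α).add (memLp_two_sum _ fun j _ => hk.memLp_mul h₀ (hd α j) i j)

theorem memLp_secondFlux (h₀ : 0 ≤ γ₀) (hk : IsElliptic (unitCell N) k γ₀ γ₁)
    {M1 : Fin N → Space N → ℝ} {dM2 : Fin N → Fin N → Space N → Fin N → ℝ}
    (hM : ∀ α, MemLp (M1 α) 2 (volume.restrict (unitCell N)))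
    (hd : ∀ α β i, MemLp (fun x => dM2 α β x i) 2 (volume.restrict (unitCell N)))
    (i α β : Fin N) : MemLp (secondFlux k M1 dM2 i α β) 2 (volume.restrict (unitCell N)) :=
  (hk.memLp_mul h₀ (hM α) i β).add (memLp_two_sum _ fun j _ => hk.memLp_mul h₀ (hd α β j) i j)

theorem integrable_flux_mul (h₀ : 0 ≤ γ₀) (hk : IsElliptic (unitCell N) k γ₀ γ₁)
    {g v : Space N → Fin N → ℝ} (hg : ∀ i, MemLp (fun x => g x i) 2 (volume.restrict (unitCell N)))
    (hv : ∀ i, MemLp (fun x => v x i) 2 (volume.restrict (unitCell N))) :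
    Integrable (fun y => ∑ i, ∑ j, k y i j * g y j * v y i) (volume.restrict (unitCell N)) :=
  integrable_finsetSum _ fun i _ => integrable_finsetSum _ fun j _ =>
    memLp_two_integrable_mul (hk.memLp_mul h₀ (hg j) i j) (hv i)

theorem exists_firstCellSolution (i₀ : Fin N) (h₀ : 0 < γ₀)
    (hk : IsElliptic (unitCell N) k γ₀ γ₁) (α : Fin N) :
    ∃ M dM, IsFirstCellSolution k α M dM := by
  obtain ⟨u, du, hu, h⟩ := hk.exists_dirichlet_solution (fun x hx => norm_le_of_mem_unitCell hx)
    i₀ h₀ (f := fun _ => 0) (F := fun y i => -k y i α) MemLp.zero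
    fun i => (hk.memLp_entry h₀.le i α).neg
  refine ⟨u, du, hu, fun φ hφ => ?_⟩
  rw [h φ hφ]
  simp [integral_neg]

theorem exists_secondCellSolution (i₀ : Fin N) (h₀ : 0 < γ₀)
    (hk : IsElliptic (unitCell N) k γ₀ γ₁) {M1 : Fin N → Space N → ℝ}
    {dM1 : Fin N → Space N → Fin N → ℝ} (hM : ∀ α, IsFirstCellSolution k α (M1 α) (dM1 α))
    (α β : Fin N) : ∃ M dM, IsSecondCellSolution k M1 dM1 α β M dM := by
  obtain ⟨u, du, hu, h⟩ := hk.exists_dirichlet_solution (fun x hx => norm_le_of_mem_unitCell hx)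
    i₀ h₀ (f := fun y => -(homogenized k dM1 α β - k y α β - ∑ j, k y α j * dM1 β y j))
    (F := fun y i => -(k y i β * M1 α y))
    ((((memLp_const _).sub (hk.memLp_entry h₀.le α β)).sub
      (memLp_two_sum _ fun j _ => hk.memLp_mul h₀.le ((hM β).1.memLp_grad j) α j)).neg)
    fun i => (hk.memLp_mul h₀.le (hM α).1.memLp i β).neg
  refine ⟨u, du, hu, fun φ hφ => ?_⟩
  rw [h φ hφ]
  simp only [neg_mul, integral_neg, Finset.sum_neg_distrib]
  ring

theorem IsFirstCellSolution.unique (i₀ : Fin N) (h₀ : 0 < γ₀)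
    (hk : IsElliptic (unitCell N) k γ₀ γ₁) {α : Fin N} {u v : Space N → ℝ}
    {du dv : Space N → Fin N → ℝ} (hu : IsFirstCellSolution k α u du)
    (hv : IsFirstCellSolution k α v dv) :
    u =ᵐ[volume.restrict (unitCell N)] v ∧ du =ᵐ[volume.restrict (unitCell N)] dv :=
  hk.dirichlet_unique (fun x hx => norm_le_of_mem_unitCell hx) i₀ h₀ hu.1 hv.1 fun φ hφ => by
    rw [hu.2 φ hφ, hv.2 φ hφ]

theorem IsSecondCellSolution.unique (i₀ : Fin N) (h₀ : 0 < γ₀)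
    (hk : IsElliptic (unitCell N) k γ₀ γ₁) {M1 : Fin N → Space N → ℝ}
    {dM1 : Fin N → Space N → Fin N → ℝ} {α β : Fin N} {u v : Space N → ℝ}
    {du dv : Space N → Fin N → ℝ} (hu : IsSecondCellSolution k M1 dM1 α β u du)
    (hv : IsSecondCellSolution k M1 dM1 α β v dv) :
    u =ᵐ[volume.restrict (unitCell N)] v ∧ du =ᵐ[volume.restrict (unitCell N)] dv :=
  hk.dirichlet_unique (fun x hx => norm_le_of_mem_unitCell hx) i₀ h₀ hu.1 hv.1 fun φ hφ => by
    rw [← neg_inj, hu.2 φ hφ, hv.2 φ hφ]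

/-- The first-order flux is divergence free. -/
theorem IsFirstCellSolution.integral_firstFlux (h₀ : 0 ≤ γ₀)
    (hk : IsElliptic (unitCell N) k γ₀ γ₁) {α : Fin N} {M : Space N → ℝ}
    {dM1 : Fin N → Space N → Fin N → ℝ} (h : IsFirstCellSolution k α M (dM1 α))
    {φ : Space N → ℝ} (hφ : IsTestFunction (unitCell N) φ) :
    ∫ y in unitCell N, ∑ i, firstFlux k dM1 i α y * partialDeriv i φ y = 0 := by
  have e := h.2 φ hφ
  have hφ' : ∀ i, MemLp (fun x => partialDeriv i φ x) 2 (volume.restrict (unitCell N)) :=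
    hφ.memLp_grad
  rw [eq_neg_iff_add_eq_zero, ← integral_add (integrable_flux_mul h₀ hk h.1.memLp_grad hφ')
    (integrable_finsetSum _ fun i _ =>
      memLp_two_integrable_mul (hk.memLp_entry h₀ i α) (hφ' i))] at e
  rw [← e]
  congr 1; ext y
  rw [← Finset.sum_add_distrib]
  refine Finset.sum_congr rfl fun i _ => ?_
  rw [firstFlux, add_mul, Finset.sum_mul, add_comm]

/-- The divergence of the second-order flux is `k̂_αβ` minus the first-order flux. -/
theorem IsSecondCellSolution.integral_secondFlux (h₀ : 0 ≤ γ₀)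
    (hk : IsElliptic (unitCell N) k γ₀ γ₁) {M1 : Fin N → Space N → ℝ}
    {dM1 : Fin N → Space N → Fin N → ℝ} {dM2 : Fin N → Fin N → Space N → Fin N → ℝ}
    {α β : Fin N} {M : Space N → ℝ}
    (hM : MemLp (M1 α) 2 (volume.restrict (unitCell N)))
    (h : IsSecondCellSolution k M1 dM1 α β M (dM2 α β))
    {φ : Space N → ℝ} (hφ : IsTestFunction (unitCell N) φ) :
    ∫ y in unitCell N, ∑ i, secondFlux k M1 dM2 i α β y * partialDeriv i φ y =
      ∫ y in unitCell N, (firstFlux k dM1 α β y - homogenized k dM1 α β) * φ y := by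
  have e := h.2 φ hφ
  have hφ' : ∀ i, MemLp (fun x => partialDeriv i φ x) 2 (volume.restrict (unitCell N)) :=
    hφ.memLp_grad
  have e1 : ∫ y in unitCell N, ∑ i, secondFlux k M1 dM2 i α β y * partialDeriv i φ y =
      (∫ y in unitCell N, ∑ i, ∑ j, k y i j * dM2 α β y j * partialDeriv i φ y) +
        ∫ y in unitCell N, ∑ i, k y i β * M1 α y * partialDeriv i φ y := by
    rw [← integral_add (integrable_flux_mul h₀ hk h.1.memLp_grad hφ')
      (integrable_finsetSum _ fun i _ =>
        memLp_two_integrable_mul (hk.memLp_mul h₀ hM i β) (hφ' i))]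
    congr 1; ext y
    rw [← Finset.sum_add_distrib]
    refine Finset.sum_congr rfl fun i _ => ?_
    rw [secondFlux, add_mul, Finset.sum_mul, add_comm]
  have e2 : ∫ y in unitCell N, (firstFlux k dM1 α β y - homogenized k dM1 α β) * φ y =
      -∫ y in unitCell N,
        (homogenized k dM1 α β - k y α β - ∑ j, k y α j * dM1 β y j) * φ y := by
    rw [← integral_neg]
    congr 1; ext y
    rw [firstFlux]; ring
  rw [e1, e2]
  linarith

theorem homogenized_eq_integral (dM1 : Fin N → Space N → Fin N → ℝ) (i j : Fin N) :
    homogenized k dM1 i j = ∫ y in unitCell N, firstFlux k dM1 i j y := by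
  simp [homogenized, firstFlux, average_eq]

/-- The cell average of `k_ij v_j w_i`. -/
noncomputable def cellEnergy (k : Space N → Matrix (Fin N) (Fin N) ℝ)
    (v w : Space N → Fin N → ℝ) : ℝ :=
  ∫ y in unitCell N, ∑ i, ∑ j, k y i j * v y j * w y i

theorem cellEnergy_comm (hk : IsElliptic (unitCell N) k γ₀ γ₁) (v w : Space N → Fin N → ℝ) :
    cellEnergy k v w = cellEnergy k w v := by
  refine integral_congr_ae ?_
  filter_upwards [hk.symm] with y hy
  rw [Finset.sum_comm]
  refine Finset.sum_congr rfl fun i _ => Finset.sum_congr rfl fun j _ => ?_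
  rw [hy.apply i j]; ring

theorem cellEnergy_add_left (h₀ : 0 ≤ γ₀) (hk : IsElliptic (unitCell N) k γ₀ γ₁)
    {v v' w : Space N → Fin N → ℝ}
    (hv : ∀ i, MemLp (fun x => v x i) 2 (volume.restrict (unitCell N)))
    (hv' : ∀ i, MemLp (fun x => v' x i) 2 (volume.restrict (unitCell N)))
    (hw : ∀ i, MemLp (fun x => w x i) 2 (volume.restrict (unitCell N))) :
    cellEnergy k (fun y i => v y i + v' y i) w = cellEnergy k v w + cellEnergy k v' w := by
  simp only [cellEnergy]
  rw [← integral_add (integrable_flux_mul h₀ hk hv hw) (integrable_flux_mul h₀ hk hv' hw)]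
  congr 1; ext y
  simp only [← Finset.sum_add_distrib]
  refine Finset.sum_congr rfl fun i _ => Finset.sum_congr rfl fun j _ => by ring

theorem cellEnergy_sum_left (h₀ : 0 ≤ γ₀) (hk : IsElliptic (unitCell N) k γ₀ γ₁)
    {v : Fin N → Space N → Fin N → ℝ} {w : Space N → Fin N → ℝ}
    (hv : ∀ α i, MemLp (fun x => v α x i) 2 (volume.restrict (unitCell N)))
    (hw : ∀ i, MemLp (fun x => w x i) 2 (volume.restrict (unitCell N))) (ξ : Fin N → ℝ) :
    cellEnergy k (fun y i => ∑ α, ξ α * v α y i) w = ∑ α, ξ α * cellEnergy k (v α) w := by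
  simp only [cellEnergy, ← integral_const_mul]
  rw [← integral_finsetSum _ fun α _ => (integrable_flux_mul h₀ hk (hv α) hw).const_mul (ξ α)]
  congr 1; ext y
  simp only [Finset.mul_sum, Finset.sum_mul]
  rw [Finset.sum_comm]
  conv_rhs => rw [Finset.sum_comm]
  rw [Finset.sum_comm]
  refine Finset.sum_congr rfl fun i _ => ?_
  rw [Finset.sum_comm]
  refine Finset.sum_congr rfl fun α _ => Finset.sum_congr rfl fun j _ => by ring

theorem cellEnergy_sum (h₀ : 0 ≤ γ₀) (hk : IsElliptic (unitCell N) k γ₀ γ₁)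
    {v : Fin N → Space N → Fin N → ℝ}
    (hv : ∀ α i, MemLp (fun x => v α x i) 2 (volume.restrict (unitCell N))) (ξ : Fin N → ℝ) :
    cellEnergy k (fun y i => ∑ α, ξ α * v α y i) (fun y i => ∑ α, ξ α * v α y i) =
      ∑ α, ∑ β, cellEnergy k (v α) (v β) * ξ α * ξ β := by
  rw [cellEnergy_sum_left h₀ hk hv fun i => memLp_two_sum _ fun α _ => (hv α i).const_mul _]
  refine Finset.sum_congr rfl fun α _ => ?_
  rw [cellEnergy_comm hk, cellEnergy_sum_left h₀ hk hv (hv α), Finset.mul_sum]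
  refine Finset.sum_congr rfl fun β _ => ?_
  rw [cellEnergy_comm hk]; ring

/-- The constant field `e_j`. -/
def unitField (j : Fin N) (_ : Space N) (b : Fin N) : ℝ := if b = j then 1 else 0

/-- The corrected gradient `e_j + ∇M_j`. -/
def correctedGrad (dM1 : Fin N → Space N → Fin N → ℝ) (j : Fin N) (y : Space N) (b : Fin N) : ℝ :=
  unitField j y b + dM1 j y b

theorem sum_correctedGrad (dM1 : Fin N → Space N → Fin N → ℝ) (i j : Fin N) (y : Space N) :
    ∑ b, k y i b * correctedGrad dM1 j y b = firstFlux k dM1 i j y := by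
  simp [correctedGrad, unitField, firstFlux, mul_add, Finset.sum_add_distrib]

theorem memLp_unitField (j i : Fin N) :
    MemLp (fun y => unitField j y i) 2 (volume.restrict (unitCell N)) := memLp_const _

theorem cellEnergy_correctedGrad_unitField (dM1 : Fin N → Space N → Fin N → ℝ) (i j : Fin N) :
    cellEnergy k (correctedGrad dM1 j) (unitField i) = homogenized k dM1 i j := by
  rw [homogenized_eq_integral, cellEnergy]
  congr 1; ext y
  simp_rw [← Finset.sum_mul, sum_correctedGrad]
  simp [unitField]

section

variable {M1 : Fin N → Space N → ℝ} {dM1 : Fin N → Space N → Fin N → ℝ}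

/-- The corrected gradients are orthogonal, in energy, to the gradients of the cell functions: test
the cell problem of `M_j` with `M_i`. -/
theorem cellEnergy_correctedGrad_grad (h₀ : 0 ≤ γ₀) (hk : IsElliptic (unitCell N) k γ₀ γ₁)
    (hM : ∀ α, IsFirstCellSolution k α (M1 α) (dM1 α)) (i j : Fin N) :
    cellEnergy k (correctedGrad dM1 j) (dM1 i) = 0 := by
  have e := (hM i).1.integral_eq_of_test (F := fun a => firstFlux k dM1 a j) (f := fun _ => 0)
    (fun a => memLp_firstFlux h₀ hk (fun α => (hM α).1.memLp_grad) a j) MemLp.zero fun φ hφ => by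
      rw [(hM j).integral_firstFlux h₀ hk hφ]; simp
  simp only [zero_mul, integral_zero] at e
  rw [← e, cellEnergy]
  simp_rw [← Finset.sum_mul, sum_correctedGrad]

/-- The homogenized matrix is the Gram matrix of the corrected gradients `e_j + ∇M_j` in the energy
inner product. -/
theorem homogenized_eq_cellEnergy (h₀ : 0 ≤ γ₀) (hk : IsElliptic (unitCell N) k γ₀ γ₁)
    (hM : ∀ α, IsFirstCellSolution k α (M1 α) (dM1 α)) (i j : Fin N) :
    homogenized k dM1 i j = cellEnergy k (correctedGrad dM1 j) (correctedGrad dM1 i) := by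
  have hG : ∀ α i, MemLp (fun y => correctedGrad dM1 α y i) 2 (volume.restrict (unitCell N)) :=
    fun α i => (memLp_unitField α i).add ((hM α).1.memLp_grad i)
  rw [cellEnergy_comm hk (correctedGrad dM1 j)]
  have := cellEnergy_add_left h₀ hk (memLp_unitField i) (hM i).1.memLp_grad (hG j)
  rw [cellEnergy_comm hk (unitField i), cellEnergy_comm hk (dM1 i),
    cellEnergy_correctedGrad_unitField, cellEnergy_correctedGrad_grad h₀ hk hM, add_zero] at this
  exact this.symm

/-- Pythagoras: the corrector `∇M_j` lowers the energy of the constant field `e_j`. -/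
theorem homogenized_eq_sub (h₀ : 0 ≤ γ₀) (hk : IsElliptic (unitCell N) k γ₀ γ₁)
    (hM : ∀ α, IsFirstCellSolution k α (M1 α) (dM1 α)) (i j : Fin N) :
    homogenized k dM1 i j =
      cellEnergy k (unitField j) (unitField i) - cellEnergy k (dM1 j) (dM1 i) := by
  have h1 := cellEnergy_add_left h₀ hk (memLp_unitField j) (hM j).1.memLp_grad (memLp_unitField i)
  have h2 := cellEnergy_add_left h₀ hk (memLp_unitField i) (hM i).1.memLp_grad (hM j).1.memLp_grad
  have h3 := cellEnergy_correctedGrad_unitField (k := k) dM1 i j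
  have h4 := cellEnergy_correctedGrad_grad h₀ hk hM j i
  rw [cellEnergy_comm hk (unitField i), cellEnergy_comm hk (dM1 i)] at h2
  unfold correctedGrad at h3 h4
  linarith

theorem homogenized_isSymm (h₀ : 0 ≤ γ₀) (hk : IsElliptic (unitCell N) k γ₀ γ₁)
    (hM : ∀ α, IsFirstCellSolution k α (M1 α) (dM1 α)) : (homogenized k dM1).IsSymm := by
  ext i j
  rw [Matrix.transpose_apply, homogenized_eq_cellEnergy h₀ hk hM,
    homogenized_eq_cellEnergy h₀ hk hM, cellEnergy_comm hk]

/-- The energy of the corrected gradient of `ξ` is at least `γ₀` times its squared `L²` norm, which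
is at least `|ξ|²`, because its mean is `ξ`. -/
theorem homogenized_ge (h₀ : 0 ≤ γ₀) (hk : IsElliptic (unitCell N) k γ₀ γ₁)
    (hM : ∀ α, IsFirstCellSolution k α (M1 α) (dM1 α)) (ξ : Space N) :
    γ₀ * ‖ξ‖ ^ 2 ≤ ∑ i, ∑ j, homogenized k dM1 i j * ξ i * ξ j := by
  have hG : ∀ α i, MemLp (fun y => correctedGrad dM1 α y i) 2 (volume.restrict (unitCell N)) :=
    fun α i => (memLp_unitField α i).add ((hM α).1.memLp_grad i)
  have e : ∑ i, ∑ j, homogenized k dM1 i j * ξ i * ξ j =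
      cellEnergy k (fun y i => ∑ α, ξ α * correctedGrad dM1 α y i)
        (fun y i => ∑ α, ξ α * correctedGrad dM1 α y i) := by
    rw [cellEnergy_sum h₀ hk hG]
    refine Finset.sum_congr rfl fun i _ => Finset.sum_congr rfl fun j _ => ?_
    rw [homogenized_eq_cellEnergy h₀ hk hM, cellEnergy_comm hk]
  rw [e]
  have hS : ∀ i, MemLp (fun y => ∑ α, ξ α * correctedGrad dM1 α y i) 2
      (volume.restrict (unitCell N)) := fun i => memLp_two_sum _ fun α _ => (hG α i).const_mul _
  refine le_trans ?_ (hk.energy_ge h₀ hS)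
  rw [EuclideanSpace.norm_sq_eq]
  refine mul_le_mul_of_nonneg_left (Finset.sum_le_sum fun a _ => ?_) h₀
  -- the gradients of the cell functions have mean zero
  have hmean : ∀ α, ∫ y in unitCell N, dM1 α y a = 0 := fun α =>
    (hM α).1.integral_grad_eq_zero isBounded_unitCell a
  have hint : ∀ α, Integrable (fun y => dM1 α y a) (volume.restrict (unitCell N)) := fun α =>
    ((hM α).1.memLp_grad a).integrable (by norm_num)
  have hsum : Integrable (fun y => ∑ α, ξ α * dM1 α y a) (volume.restrict (unitCell N)) :=
    integrable_finsetSum _ fun α _ => (hint α).const_mul _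
  have h1 : ∫ y in unitCell N, ξ a ^ 2 + 2 * ξ a * ∑ α, ξ α * dM1 α y a = ξ a ^ 2 := by
    rw [integral_add (integrable_const _) (hsum.const_mul _), integral_const_mul,
      integral_finsetSum _ fun α _ => (hint α).const_mul _]
    simp [integral_const_mul, hmean]
  rw [Real.norm_eq_abs, sq_abs, ← h1]
  refine integral_mono ((integrable_const _).add (hsum.const_mul _)) (hS a).integrable_sq
    fun y => ?_
  have : ∑ α, ξ α * correctedGrad dM1 α y a = ξ a + ∑ α, ξ α * dM1 α y a := by
    simp [correctedGrad, unitField, mul_add, Finset.sum_add_distrib]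
  simp only [this]
  nlinarith [sq_nonneg (∑ α, ξ α * dM1 α y a)]

/-- The form of `k̂` is at most the mean of the form of `k`, because the energy that
`homogenized_eq_sub` subtracts is nonnegative. -/
theorem homogenized_le (h₀ : 0 ≤ γ₀) (hk : IsElliptic (unitCell N) k γ₀ γ₁)
    (hM : ∀ α, IsFirstCellSolution k α (M1 α) (dM1 α)) (ξ : Space N) :
    ∑ i, ∑ j, homogenized k dM1 i j * ξ i * ξ j ≤ γ₁ * ‖ξ‖ ^ 2 := by
  have hd := fun α => (hM α).1.memLp_grad
  have e : ∑ i, ∑ j, homogenized k dM1 i j * ξ i * ξ j =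
      cellEnergy k (fun y i => ∑ α, ξ α * unitField α y i)
        (fun y i => ∑ α, ξ α * unitField α y i) -
      cellEnergy k (fun y i => ∑ α, ξ α * dM1 α y i) (fun y i => ∑ α, ξ α * dM1 α y i) := by
    rw [cellEnergy_sum h₀ hk memLp_unitField, cellEnergy_sum h₀ hk hd, ← Finset.sum_sub_distrib]
    refine Finset.sum_congr rfl fun i _ => ?_
    rw [← Finset.sum_sub_distrib]
    refine Finset.sum_congr rfl fun j _ => ?_
    rw [homogenized_eq_sub h₀ hk hM, cellEnergy_comm hk, cellEnergy_comm hk (dM1 j)]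
    ring
  have h1 : 0 ≤ cellEnergy k (fun y i => ∑ α, ξ α * dM1 α y i)
      (fun y i => ∑ α, ξ α * dM1 α y i) :=
    le_trans (mul_nonneg h₀ (Finset.sum_nonneg fun i _ => integral_nonneg fun y => sq_nonneg _))
      (hk.energy_ge h₀ fun i => memLp_two_sum _ fun α _ => (hd α i).const_mul _)
  have h2 : cellEnergy k (fun y i => ∑ α, ξ α * unitField α y i)
        (fun y i => ∑ α, ξ α * unitField α y i) ≤ γ₁ * ‖ξ‖ ^ 2 := by
    have hu : ∀ (y : Space N) i, ∑ α, ξ α * unitField α y i = ξ i := by simp [unitField]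
    have : γ₁ * ‖ξ‖ ^ 2 = ∫ _ in unitCell N, γ₁ * ‖ξ‖ ^ 2 := by simp
    rw [this, cellEnergy]
    simp_rw [hu]
    refine integral_mono_ae (integrable_flux_mul h₀ hk (g := fun _ i => ξ i) (v := fun _ i => ξ i)
      (fun i => memLp_const _) fun i => memLp_const _) (integrable_const _) ?_
    filter_upwards [hk.elliptic] with y hy
    refine le_trans (le_of_eq ?_) (hy ξ).2
    refine Finset.sum_congr rfl fun i _ => Finset.sum_congr rfl fun j _ => by ring
  linarith

end

end Cell

/-! ### Mollification of square integrable functions -/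

/-- The kernel of `mollify n`: a smooth function of integral one. -/
noncomputable def mollKernel (N n : ℕ) : Space N → ℝ := (mollifier N n).normed volume

theorem contDiff_mollKernel (n : ℕ) : ContDiff ℝ ∞ (mollKernel N n) :=
  (mollifier N n).contDiff_normed

theorem hasCompactSupport_mollKernel (n : ℕ) : HasCompactSupport (mollKernel N n) :=
  (mollifier N n).hasCompactSupport_normed

theorem mollKernel_nonneg (n : ℕ) (x : Space N) : 0 ≤ mollKernel N n x :=
  (mollifier N n).nonneg_normed x

theorem mollKernel_neg (n : ℕ) (x : Space N) : mollKernel N n (-x) = mollKernel N n x :=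
  (mollifier N n).normed_neg x

theorem integral_mollKernel (n : ℕ) : ∫ x, mollKernel N n x = 1 :=
  (mollifier N n).integral_normed

theorem mollify_eq (n : ℕ) (u : Space N → ℝ) (x : Space N) :
    mollify n u x = ∫ t, u t * mollKernel N n (x - t) := mollify_eq_swap n u x

/-- The reflected and translated kernel `t ↦ ρ(x - t)` is a test function. -/
theorem isTestFunction_mollKernel_sub (n : ℕ) (x : Space N) :
    IsTestFunction univ (fun t => mollKernel N n (x - t)) :=
  ⟨(contDiff_mollKernel n).comp (contDiff_const.sub contDiff_id),
    (hasCompactSupport_mollKernel n).comp_homeomorph (Homeomorph.subLeft x), subset_univ _⟩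

theorem fderiv_mollKernel_sub (n : ℕ) (x t v : Space N) :
    fderiv ℝ (fun t => mollKernel N n (x - t)) t v = -fderiv ℝ (mollKernel N n) (x - t) v := by
  have hd : DifferentiableAt ℝ (mollKernel N n) (x - t) :=
    (contDiff_infty.1 (contDiff_mollKernel n) 1).differentiable (by simp) _
  have := hd.hasFDerivAt.comp t ((hasFDerivAt_const x t).sub (hasFDerivAt_id t))
  rw [show (fun t => mollKernel N n (x - t)) = mollKernel N n ∘ (fun t => x - t) from rfl]
  have h2 := this.fderiv
  simp only [Function.comp_def] at h2 ⊢
  erw [h2]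
  simp

theorem fderiv_mollify (n : ℕ) {u : Space N → ℝ} (hu : LocallyIntegrable u) (x v : Space N) :
    fderiv ℝ (mollify n u) x v = ∫ t, u t * fderiv ℝ (mollKernel N n) (x - t) v := by
  have hc := hasCompactSupport_mollKernel (N := N) n
  have hd := contDiff_infty.1 (contDiff_mollKernel (N := N) n) 1
  rw [mollify_eq_convolution]
  change fderiv ℝ (convolution (mollKernel N n) u _ volume) x v = _
  rw [(hc.hasFDerivAt_convolution_left (ContinuousLinearMap.lsmul ℝ ℝ) hd hu x).fderiv,
    convolution_eq_swap]
  have hi : Integrable (fun t => ((ContinuousLinearMap.lsmul ℝ ℝ : ℝ →L[ℝ] ℝ →L[ℝ] ℝ).precompL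
      (Space N)) (fderiv ℝ (mollKernel N n) (x - t)) (u t)) := by
    exact ((hc.fderiv ℝ).convolutionExists_left _ (hd.continuous_fderiv (by simp)) hu
      x).integrable_swap
  rw [ContinuousLinearMap.integral_apply hi]
  congr 1; ext t
  simp [mul_comm]

/-- The derivative of a mollification is the mollification of the weak derivative. -/
theorem HasWeakDeriv.fderiv_mollify {u g : Space N → ℝ} {v : Space N}
    (h : HasWeakDeriv univ v u g) (n : ℕ) (x : Space N) :
    fderiv ℝ (mollify n u) x v = mollify n g x := by
  rw [_root_.fderiv_mollify n (locallyIntegrableOn_univ.1 h.locallyIntegrable), mollify_eq]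
  have e := h.integral_eq' (isTestFunction_mollKernel_sub n x)
  simp_rw [fderiv_mollKernel_sub, mul_neg, integral_neg] at e
  exact neg_inj.1 e

theorem integrable_mul_mollKernel (n : ℕ) {f : Space N → ℝ} (hf : LocallyIntegrable f)
    (x : Space N) : Integrable fun t => f t * mollKernel N n (x - t) :=
  integrable_mul_of_tsupport
    (hf.integrableOn_isCompact (isTestFunction_mollKernel_sub n x).compact)
    (isTestFunction_mollKernel_sub n x).toC1.continuous
    (isTestFunction_mollKernel_sub n x).compact

/-- Jensen's inequality for the mollification: expand the mean of `(f - c)²` at `c = mollify n f x`.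
-/
theorem mollify_sq_le (n : ℕ) {f : Space N → ℝ} (hf : LocallyIntegrable f)
    (hf2 : LocallyIntegrable fun x => f x ^ 2) (x : Space N) :
    mollify n f x ^ 2 ≤ mollify n (fun x => f x ^ 2) x := by
  have i1 := integrable_mul_mollKernel n hf x
  have i2 := integrable_mul_mollKernel n hf2 x
  have i0 := integrable_mul_mollKernel n (locallyIntegrable_const (1 : ℝ)) x
  set c := mollify n f x with hc
  have h0 : 0 ≤ ∫ t, (f t - c) ^ 2 * mollKernel N n (x - t) :=
    integral_nonneg fun t => mul_nonneg (sq_nonneg _) (mollKernel_nonneg n _)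
  have e : ∀ t, (f t - c) ^ 2 * mollKernel N n (x - t) =
      f t ^ 2 * mollKernel N n (x - t) - 2 * c * (f t * mollKernel N n (x - t)) +
        c ^ 2 * (1 * mollKernel N n (x - t)) := fun t => by ring
  have hone : ∫ t, mollKernel N n (x - t) = 1 := by
    rw [integral_sub_left_eq_self]; exact integral_mollKernel n
  simp_rw [e] at h0
  have i12 : Integrable fun t => f t ^ 2 * mollKernel N n (x - t) -
      2 * c * (f t * mollKernel N n (x - t)) := i2.sub (i1.const_mul _)
  rw [integral_add i12 (i0.const_mul _), integral_sub i2 (i1.const_mul _),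
    integral_const_mul, integral_const_mul, ← mollify_eq, ← mollify_eq, ← hc] at h0
  simp_rw [one_mul] at h0
  rw [hone] at h0
  linarith

theorem locallyIntegrable_of_memLp_two {f : Space N → ℝ} (hf : MemLp f 2) : LocallyIntegrable f :=
  hf.locallyIntegrable (by norm_num)

theorem memLp_mollify (n : ℕ) {f : Space N → ℝ} (hf : MemLp f 2) (hc : HasCompactSupport f) :
    MemLp (mollify n f) 2 :=
  (contDiff_mollify n (locallyIntegrable_of_memLp_two hf)).continuous.memLp_of_hasCompactSupport
    (hasCompactSupport_mollify n hc)

/-- Mollification does not increase the `L²` norm. -/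
theorem integral_mollify_sq_le (n : ℕ) {f : Space N → ℝ} (hf : MemLp f 2)
    (hc : HasCompactSupport f) : ∫ x, mollify n f x ^ 2 ≤ ∫ x, f x ^ 2 := by
  have hl := locallyIntegrable_of_memLp_two hf
  have hρ : Integrable (mollKernel N n) :=
    (contDiff_mollKernel n).continuous.integrable_of_hasCompactSupport
      (hasCompactSupport_mollKernel n)
  have e : ∫ x, mollify n (fun x => f x ^ 2) x = ∫ x, f x ^ 2 := by
    rw [mollify_eq_convolution]
    have := integral_convolution (L := ContinuousLinearMap.lsmul ℝ ℝ) (μ := volume) (ν := volume)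
      hρ hf.integrable_sq
    refine this.trans ?_
    rw [integral_mollKernel]
    simp
  have hi : Integrable (mollify n fun x => f x ^ 2) := by
    rw [mollify_eq_convolution]
    exact Integrable.integrable_convolution (L := ContinuousLinearMap.lsmul ℝ ℝ) hρ hf.integrable_sq
  rw [← e]
  exact integral_mono (memLp_mollify n hf hc).integrable_sq hi
    fun x => mollify_sq_le n hl hf.integrable_sq.locallyIntegrable x

/-- Mollification is symmetric in `L²`. -/
theorem integral_mollify_mul (n : ℕ) {f ψ : Space N → ℝ} (hf : Integrable f)
    (hψ : Continuous ψ) (hc : HasCompactSupport ψ) :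
    ∫ x, mollify n f x * ψ x = ∫ x, f x * mollify n ψ x := by
  have hρ : Integrable (mollKernel N n) :=
    (contDiff_mollKernel n).continuous.integrable_of_hasCompactSupport
      (hasCompactSupport_mollKernel n)
  have h1 : Integrable (fun p : Space N × Space N => f p.2 * mollKernel N n (p.1 - p.2))
      (volume.prod volume) :=
    hf.convolution_integrand (ContinuousLinearMap.mul ℝ ℝ) hρ
  obtain ⟨C, hC⟩ := hψ.bounded_above_of_compact_support hc
  have h2 : Integrable (fun p : Space N × Space N => ψ p.1 * (f p.2 * mollKernel N n (p.1 - p.2)))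
      (volume.prod volume) :=
    h1.bdd_mul (c := C) (hψ.comp continuous_fst).aestronglyMeasurable
      (Eventually.of_forall fun p => hC p.1)
  have e1 : ∀ x, mollify n f x * ψ x = ∫ t, ψ x * (f t * mollKernel N n (x - t)) := fun x => by
    rw [integral_const_mul, ← mollify_eq, mul_comm]
  have e2 : ∀ t, f t * mollify n ψ t = ∫ x, ψ x * (f t * mollKernel N n (x - t)) := fun t => by
    rw [mollify_eq, ← integral_const_mul]
    congr 1; ext x
    rw [← mollKernel_neg, neg_sub]; ring
  simp_rw [e1, e2]
  exact integral_integral_swap h2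

/-- Mollifications converge weakly: by symmetry the mollifier is moved to `ψ`. -/
theorem tendsto_integral_mollify_mul {f ψ : Space N → ℝ} (hf : MemLp f 2) (hfi : Integrable f)
    (hψ : Continuous ψ) (hc : HasCompactSupport ψ) :
    Tendsto (fun n => ∫ x, mollify n f x * ψ x) atTop (𝓝 (∫ x, f x * ψ x)) := by
  simp_rw [integral_mollify_mul _ hfi hψ hc]
  have hψ2 : MemLp ψ 2 volume := hψ.memLp_of_hasCompactSupport hc
  have := tendsto_integral_mul_of_eLpNorm (μ := volume) (φ := fun n => mollify n ψ)
    (fun n => memLp_mollify n hψ2 hc) hψ2 hf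
    (by simpa using tendsto_eLpNorm_mollify_sub (U := univ) hψ hc)
  simpa only [mul_comm] using this

/-! ### Interior regularity for constant coefficients -/

section Regularity

variable {A : Matrix (Fin N) (Fin N) ℝ} {γ₀ : ℝ}

theorem IsTestFunction.partialDeriv {U : Set (Space N)} {φ : Space N → ℝ}
    (h : IsTestFunction U φ) (i : Fin N) : IsTestFunction U (partialDeriv i φ) :=
  h.fderiv_apply _

theorem IsTestFunction.partialDeriv_comm {U : Set (Space N)} {φ : Space N → ℝ}
    (h : IsTestFunction U φ) (i j : Fin N) :
    _root_.partialDeriv i (_root_.partialDeriv j φ) =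
      _root_.partialDeriv j (_root_.partialDeriv i φ) := by
  ext x
  exact h.fderiv_fderiv_comm x _ _

theorem IsTestFunction.integral_mul_partialDeriv {φ ψ : Space N → ℝ}
    (h : IsTestFunction univ φ) (h' : IsTestFunction univ ψ) (i : Fin N) :
    ∫ x, φ x * _root_.partialDeriv i ψ x = -∫ x, _root_.partialDeriv i φ x * ψ x :=
  integral_mul_fderiv_of_contDiffOn isOpen_univ h.toC1.contDiff.contDiffOn h'.toC1 _

/-- `∫ ∂ᵢ∂ₘv ∂ⱼ∂ₘv = ∫ ∂ᵢ∂ⱼv ∂ₘ∂ₘv`: integrate by parts twice. -/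
theorem integral_mixed_second_derivs {v : Space N → ℝ} (hv : IsTestFunction univ v)
    (i j m : Fin N) :
    ∫ x, partialDeriv i (partialDeriv m v) x * partialDeriv j (partialDeriv m v) x =
      ∫ x, partialDeriv i (partialDeriv j v) x * partialDeriv m (partialDeriv m v) x := by
  rw [((hv.partialDeriv m).partialDeriv i).integral_mul_partialDeriv (hv.partialDeriv m) j,
    ((hv.partialDeriv j).partialDeriv i).integral_mul_partialDeriv (hv.partialDeriv m) m,
    hv.partialDeriv_comm i m, (hv.partialDeriv i).partialDeriv_comm j m,
    hv.partialDeriv_comm j i]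

/-- `γ₀ ‖∂ᵢ∂ₘ v‖ ≤ ‖A_ij ∂ᵢ∂ⱼ v‖` in `L²` for test functions `v`. -/
theorem norm_second_deriv_le (h₀ : 0 < γ₀)
    (hA : ∀ ξ : Space N, γ₀ * ‖ξ‖ ^ 2 ≤ ∑ i, ∑ j, A i j * ξ i * ξ j) {v L : Space N → ℝ}
    (hv : IsTestFunction univ v)
    (hL : ∀ x, L x = ∑ i, ∑ j, A i j * partialDeriv i (partialDeriv j v) x) (i m : Fin N) :
    Real.sqrt (∫ x, partialDeriv i (partialDeriv m v) x ^ 2) ≤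
      Real.sqrt (∫ x, L x ^ 2) / γ₀ := by
  have hm : ∀ i j, MemLp (partialDeriv i (partialDeriv j v)) 2 volume := fun i j =>
    ((hv.partialDeriv j).partialDeriv i).toC1.memLp
  have hLm : MemLp L 2 volume := by
    rw [funext hL]
    exact memLp_two_sum _ fun i _ => memLp_two_sum _ fun j _ => (hm i j).const_mul _
  have hi : ∀ i j, Integrable fun x => A i j * partialDeriv i (partialDeriv m v) x *
      partialDeriv j (partialDeriv m v) x := fun i j => by
    simp_rw [mul_assoc]
    exact (memLp_two_integrable_mul (hm i m) (hm j m)).const_mul _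
  set S := ∑ i, ∫ x, partialDeriv i (partialDeriv m v) x ^ 2 with hS
  have hSi : ∀ i, ∫ x, partialDeriv i (partialDeriv m v) x ^ 2 ≤ S := fun i =>
    Finset.single_le_sum (f := fun i => ∫ x, partialDeriv i (partialDeriv m v) x ^ 2)
      (fun i _ => integral_nonneg fun x => sq_nonneg _) (Finset.mem_univ i)
  have hS0 : 0 ≤ S := Finset.sum_nonneg fun i _ => integral_nonneg fun x => sq_nonneg _
  have h1 : γ₀ * S ≤ ∫ x, ∑ i, ∑ j, A i j * partialDeriv i (partialDeriv m v) x *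
      partialDeriv j (partialDeriv m v) x := by
    rw [hS, ← integral_finsetSum _ fun i _ => (hm i m).integrable_sq, ← integral_const_mul]
    refine integral_mono
      ((integrable_finsetSum _ fun i _ => (hm i m).integrable_sq).const_mul _)
      (integrable_finsetSum _ fun i _ => integrable_finsetSum _ fun j _ => hi i j) fun x => ?_
    have := hA (WithLp.toLp 2 fun i => partialDeriv i (partialDeriv m v) x)
    rw [EuclideanSpace.norm_sq_eq] at this
    simpa only [Real.norm_eq_abs, sq_abs] using this
  have h2 : ∫ x, ∑ i, ∑ j, A i j * partialDeriv i (partialDeriv m v) x *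
      partialDeriv j (partialDeriv m v) x = ∫ x, L x * partialDeriv m (partialDeriv m v) x := by
    simp_rw [hL, Finset.sum_mul]
    rw [integral_finsetSum _ fun i _ => integrable_finsetSum _ fun j _ => hi i j,
      integral_finsetSum _ fun i _ => integrable_finsetSum _ fun j _ => by
        simp_rw [mul_assoc]
        exact (memLp_two_integrable_mul (hm i j) (hm m m)).const_mul _]
    refine Finset.sum_congr rfl fun i _ => ?_
    rw [integral_finsetSum _ fun j _ => hi i j, integral_finsetSum _ fun j _ => by
        simp_rw [mul_assoc]
        exact (memLp_two_integrable_mul (hm i j) (hm m m)).const_mul _]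
    refine Finset.sum_congr rfl fun j _ => ?_
    simp_rw [mul_assoc]
    rw [integral_const_mul, integral_const_mul, integral_mixed_second_derivs hv]
  have h3 : γ₀ * S ≤ Real.sqrt (∫ x, L x ^ 2) * Real.sqrt S := by
    rw [h2] at h1
    refine h1.trans ((le_abs_self _).trans ((abs_integral_mul_le hLm (hm m m)).trans ?_))
    exact mul_le_mul_of_nonneg_left (Real.sqrt_le_sqrt (hSi m)) (Real.sqrt_nonneg _)
  refine (Real.sqrt_le_sqrt (hSi i)).trans ?_
  rw [le_div_iff₀ h₀]
  rcases hS0.eq_or_lt with h | h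
  · rw [← h]; simp
  · have hs := Real.sqrt_pos.2 h
    have : γ₀ * (Real.sqrt S * Real.sqrt S) ≤ Real.sqrt (∫ x, L x ^ 2) * Real.sqrt S := by
      rwa [Real.mul_self_sqrt hS0]
    rw [← mul_assoc] at this
    have := le_of_mul_le_mul_right this hs
    linarith

/-- If `w ∈ H¹` has compact support and `-∂ᵢ(A_ij ∂ⱼ w) = F ∈ L²`, then the distributional second
derivatives of `w` are bounded functionals on `L²`. The estimate is
`norm_second_deriv_le`, applied to mollifications. -/
theorem abs_integral_weakGrad_mul_le (h₀ : 0 < γ₀)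
    (hA : ∀ ξ : Space N, γ₀ * ‖ξ‖ ^ 2 ≤ ∑ i, ∑ j, A i j * ξ i * ξ j) {w F : Space N → ℝ}
    {Dw : Space N → Fin N → ℝ} (hw : MemLp w 2) (cw : HasCompactSupport w)
    (hD : ∀ i, MemLp (fun x => Dw x i) 2) (cD : ∀ i, HasCompactSupport fun x => Dw x i)
    (hF : MemLp F 2) (cF : HasCompactSupport F) (hg : HasWeakGrad univ w Dw)
    (heq : ∀ φ, IsTestFunction univ φ →
      ∫ x, ∑ i, ∑ j, A i j * Dw x j * partialDeriv i φ x = ∫ x, F x * φ x)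
    (i m : Fin N) {φ : Space N → ℝ} (hφ : IsTestFunction univ φ) :
    |∫ x, Dw x m * partialDeriv i φ x| ≤
      Real.sqrt (∫ x, F x ^ 2) / γ₀ * Real.sqrt (∫ x, φ x ^ 2) := by
  have hv : ∀ n, IsTestFunction univ (mollify n w) := fun n =>
    ⟨contDiff_mollify n (locallyIntegrable_of_memLp_two hw), hasCompactSupport_mollify n cw,
      subset_univ _⟩
  have hd : ∀ n j, partialDeriv j (mollify n w) = mollify n fun x => Dw x j := fun n j => by
    ext x; exact (hg j).fderiv_mollify n x
  have hl := fun j => locallyIntegrable_of_memLp_two (hD j)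
  -- the mollified equation, obtained by testing with `t ↦ ρ(x - t)`
  have hL : ∀ n x, -mollify n F x =
      ∑ i, ∑ j, A i j * partialDeriv i (partialDeriv j (mollify n w)) x := by
    intro n x
    have hψ := isTestFunction_mollKernel_sub (N := N) n x
    have e := heq _ hψ
    rw [← mollify_eq] at e
    rw [← e, ← integral_neg]
    have hint : ∀ i j, Integrable fun t => A i j * Dw t j *
        partialDeriv i (fun t => mollKernel N n (x - t)) t := fun i j => by
      simp_rw [mul_assoc]
      exact (memLp_two_integrable_mul (hD j) (hψ.toC1.memLp_fderiv (unitVec i))).const_mul _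
    rw [integral_neg, integral_finsetSum _ fun i _ => integrable_finsetSum _ fun j _ => hint i j,
      ← Finset.sum_neg_distrib]
    refine Finset.sum_congr rfl fun i _ => ?_
    rw [integral_finsetSum _ fun j _ => hint i j, ← Finset.sum_neg_distrib]
    refine Finset.sum_congr rfl fun j _ => ?_
    simp_rw [mul_assoc]
    rw [integral_const_mul, ← mul_neg, ← integral_neg, hd]
    congr 1
    simp only [partialDeriv]
    rw [_root_.fderiv_mollify n (hl j)]
    congr 1; ext t
    rw [fderiv_mollKernel_sub]; ring
  have hfi : Integrable fun x => Dw x m := by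
    have h1 : IntegrableOn (fun x => Dw x m) (tsupport fun x => Dw x m) :=
      (hl m).integrableOn_isCompact (cD m)
    exact (integrableOn_iff_integrable_of_support_subset (subset_tsupport _)).1 h1
  have hlim := (tendsto_integral_mollify_mul (hD m) hfi (hφ.partialDeriv i).toC1.continuous
    (hφ.partialDeriv i).compact).abs
  refine le_of_tendsto hlim (Eventually.of_forall fun n => ?_)
  rw [← hd, ((hv n).partialDeriv m).integral_mul_partialDeriv hφ i, abs_neg]
  refine (abs_integral_mul_le (((hv n).partialDeriv m).partialDeriv i).toC1.memLp
    hφ.toC1.memLp).trans ?_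
  refine mul_le_mul_of_nonneg_right ?_ (Real.sqrt_nonneg _)
  refine (norm_second_deriv_le h₀ hA (hv n) (L := fun x => -mollify n F x) (hL n) i m).trans ?_
  refine div_le_div_of_nonneg_right (Real.sqrt_le_sqrt ?_) h₀.le
  simp_rw [neg_sq]
  exact integral_mollify_sq_le n hF cF

/-- By the Riesz representation theorem, a distributional derivative that is bounded on `L²` is an
`L²` function. -/
theorem exists_hasWeakDeriv_of_bounded {p : Space N → ℝ} (hp : LocallyIntegrable p) (v : Space N)
    {C : ℝ} (hC : ∀ φ, IsTestFunction univ φ →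
      |∫ x, p x * fderiv ℝ φ x v| ≤ C * Real.sqrt (∫ x, φ x ^ 2)) :
    ∃ g, MemLp g 2 ∧ HasWeakDeriv univ v p g := by
  let T : Submodule ℝ (Space N → ℝ) :=
    { carrier := {φ | IsTestFunction univ φ}
      zero_mem' := IsTestFunction.zero univ
      add_mem' := fun h h' => IsTestFunction.add h h'
      smul_mem' := fun c _ h => IsTestFunction.const_mul h c }
  let e : T →ₗ[ℝ] Lp ℝ 2 (volume : Measure (Space N)) :=
    { toFun := fun φ => (φ.2.toC1.memLp).toLp φ.1
      map_add' := fun φ ψ => MemLp.toLp_add _ _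
      map_smul' := fun c φ => MemLp.toLp_const_smul c φ.2.toC1.memLp }
  have hi : ∀ φ : T, Integrable fun x => p x * fderiv ℝ φ.1 x v := fun φ =>
    have h := φ.2.fderiv_apply v
    integrable_mul_of_locallyIntegrableOn (locallyIntegrableOn_univ.2 hp) h.toC1.continuous
      h.compact h.support_subset
  let ℓ : T →ₗ[ℝ] ℝ :=
    { toFun := fun φ => ∫ x, p x * fderiv ℝ φ.1 x v
      map_add' := fun φ ψ => by
        rw [← integral_add (hi φ) (hi ψ)]
        congr 1; ext x
        have h1 := φ.2.toC1.contDiff.differentiable (by simp) x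
        have h2 := ψ.2.toC1.contDiff.differentiable (by simp) x
        rw [Submodule.coe_add, fderiv_add h1 h2]
        simp [mul_add]
      map_smul' := fun c φ => by
        rw [RingHom.id_apply, smul_eq_mul, ← integral_const_mul]
        congr 1; ext x
        have h1 := φ.2.toC1.contDiff.differentiable (by simp) x
        rw [Submodule.coe_smul, fderiv_const_smul h1]
        simp; ring }
  have hb : ∃ C : ℝ, ∀ φ : T, ‖ℓ φ‖ ≤ C * ‖e φ‖ := by
    refine ⟨C, fun φ => ?_⟩
    change |_| ≤ C * ‖(φ.2.toC1.memLp).toLp φ.1‖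
    rw [norm_toLp_eq]
    exact hC φ.1 φ.2
  -- Hahn-Banach extends the functional from the classes of test functions to `L²`
  obtain ⟨G, hG, -⟩ := exists_extension_norm_eq (𝕜 := ℝ) (LinearMap.range e) (ℓ.compLeftInverse e)
  let g := (InnerProductSpace.toDual ℝ (Lp ℝ 2 (volume : Measure (Space N)))).symm G
  refine ⟨fun x => -g x, (Lp.memLp g).neg, .of_integral_eq (locallyIntegrableOn_univ.2 hp)
    (locallyIntegrableOn_univ.2 (locallyIntegrable_of_memLp_two (Lp.memLp g).neg)) fun φ hφ => ?_⟩
  let φ' : T := ⟨φ, hφ⟩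
  have h1 : G (e φ') = ℓ φ' := by
    have := hG ⟨e φ', LinearMap.mem_range_self e φ'⟩
    rw [LinearMap.compLeftInverse_apply_of_bdd ℓ e hb φ' (e φ') rfl] at this
    exact this
  have h2 : G (e φ') = ∫ x, g x * φ x := by
    rw [← InnerProductSpace.toDual_symm_apply (x := e φ')]
    have := inner_toLp_eq (Lp.memLp g) hφ.toC1.memLp
    rw [Lp.toLp_coeFn] at this
    exact this
  simp_rw [neg_mul, integral_neg, neg_neg]
  rw [← h2, h1]
  rfl

end Regularity

theorem exists_cutoff {U K : Set (Space N)} (hU : IsOpen U) (hK : IsCompact K) (hKU : K ⊆ U) :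
    ∃ η : Space N → ℝ, IsTestFunction U η ∧ ∃ V, IsOpen V ∧ K ⊆ V ∧ V ⊆ U ∧ ∀ x ∈ V, η x = 1 := by
  obtain ⟨L, hL, hKL, hLU⟩ := exists_compact_between hK hU hKU
  obtain ⟨f, h1, h0, -⟩ := exists_contMDiffMap_one_nhds_of_subset_interior
    (modelWithCornersSelf ℝ (Space N)) (n := (⊤ : ℕ∞)) hK.isClosed hKL
  obtain ⟨V, hV, hKV, hV1⟩ := mem_nhdsSet_iff_exists.1 h1
  have hs : tsupport (f : Space N → ℝ) ⊆ L :=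
    closure_minimal (fun x hx => by_contra fun h => hx (h0 x h)) hL.isClosed
  exact ⟨f, ⟨f.contMDiff.contDiff, hL.of_isClosed_subset (isClosed_tsupport _) hs, hs.trans hLU⟩,
    V ∩ U, hV.inter hU, subset_inter hKV hKU, inter_subset_right, fun x hx => hV1 hx.1⟩

theorem IsTestFunction.memLp_mul {U : Set (Space N)} (hU : IsOpen U) {η f : Space N → ℝ}
    (hη : IsTestFunction U η) (hf : MemLp f 2 (volume.restrict U)) :
    MemLp (fun x => η x * f x) 2 := by
  obtain ⟨C, hC⟩ := hη.toC1.continuous.bounded_above_of_compact_support hη.compact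
  have h1 : MemLp (fun x => η x * f x) 2 (volume.restrict U) :=
    hf.mul_bdd hη.toC1.continuous.aestronglyMeasurable (Eventually.of_forall hC)
  have h2 : U.indicator (fun x => η x * f x) = fun x => η x * f x :=
    indicator_eq_self.2 fun x hx => by_contra fun h => hx (by simp [hη.toC1.eq_zero h])
  rw [← h2]
  exact (memLp_indicator_iff_restrict hU.measurableSet).2 h1

/-- Multiplication by a cut-off function extends a weak derivative on `U` to the whole space. -/
theorem HasWeakDeriv.mul_test {U : Set (Space N)} {u g η : Space N → ℝ} {v : Space N}
    (h : HasWeakDeriv U v u g) (hη : IsTestFunction U η) :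
    HasWeakDeriv univ v (fun x => η x * u x)
      (fun x => η x * g x + fderiv ℝ η x v * u x) := by
  have hl : ∀ {f θ : Space N → ℝ}, LocallyIntegrableOn f U → IsTestFunction U θ →
      Integrable fun x => θ x * f x := fun hf hθ => by
    simpa only [mul_comm] using integrable_mul_of_locallyIntegrableOn hf hθ.toC1.continuous
      hθ.compact hθ.support_subset
  have hη' := hη.fderiv_apply v
  refine .of_integral_eq (locallyIntegrableOn_univ.2 (hl h.locallyIntegrable hη).locallyIntegrable)
    (locallyIntegrableOn_univ.2 ((hl h.locallyIntegrable_deriv hη).add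
      (hl h.locallyIntegrable hη')).locallyIntegrable) fun φ hφ => ?_
  have hηφ : IsTestFunction U fun x => φ x * η x := hη.mul_left hφ.smooth
  have e := h.integral_eq' hηφ
  have hd : ∀ x, fderiv ℝ (fun x => φ x * η x) x v =
      φ x * fderiv ℝ η x v + fderiv ℝ φ x v * η x := fun x =>
    fderiv_mul_test isOpen_univ hφ.toC1.contDiff.contDiffOn (hη.toC1.mono (subset_univ _)) x v
  simp_rw [hd] at e
  have i1 : Integrable fun x => φ x * fderiv ℝ η x v * u x :=
    hl h.locallyIntegrable (hη'.mul_left hφ.smooth)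
  have i2 : Integrable fun x => fderiv ℝ φ x v * η x * u x :=
    hl h.locallyIntegrable (hη.mul_left (hφ.fderiv_apply v).smooth)
  have i3 : Integrable fun x => φ x * η x * g x := hl h.locallyIntegrable_deriv hηφ
  have e1 : ∫ x, u x * (φ x * fderiv ℝ η x v + fderiv ℝ φ x v * η x) =
      (∫ x, φ x * fderiv ℝ η x v * u x) + ∫ x, fderiv ℝ φ x v * η x * u x := by
    rw [← integral_add i1 i2]; congr 1; ext x; ring
  have e2 : ∫ x, (η x * g x + fderiv ℝ η x v * u x) * φ x =
      (∫ x, φ x * η x * g x) + ∫ x, φ x * fderiv ℝ η x v * u x := by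
    rw [← integral_add i3 i1]; congr 1; ext x; ring
  have e3 : ∫ x, η x * u x * fderiv ℝ φ x v = ∫ x, fderiv ℝ φ x v * η x * u x := by
    congr 1; ext x; ring
  have e4 : ∫ x, g x * (φ x * η x) = ∫ x, φ x * η x * g x := by congr 1; ext x; ring
  rw [e1, e4] at e
  rw [e2, e3]
  linarith

/-- Weak derivatives that are locally square integrable can be glued. -/
theorem exists_hasWeakDeriv_of_local {U : Set (Space N)} (hU : IsOpen U) {v : Space N}
    {u : Space N → ℝ} (hu : LocallyIntegrableOn u U)
    (h : ∀ K, IsCompact K → K ⊆ U → ∃ (V : Set (Space N)) (g : Space N → ℝ), IsOpen V ∧ K ⊆ V ∧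
      V ⊆ U ∧ MemLp g 2 ∧ HasWeakDeriv V v u g) :
    ∃ G, HasWeakDeriv U v u G ∧ ∀ K, IsCompact K → K ⊆ U → MemLp G 2 (volume.restrict K) := by
  classical
  have := hU.locallyCompactSpace
  let E := CompactExhaustion.choice U
  have hE : ∀ n, IsCompact (Subtype.val '' E n : Set (Space N)) := fun n =>
    (E.isCompact n).image continuous_subtype_val
  choose V g hV hKV hVU hg hw using fun n => h _ (hE n) (by simp)
  -- at `x`, use the local derivative of the first set of the exhaustion that contains `x`
  let G : Space N → ℝ := fun x => if hx : x ∈ U then g (E.find ⟨x, hx⟩) x else 0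
  have hmem : ∀ x (hx : x ∈ U), x ∈ V (E.find ⟨x, hx⟩) := fun x hx =>
    hKV _ ⟨⟨x, hx⟩, E.mem_find _, rfl⟩
  have hGg : ∀ m, G =ᵐ[volume.restrict (V m)] g m := by
    intro m
    have h1 : ∀ n, ∀ᵐ x, x ∈ V n ∩ V m → g n x = g m x := fun n =>
      (ae_restrict_iff' ((hV n).inter (hV m)).measurableSet).1
        (((hw n).mono inter_subset_left).unique ((hV n).inter (hV m))
          ((hw m).mono inter_subset_right))
    rw [EventuallyEq, ae_restrict_iff' (hV m).measurableSet]
    filter_upwards [ae_all_iff.2 h1] with x hx hxm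
    have hxU := hVU m hxm
    simp only [G, hxU, dif_pos]
    exact hx _ ⟨hmem x hxU, hxm⟩
  have hcover : ∀ K, IsCompact K → K ⊆ U → ∃ n, K ⊆ V n := by
    intro K hK hKU
    obtain ⟨n, hn⟩ := E.exists_superset_of_isCompact (s := Subtype.val ⁻¹' K)
      (Subtype.isCompact_iff.2 (by rwa [Subtype.image_preimage_coe, inter_eq_right.2 hKU]))
    exact ⟨n, fun x hx => hKV n ⟨⟨x, hKU hx⟩, hn hx, rfl⟩⟩
  have hL2 : ∀ K, IsCompact K → K ⊆ U → MemLp G 2 (volume.restrict K) := by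
    intro K hK hKU
    obtain ⟨n, hn⟩ := hcover K hK hKU
    exact (memLp_congr_ae (ae_restrict_of_ae_restrict_of_subset hn (hGg n))).2 ((hg n).restrict K)
  refine ⟨G, .of_integral_eq hu ?_ fun φ hφ => ?_, hL2⟩
  · refine (locallyIntegrableOn_iff hU.isLocallyClosed).2 fun K hKU hK => ?_
    have : IsFiniteMeasure ((volume : Measure (Space N)).restrict K) :=
      ⟨by simpa using hK.measure_lt_top⟩
    exact (hL2 K hK hKU).integrable (by norm_num)
  · obtain ⟨n, hn⟩ := hcover _ hφ.compact hφ.support_subset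
    exact ((hw n).congr (ae_eq_refl _) (hGg n).symm).integral_eq' ⟨hφ.smooth, hφ.compact, hn⟩

/-- Interior `H²` regularity: a weak solution of `-∂ᵢ(A_ij ∂ⱼ u) = h ∈ L²` with constant elliptic
coefficients has locally square integrable second derivatives. -/
theorem exists_second_weakGrad {U : Set (Space N)} (hU : IsOpen U)
    {A : Matrix (Fin N) (Fin N) ℝ} {γ₀ : ℝ} (h₀ : 0 < γ₀)
    (hA : ∀ ξ : Space N, γ₀ * ‖ξ‖ ^ 2 ≤ ∑ i, ∑ j, A i j * ξ i * ξ j)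
    {u h : Space N → ℝ} {du : Space N → Fin N → ℝ} (hu : MemLp u 2 (volume.restrict U))
    (hdu : ∀ i, MemLp (fun x => du x i) 2 (volume.restrict U)) (hh : MemLp h 2 (volume.restrict U))
    (hw : HasWeakGrad U u du)
    (heq : ∀ φ, IsTestFunction U φ →
      ∫ x in U, ∑ i, ∑ j, A i j * du x j * partialDeriv i φ x = ∫ x in U, h x * φ x) :
    ∃ d2 : Space N → Fin N → Fin N → ℝ,
      (∀ α, HasWeakGrad U (fun x => du x α) fun x => d2 x α) ∧
      ∀ K, IsCompact K → K ⊆ U → ∀ α β, MemLp (fun x => d2 x α β) 2 (volume.restrict K) := by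
  have key : ∀ α i, ∃ G, HasWeakDeriv U (unitVec i) (fun x => du x α) G ∧
      ∀ K, IsCompact K → K ⊆ U → MemLp G 2 (volume.restrict K) := by
    intro α i
    refine exists_hasWeakDeriv_of_local hU (locallyIntegrableOn_of_memLp_two (hdu α))
      fun K hK hKU => ?_
    obtain ⟨η, hη, V, hV, hKV, hVU, hη1⟩ := exists_cutoff hU hK hKU
    -- the localized function `w = η u`, its gradient and its source term
    let w : Space N → ℝ := fun x => η x * u x
    let Dw : Space N → Fin N → ℝ := fun x j => η x * du x j + partialDeriv j η x * u x
    have hη' := fun j => hη.partialDeriv j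
    have hη'' := fun i j => (hη' j).partialDeriv i
    let F : Space N → ℝ := fun x => η x * h x - ∑ i, ∑ j, A i j *
      (partialDeriv i η x * du x j + partialDeriv j η x * du x i +
        partialDeriv i (partialDeriv j η) x * u x)
    have hDw : HasWeakGrad univ w Dw := fun j => (hw j).mul_test hη
    have mD : ∀ j, MemLp (fun x => Dw x j) 2 := fun j =>
      (hη.memLp_mul hU (hdu j)).add ((hη' j).memLp_mul hU hu)
    have hz : ∀ x ∉ tsupport η, (η x = 0) ∧ (∀ j, partialDeriv j η x = 0) ∧
        ∀ i j, partialDeriv i (partialDeriv j η) x = 0 := by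
      intro x hx
      have h1 : ∀ j, x ∉ tsupport (partialDeriv j η) := fun j h' =>
        hx (tsupport_fderiv_apply_subset' η _ h')
      refine ⟨image_eq_zero_of_notMem_tsupport hx,
        fun j => image_eq_zero_of_notMem_tsupport (h1 j), fun i j => ?_⟩
      exact image_eq_zero_of_notMem_tsupport fun h' =>
        h1 j (tsupport_fderiv_apply_subset' _ _ h')
    have cs : ∀ f : Space N → ℝ, (∀ x ∉ tsupport η, f x = 0) → HasCompactSupport f := fun f hf =>
      HasCompactSupport.intro hη.compact.isCompact hf
    have mF : MemLp F 2 := (hη.memLp_mul hU hh).sub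
      (memLp_two_sum _ fun i _ => memLp_two_sum _ fun j _ => MemLp.const_mul
        ((((hη' i).memLp_mul hU (hdu j)).add ((hη' j).memLp_mul hU (hdu i))).add
          ((hη'' i j).memLp_mul hU hu)) _)
    -- `-∂ᵢ(A_ij ∂ⱼ w) = F`: test the equation of `u` with `η φ`, and move the derivative off `φ`
    -- in the terms `A_ij ∂ⱼη u ∂ᵢφ`
    have hsrc : ∀ φ, IsTestFunction univ φ →
        ∫ x, ∑ i, ∑ j, A i j * Dw x j * partialDeriv i φ x = ∫ x, F x * φ x := by
      intro φ hφ
      have mφ : MemLp φ 2 := hφ.toC1.memLp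
      have mφ' := fun i => (hφ.partialDeriv i).toC1.memLp (μ := volume)
      have i1 := fun i j => memLp_two_integrable_mul (hη.memLp_mul hU (hdu j)) (mφ' i)
      have i2 := fun i j => memLp_two_integrable_mul ((hη' i).memLp_mul hU (hdu j)) mφ
      have i4 := fun i j => memLp_two_integrable_mul ((hη'' i j).memLp_mul hU hu) mφ
      have i5 := fun i j => memLp_two_integrable_mul ((hη' j).memLp_mul hU hu) (mφ' i)
      have iH := memLp_two_integrable_mul (hη.memLp_mul hU hh) mφ
      have hηφ : IsTestFunction U fun x => φ x * η x := hη.mul_left hφ.smooth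
      have hd : ∀ i x, partialDeriv i (fun x => φ x * η x) x =
          φ x * partialDeriv i η x + partialDeriv i φ x * η x := fun i x =>
        fderiv_mul_test isOpen_univ hφ.toC1.contDiff.contDiffOn (hη.toC1.mono (subset_univ _)) x _
      have i12 : ∀ i j, Integrable fun x => A i j * (η x * du x j * partialDeriv i φ x +
          partialDeriv i η x * du x j * φ x) := fun i j => ((i1 i j).add (i2 i j)).const_mul _
      have i15 : ∀ i j, Integrable fun x => A i j * (η x * du x j * partialDeriv i φ x +
          partialDeriv j η x * u x * partialDeriv i φ x) := fun i j =>
        ((i1 i j).add (i5 i j)).const_mul _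
      have iR : ∀ i j, Integrable fun x => A i j * (partialDeriv i η x * du x j * φ x +
          partialDeriv j η x * du x i * φ x +
          partialDeriv i (partialDeriv j η) x * u x * φ x) := fun i j =>
        (((i2 i j).add (i2 j i)).add (i4 i j)).const_mul _
      have ea : ∑ i, ∑ j, A i j * ((∫ x, η x * du x j * partialDeriv i φ x) +
          ∫ x, partialDeriv i η x * du x j * φ x) = ∫ x, η x * h x * φ x := by
        have e := heq _ hηφ
        rw [setIntegral_eq_of_tsupport hηφ.support_subset,
          setIntegral_eq_integral_of_forall_compl_eq_zero] at e
        · have e1 : ∫ x, h x * (φ x * η x) = ∫ x, η x * h x * φ x := by congr 1; ext x; ring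
          rw [← e1, ← e]
          have e2 : ∀ x, ∑ i, ∑ j, A i j * du x j * partialDeriv i (fun x => φ x * η x) x =
              ∑ i, ∑ j, A i j * (η x * du x j * partialDeriv i φ x +
                partialDeriv i η x * du x j * φ x) := fun x =>
            Finset.sum_congr rfl fun i _ => Finset.sum_congr rfl fun j _ => by rw [hd]; ring
          simp_rw [e2]
          rw [integral_finsetSum _ fun i _ => integrable_finsetSum _ fun j _ =>
            i12 i j]
          refine Finset.sum_congr rfl fun i _ => ?_
          rw [integral_finsetSum _ fun j _ => i12 i j]
          refine Finset.sum_congr rfl fun j _ => ?_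
          rw [integral_const_mul, integral_add (i1 i j) (i2 i j)]
        · intro x hx
          have : ∀ i, partialDeriv i (fun x => φ x * η x) x = 0 := fun i => by
            simp [partialDeriv, hηφ.toC1.fderiv_eq_zero hx]
          simp [this]
      have eb : ∀ i j, ∫ x, partialDeriv j η x * u x * partialDeriv i φ x =
          -((∫ x, partialDeriv j η x * du x i * φ x) +
            ∫ x, partialDeriv i (partialDeriv j η) x * u x * φ x) := by
        intro i j
        rw [← integral_add (i2 j i) (i4 i j)]
        refine (((hw i).mul_test (hη' j)).integral_eq' hφ).trans ?_
        congr 2; ext x; simp only [partialDeriv]; ring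
      have eL : ∫ x, ∑ i, ∑ j, A i j * Dw x j * partialDeriv i φ x =
          ∑ i, ∑ j, A i j * ((∫ x, η x * du x j * partialDeriv i φ x) +
            ∫ x, partialDeriv j η x * u x * partialDeriv i φ x) := by
        have e2 : ∀ x, ∑ i, ∑ j, A i j * Dw x j * partialDeriv i φ x =
            ∑ i, ∑ j, A i j * (η x * du x j * partialDeriv i φ x +
              partialDeriv j η x * u x * partialDeriv i φ x) := fun x =>
          Finset.sum_congr rfl fun i _ => Finset.sum_congr rfl fun j _ => by
            simp only [Dw]; ring
        simp_rw [e2]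
        rw [integral_finsetSum _ fun i _ => integrable_finsetSum _ fun j _ =>
          i15 i j]
        refine Finset.sum_congr rfl fun i _ => ?_
        rw [integral_finsetSum _ fun j _ => i15 i j]
        refine Finset.sum_congr rfl fun j _ => ?_
        rw [integral_const_mul, integral_add (i1 i j) (i5 i j)]
      have eR : ∫ x, F x * φ x = (∫ x, η x * h x * φ x) -
          ∑ i, ∑ j, A i j * ((∫ x, partialDeriv i η x * du x j * φ x) +
            (∫ x, partialDeriv j η x * du x i * φ x) +
            ∫ x, partialDeriv i (partialDeriv j η) x * u x * φ x) := by
        have e2 : ∀ x, F x * φ x = η x * h x * φ x - ∑ i, ∑ j, A i j *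
            (partialDeriv i η x * du x j * φ x + partialDeriv j η x * du x i * φ x +
              partialDeriv i (partialDeriv j η) x * u x * φ x) := fun x => by
          simp only [F, sub_mul, Finset.sum_mul]
          congr 1
          exact Finset.sum_congr rfl fun i _ => Finset.sum_congr rfl fun j _ => by ring
        simp_rw [e2]
        rw [integral_sub iH (integrable_finsetSum _ fun i _ => integrable_finsetSum _ fun j _ =>
          iR i j), integral_finsetSum _ fun i _ => integrable_finsetSum _ fun j _ => iR i j]
        congr 1
        refine Finset.sum_congr rfl fun i _ => ?_
        rw [integral_finsetSum _ fun j _ => iR i j]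
        refine Finset.sum_congr rfl fun j _ => ?_
        have i23 : Integrable fun x => partialDeriv i η x * du x j * φ x +
          partialDeriv j η x * du x i * φ x := (i2 i j).add (i2 j i)
        rw [integral_const_mul, integral_add i23 (i4 i j), integral_add (i2 i j) (i2 j i)]
      rw [eL, eR, ← ea, ← Finset.sum_sub_distrib]
      refine Finset.sum_congr rfl fun i _ => ?_
      rw [← Finset.sum_sub_distrib]
      refine Finset.sum_congr rfl fun j _ => ?_
      rw [eb]; ring
    have hbound := fun φ hφ => abs_integral_weakGrad_mul_le h₀ hA (hη.memLp_mul hU hu)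
      (cs w fun x hx => by simp [w, (hz x hx).1]) mD
      (fun j => cs _ fun x hx => by simp [Dw, (hz x hx).1, (hz x hx).2.1]) mF
      (cs F fun x hx => by simp [F, (hz x hx).1, (hz x hx).2.1, (hz x hx).2.2]) hDw hsrc i α
      (φ := φ) hφ
    obtain ⟨g, hg, hgw⟩ := exists_hasWeakDeriv_of_bounded
      (locallyIntegrable_of_memLp_two (mD α)) (unitVec i) hbound
    -- on `V`, where `η = 1`, the localized gradient is `∇u`
    refine ⟨V, g, hV, hKV, hVU, hg, (hgw.mono (subset_univ V)).congr ?_ (ae_eq_refl _)⟩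
    rw [EventuallyEq, ae_restrict_iff' hV.measurableSet]
    refine Eventually.of_forall fun x hx => ?_
    have h1 : partialDeriv α η x = 0 := by
      have : η =ᶠ[𝓝 x] fun _ => 1 := by
        filter_upwards [hV.mem_nhds hx] with y hy using hη1 y hy
      simp [partialDeriv, this.fderiv_eq]
    simp [Dw, h1, hη1 x hx]
  choose G hG hG2 using key
  exact ⟨fun x α i => G α i x, fun α i => hG α i, fun K hK hKU α β => hG2 α β K hK hKU⟩

/-! ### Tensor products and the formal expansion -/

section Tensor

variable {U Q : Set (Space N)}

theorem IsTestFunction.slice_left {φ : Space N × Space N → ℝ} (h : IsTestFunction (U ×ˢ Q) φ)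
    (y : Space N) : IsTestFunction U fun x => φ (x, y) := by
  have hc : IsCompact (Prod.fst '' tsupport φ) := h.compact.isCompact.image continuous_fst
  have hs : tsupport (fun x => φ (x, y)) ⊆ Prod.fst '' tsupport φ :=
    closure_minimal (fun x hx => ⟨(x, y), subset_tsupport φ hx, rfl⟩) hc.isClosed
  refine ⟨h.smooth.comp (contDiff_id.prodMk contDiff_const),
    hc.of_isClosed_subset (isClosed_tsupport _) hs, hs.trans ?_⟩
  rintro _ ⟨p, hp, rfl⟩
  exact (h.support_subset hp).1

theorem IsTestFunction.slice_right {φ : Space N × Space N → ℝ} (h : IsTestFunction (U ×ˢ Q) φ)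
    (x : Space N) : IsTestFunction Q fun y => φ (x, y) := by
  have hc : IsCompact (Prod.snd '' tsupport φ) := h.compact.isCompact.image continuous_snd
  have hs : tsupport (fun y => φ (x, y)) ⊆ Prod.snd '' tsupport φ :=
    closure_minimal (fun y hy => ⟨(x, y), subset_tsupport φ hy, rfl⟩) hc.isClosed
  refine ⟨h.smooth.comp (contDiff_const.prodMk contDiff_id),
    hc.of_isClosed_subset (isClosed_tsupport _) hs, hs.trans ?_⟩
  rintro _ ⟨p, hp, rfl⟩
  exact (h.support_subset hp).2

theorem IsTestFunction.fderiv_slice_left {φ : Space N × Space N → ℝ}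
    (h : IsTestFunction (U ×ˢ Q) φ) (x y v : Space N) :
    fderiv ℝ (fun x => φ (x, y)) x v = fderiv ℝ φ (x, y) (v, 0) := by
  have h1 : HasFDerivAt φ (fderiv ℝ φ (x, y)) (x, y) :=
    (h.toC1.contDiff.differentiable (by simp) _).hasFDerivAt
  have h2 := HasFDerivAt.comp (g := φ) (f := fun e => (e, y)) x h1 (hasFDerivAt_prodMk_left x y)
  have h3 : fderiv ℝ (fun x => φ (x, y)) x = _ := h2.fderiv
  rw [h3]; simp

theorem IsTestFunction.fderiv_slice_right {φ : Space N × Space N → ℝ}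
    (h : IsTestFunction (U ×ˢ Q) φ) (x y v : Space N) :
    fderiv ℝ (fun y => φ (x, y)) y v = fderiv ℝ φ (x, y) (0, v) := by
  have h1 : HasFDerivAt φ (fderiv ℝ φ (x, y)) (x, y) :=
    (h.toC1.contDiff.differentiable (by simp) _).hasFDerivAt
  have h2 := HasFDerivAt.comp (g := φ) (f := fun e => (x, e)) y h1 (hasFDerivAt_prodMk_right x y)
  have h3 : fderiv ℝ (fun y => φ (x, y)) y = _ := h2.fderiv
  rw [h3]; simp

theorem locallyIntegrableOn_tensor (hU : IsOpen U) (hQ : IsOpen Q) {a b : Space N → ℝ}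
    (ha : LocallyIntegrableOn a U) (hb : IntegrableOn b Q) :
    LocallyIntegrableOn (fun p : Space N × Space N => a p.1 * b p.2) (U ×ˢ Q) := by
  refine (locallyIntegrableOn_iff (hU.prod hQ).isLocallyClosed).2 fun K hK hKc => ?_
  have hc : IsCompact (Prod.fst '' K) := hKc.image continuous_fst
  have h1 : IntegrableOn a (Prod.fst '' K) := ha.integrableOn_compact_subset
    (by rintro _ ⟨p, hp, rfl⟩; exact (hK hp).1) hc
  have h2 : IntegrableOn (fun p : Space N × Space N => a p.1 * b p.2) ((Prod.fst '' K) ×ˢ Q) := by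
    rw [IntegrableOn, Measure.volume_eq_prod, ← Measure.prod_restrict]
    exact Integrable.mul_prod h1 hb
  exact h2.mono_set fun p hp => ⟨⟨p, hp, rfl⟩, (hK hp).2⟩

variable {ι : Type*} [Fintype ι]

/-- A weak identity in the macroscopic variable may be tested with functions of both variables. -/
theorem sum_integral_tensor_left (hU : IsOpen U) (hQ : IsOpen Q) {F : ι → Space N → ℝ}
    {f b : Space N → ℝ} (v : ι → Space N) (hF : ∀ i, LocallyIntegrableOn (F i) U)
    (hf : LocallyIntegrableOn f U) (hb : IntegrableOn b Q)
    (heq : ∀ ψ, IsTestFunction U ψ →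
      ∑ i, ∫ x, F i x * fderiv ℝ ψ x (v i) = ∫ x, f x * ψ x)
    {φ : Space N × Space N → ℝ} (hφ : IsTestFunction (U ×ˢ Q) φ) :
    ∑ i, ∫ p : Space N × Space N, F i p.1 * b p.2 * fderiv ℝ φ p (v i, 0) =
      ∫ p : Space N × Space N, f p.1 * b p.2 * φ p := by
  have I : ∀ {a : Space N → ℝ} {θ : Space N × Space N → ℝ}, LocallyIntegrableOn a U →
      IsTestFunction (U ×ˢ Q) θ →
      Integrable fun p : Space N × Space N => a p.1 * b p.2 * θ p := fun ha hθ =>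
    integrable_mul_of_locallyIntegrableOn (locallyIntegrableOn_tensor hU hQ ha hb)
      hθ.toC1.continuous hθ.compact hθ.support_subset
  have e : ∀ (a : Space N → ℝ) (θ : Space N × Space N → ℝ), LocallyIntegrableOn a U →
      IsTestFunction (U ×ˢ Q) θ → ∫ p : Space N × Space N, a p.1 * b p.2 * θ p =
        ∫ y, b y * ∫ x, a x * θ (x, y) := fun a θ ha hθ => by
    rw [Measure.volume_eq_prod, integral_prod_symm _ (I ha hθ)]
    congr 1; ext y
    rw [← integral_const_mul]
    congr 1; ext x; ring
  have ii : ∀ i, Integrable fun y => b y * ∫ x, F i x * fderiv ℝ φ (x, y) (v i, 0) := fun i => by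
    have := (I (hF i) (hφ.fderiv_apply (v i, 0))).integral_prod_right
    refine this.congr (Eventually.of_forall fun y => ?_)
    simp only [← integral_const_mul]
    congr 1; ext x; ring
  rw [e f φ hf hφ]
  simp_rw [fun i => e (F i) _ (hF i) (hφ.fderiv_apply (v i, 0))]
  rw [← integral_finsetSum _ fun i _ => ii i]
  congr 1; ext y
  rw [← Finset.mul_sum, ← heq _ (hφ.slice_left y)]
  simp_rw [hφ.fderiv_slice_left]

/-- A weak identity in the microscopic variable may be tested with functions of both variables. -/
theorem sum_integral_tensor_right (hU : IsOpen U) (hQ : IsOpen Q) {F : ι → Space N → ℝ}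
    {f a : Space N → ℝ} (v : ι → Space N) (hF : ∀ i, IntegrableOn (F i) Q)
    (hf : IntegrableOn f Q) (ha : LocallyIntegrableOn a U)
    (heq : ∀ ψ, IsTestFunction Q ψ →
      ∑ i, ∫ y, F i y * fderiv ℝ ψ y (v i) = ∫ y, f y * ψ y)
    {φ : Space N × Space N → ℝ} (hφ : IsTestFunction (U ×ˢ Q) φ) :
    ∑ i, ∫ p : Space N × Space N, a p.1 * F i p.2 * fderiv ℝ φ p (0, v i) =
      ∫ p : Space N × Space N, a p.1 * f p.2 * φ p := by
  have I : ∀ {b : Space N → ℝ} {θ : Space N × Space N → ℝ}, IntegrableOn b Q →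
      IsTestFunction (U ×ˢ Q) θ →
      Integrable fun p : Space N × Space N => a p.1 * b p.2 * θ p := fun hb hθ =>
    integrable_mul_of_locallyIntegrableOn (locallyIntegrableOn_tensor hU hQ ha hb)
      hθ.toC1.continuous hθ.compact hθ.support_subset
  have e : ∀ (b : Space N → ℝ) (θ : Space N × Space N → ℝ), IntegrableOn b Q →
      IsTestFunction (U ×ˢ Q) θ → ∫ p : Space N × Space N, a p.1 * b p.2 * θ p =
        ∫ x, a x * ∫ y, b y * θ (x, y) := fun b θ hb hθ => by
    rw [Measure.volume_eq_prod, integral_prod _ (I hb hθ)]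
    congr 1; ext y
    rw [← integral_const_mul]
    congr 1; ext x; ring
  have ii : ∀ i, Integrable fun x => a x * ∫ y, F i y * fderiv ℝ φ (x, y) (0, v i) := fun i => by
    have := (I (hF i) (hφ.fderiv_apply (0, v i))).integral_prod_left
    refine this.congr (Eventually.of_forall fun y => ?_)
    simp only [← integral_const_mul]
    congr 1; ext x; ring
  rw [e f φ hf hφ]
  simp_rw [fun i => e (F i) _ (hF i) (hφ.fderiv_apply (0, v i))]
  rw [← integral_finsetSum _ fun i _ => ii i]
  congr 1; ext x
  rw [← Finset.mul_sum, ← heq _ (hφ.slice_right x)]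
  simp_rw [hφ.fderiv_slice_right]

theorem HasWeakDeriv.tensor_left (hU : IsOpen U) (hQ : IsOpen Q) {j : Fin N}
    {a a' b : Space N → ℝ} (h : HasWeakDeriv U (unitVec j) a a') (hb : IntegrableOn b Q) :
    HasWeakDeriv (U ×ˢ Q) (macroVec j) (fun p : Space N × Space N => a p.1 * b p.2)
      (fun p => a' p.1 * b p.2) := by
  refine .of_integral_eq (locallyIntegrableOn_tensor hU hQ h.locallyIntegrable hb)
    (locallyIntegrableOn_tensor hU hQ h.locallyIntegrable_deriv hb) fun φ hφ => ?_
  have := sum_integral_tensor_left hU hQ (F := fun _ : Unit => a) (f := fun x => -a' x)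
    (fun _ => unitVec j) (fun _ => h.locallyIntegrable) h.locallyIntegrable_deriv.neg hb
    (fun ψ hψ => by simpa [integral_neg] using h.integral_eq' hψ) hφ
  simpa [integral_neg, macroVec] using this

theorem HasWeakDeriv.tensor_right (hU : IsOpen U) (hQ : IsOpen Q) {j : Fin N}
    {a b b' : Space N → ℝ} (h : HasWeakDeriv Q (unitVec j) b b') (ha : LocallyIntegrableOn a U)
    (hb : IntegrableOn b Q) (hb' : IntegrableOn b' Q) :
    HasWeakDeriv (U ×ˢ Q) (microVec j) (fun p : Space N × Space N => a p.1 * b p.2)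
      (fun p => a p.1 * b' p.2) := by
  refine .of_integral_eq (locallyIntegrableOn_tensor hU hQ ha hb)
    (locallyIntegrableOn_tensor hU hQ ha hb') fun φ hφ => ?_
  have := sum_integral_tensor_right hU hQ (F := fun _ : Unit => b) (f := fun x => -b' x)
    (fun _ => unitVec j) (fun _ => hb) hb'.neg ha
    (fun ψ hψ => by simpa [integral_neg] using h.integral_eq' hψ) hφ
  simpa [integral_neg, microVec] using this

end Tensor

theorem locallyIntegrableOn_finsetSum {ι : Type*} (s : Finset ι) {U : Set (Space N)}
    {f : ι → Space N → ℝ} (h : ∀ i ∈ s, LocallyIntegrableOn (f i) U) :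
    LocallyIntegrableOn (fun x => ∑ i ∈ s, f i x) U := by
  classical
  induction s using Finset.induction_on with
  | empty => simpa using locallyIntegrableOn_zero
  | insert a s ha ih =>
    simp_rw [Finset.sum_insert ha]
    exact (h a (by simp)).add (ih fun i hi => h i (by simp [hi]))

/-- Weak identities over `U` in the form used by `sum_integral_tensor_left` and
`sum_integral_tensor_right`. -/
theorem sum_integral_eq_of_setIntegral_eq {U : Set (Space N)} {F : Fin N → Space N → ℝ}
    {f ψ : Space N → ℝ} (hF : ∀ i, LocallyIntegrableOn (F i) U) (hψ : IsC1TestFunction U ψ)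
    (e : ∫ x in U, ∑ i, F i x * partialDeriv i ψ x = ∫ x in U, f x * ψ x) :
    ∑ i, ∫ x, F i x * fderiv ℝ ψ x (unitVec i) = ∫ x, f x * ψ x := by
  have ii : ∀ i, Integrable fun x => F i x * partialDeriv i ψ x := fun i =>
    integrable_mul_of_locallyIntegrableOn (hF i) (hψ.continuous_fderiv_apply _)
      (hψ.hasCompactSupport_fderiv_apply _)
      ((tsupport_fderiv_apply_subset' ψ _).trans hψ.support_subset)
  rw [setIntegral_eq_of_tsupport hψ.support_subset,
    setIntegral_eq_integral_of_forall_compl_eq_zero, integral_finsetSum _ fun i _ => ii i] at e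
  · exact e
  · intro x hx
    simp [partialDeriv, hψ.fderiv_eq_zero hx]

section Formal

variable {k : Space N → Matrix (Fin N) (Fin N) ℝ} {γ₀ γ₁ : ℝ}

/-- `k_ij (∂ⱼT + ∂ⱼM_α ∂_αT) = P_iα ∂_αT`, with `t` for the gradient of `T`. -/
theorem sum_firstFlux (dM1 : Fin N → Space N → Fin N → ℝ) (t : Fin N → ℝ) (y : Space N)
    (i : Fin N) : ∑ j, k y i j * (t j + ∑ α, dM1 α y j * t α) =
      ∑ α, t α * firstFlux k dM1 i α y := by
  simp only [firstFlux, mul_add, Finset.sum_add_distrib, Finset.mul_sum]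
  rw [Finset.sum_comm (f := fun j α => k y i j * (dM1 α y j * t α))]
  congr 1
  · exact Finset.sum_congr rfl fun j _ => mul_comm _ _
  · exact Finset.sum_congr rfl fun α _ => Finset.sum_congr rfl fun j _ => by ring

/-- `k_ij (M_α ∂²_αj T + ∂ⱼM_αβ ∂²_αβ T) = W_iαβ ∂²_αβ T`, with `d` for the second derivatives
of `T`. -/
theorem sum_secondFlux (M1 : Fin N → Space N → ℝ) (dM2 : Fin N → Fin N → Space N → Fin N → ℝ)
    (d : Fin N → Fin N → ℝ) (y : Space N) (i : Fin N) :
    ∑ j, k y i j * ((∑ α, M1 α y * d α j) + ∑ α, ∑ β, dM2 α β y j * d α β) =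
      ∑ α, ∑ β, d α β * secondFlux k M1 dM2 i α β y := by
  simp only [secondFlux, mul_add, Finset.sum_add_distrib, Finset.mul_sum]
  congr 1
  · rw [Finset.sum_comm]
    exact Finset.sum_congr rfl fun α _ => Finset.sum_congr rfl fun j _ => by ring
  · rw [Finset.sum_comm]
    refine Finset.sum_congr rfl fun α _ => ?_
    rw [Finset.sum_comm]
    exact Finset.sum_congr rfl fun β _ => Finset.sum_congr rfl fun j _ => by ring

theorem MemH10.hasWeakGrad {u : Space N → ℝ} {g : Space N → Fin N → ℝ} {U : Set (Space N)}
    (hU : Bornology.IsBounded U) (h : MemH10 U u g) : HasWeakGrad U u g := fun i =>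
  .of_integral_eq (locallyIntegrableOn_of_memLp_two h.memLp)
    (locallyIntegrableOn_of_memLp_two (h.memLp_grad i)) fun φ hφ => by
      rw [← setIntegral_eq_of_tsupport hφ.support_subset, ← setIntegral_eq_of_tsupport
        ((tsupport_fderiv_apply_subset' φ (unitVec i)).trans hφ.support_subset)]
      exact h.integral_mul_partialDeriv hU hφ.toC1.contDiff i

/-- The equations of orders `ε⁻²`, `ε⁻¹` and `ε⁰` hold: the first by `∂_y T0 = 0`, the second by
the first-order cell problem. In the third, integration by parts in `x` and the second-order cell
problem cancel the oscillating part `∂²_αβ T0 P_αβ`, and the homogenized equation remains. -/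
theorem isFormalExpansion {U : Set (Space N)} (hU : IsOpen U) (h₀ : 0 ≤ γ₀)
    (hk : IsElliptic (unitCell N) k γ₀ γ₁) {M1 : Fin N → Space N → ℝ}
    {dM1 : Fin N → Space N → Fin N → ℝ} {M2 : Fin N → Fin N → Space N → ℝ}
    {dM2 : Fin N → Fin N → Space N → Fin N → ℝ}
    (hM1 : ∀ α, IsFirstCellSolution k α (M1 α) (dM1 α))
    (hM2 : ∀ α β, IsSecondCellSolution k M1 dM1 α β (M2 α β) (dM2 α β))
    {T0 h : Space N → ℝ} {dT0 : Space N → Fin N → ℝ} {d2 : Space N → Fin N → Fin N → ℝ}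
    (hT : HasWeakGrad U T0 dT0) (hd2 : ∀ α, HasWeakGrad U (fun x => dT0 x α) fun x => d2 x α)
    (hh : LocallyIntegrableOn h U)
    (heq : ∀ φ, IsTestFunction U φ →
      ∫ x in U, ∑ i, ∑ j, homogenized k dM1 i j * dT0 x j * partialDeriv i φ x =
        ∫ x in U, h x * φ x) :
    IsFormalExpansion U k h (fun p => T0 p.1) (firstOrderTerm M1 dT0)
      (secondOrderTerm M2 d2) := by
  have hQ := isOpen_unitCell (N := N)
  have i1 : ∀ {b : Space N → ℝ}, MemLp b 2 (volume.restrict (unitCell N)) →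
      IntegrableOn b (unitCell N) := fun hb => hb.integrable (by norm_num)
  have ione : IntegrableOn (fun _ : Space N => (1 : ℝ)) (unitCell N) := i1 (memLp_const 1)
  have iM1 := fun α => i1 (hM1 α).1.memLp
  have idM1 := fun α j => i1 ((hM1 α).1.memLp_grad j)
  have idM2 := fun α β j => i1 ((hM2 α β).1.memLp_grad j)
  have iP : ∀ i α, IntegrableOn (firstFlux k dM1 i α) (unitCell N) := fun i α =>
    i1 (memLp_firstFlux h₀ hk (fun α => (hM1 α).1.memLp_grad) i α)
  have iW : ∀ i α β, IntegrableOn (secondFlux k M1 dM2 i α β) (unitCell N) := fun i α β =>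
    i1 (memLp_secondFlux h₀ hk (fun α => (hM1 α).1.memLp) (fun α β => (hM2 α β).1.memLp_grad) i α β)
  have lT : ∀ α, LocallyIntegrableOn (fun x => dT0 x α) U := fun α => (hT α).locallyIntegrable_deriv
  have l2 : ∀ α β, LocallyIntegrableOn (fun x => d2 x α β) U := fun α β =>
    (hd2 α β).locallyIntegrable_deriv
  -- the gradients `∂ₓT0`, `∂ₓT1`, `∂_yT0`, `∂_yT1`, `∂_yT2`
  refine ⟨fun j p => dT0 p.1 j, fun j p => ∑ α, M1 α p.2 * d2 p.1 α j, fun _ _ => 0,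
    fun j p => ∑ α, dM1 α p.2 j * dT0 p.1 α, fun j p => ∑ α, ∑ β, dM2 α β p.2 j * d2 p.1 α β,
    fun j => ?_, fun j => ?_, fun j => ?_, fun j => ?_, fun j => ?_, fun φ hφ => ⟨?_, ?_, ?_⟩⟩
  · simpa only [mul_one] using (hT j).tensor_left hU hQ ione
  · refine HasWeakDeriv.sum _ fun α _ => ?_
    simpa only [mul_comm] using (hd2 α j).tensor_left hU hQ (iM1 α)
  · have hz : HasWeakDeriv (unitCell N) (unitVec j) (fun _ => (1 : ℝ)) fun _ => 0 := by
      simpa using HasWeakDeriv.of_contDiffOn hQ (contDiffOn_const (c := (1 : ℝ))) (unitVec j)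
    simpa only [mul_one, mul_zero] using
      hz.tensor_right hU hQ (hT j).locallyIntegrable ione (integrable_zero _ _ _)
  · refine HasWeakDeriv.sum _ fun α _ => ?_
    simpa only [mul_comm] using ((hM1 α).1.hasWeakGrad isBounded_unitCell j).tensor_right hU hQ
      (lT α) (iM1 α) (idM1 α j)
  · refine HasWeakDeriv.sum _ fun α _ => HasWeakDeriv.sum _ fun β _ => ?_
    simpa only [mul_comm] using ((hM2 α β).1.hasWeakGrad isBounded_unitCell j).tensor_right hU hQ
      (l2 α β) (i1 (hM2 α β).1.memLp) (idM2 α β j)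
  · simp
  all_goals
    have hmi := fun i => hφ.fderiv_apply (microVec i)
    have hma := fun i => hφ.fderiv_apply (macroVec i)
    have I : ∀ {a b : Space N → ℝ} {θ : Space N × Space N → ℝ}, LocallyIntegrableOn a U →
        IntegrableOn b (unitCell N) → IsTestFunction (U ×ˢ unitCell N) θ →
        Integrable fun p : Space N × Space N => a p.1 * b p.2 * θ p := fun ha hb hθ =>
      integrable_mul_of_locallyIntegrableOn (locallyIntegrableOn_tensor hU hQ ha hb)
        hθ.toC1.continuous hθ.compact hθ.support_subset
    have hz : ∀ p ∉ U ×ˢ unitCell N, ∀ v, fderiv ℝ φ p v = 0 := fun p hp v => by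
      rw [hφ.toC1.fderiv_eq_zero hp]; rfl
    rw [setIntegral_eq_integral_of_forall_compl_eq_zero fun p hp => by simp [hz p hp]]
  · have e : ∀ p : Space N × Space N, (∑ i, ∑ j,
        (k p.2 i j * (dT0 p.1 j + ∑ α, dM1 α p.2 j * dT0 p.1 α) * fderiv ℝ φ p (microVec i) +
          k p.2 i j * 0 * fderiv ℝ φ p (macroVec i))) = ∑ α, ∑ i,
            dT0 p.1 α * firstFlux k dM1 i α p.2 * fderiv ℝ φ p (microVec i) := fun p => by
      rw [Finset.sum_comm (f := fun α i => dT0 p.1 α * firstFlux k dM1 i α p.2 *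
        fderiv ℝ φ p (microVec i))]
      refine Finset.sum_congr rfl fun i _ => ?_
      simp only [mul_zero, zero_mul, add_zero]
      rw [← Finset.sum_mul, ← Finset.sum_mul, sum_firstFlux]
    simp_rw [e]
    rw [integral_finsetSum _ fun α _ => integrable_finsetSum _ fun i _ => I (lT α) (iP i α) (hmi i)]
    refine Finset.sum_eq_zero fun α _ => ?_
    rw [integral_finsetSum _ fun i _ => I (lT α) (iP i α) (hmi i)]
    refine (sum_integral_tensor_right hU hQ (f := fun _ => 0) unitVec (fun i => iP i α)
      (integrable_zero _ _ _) (lT α) (fun ψ hψ => ?_) hφ).trans (by simp)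
    refine sum_integral_eq_of_setIntegral_eq (fun i => (iP i α).locallyIntegrableOn) hψ.toC1 ?_
    simpa using (hM1 α).integral_firstFlux h₀ hk hψ
  · rw [setIntegral_eq_of_tsupport hφ.support_subset]
    have e : ∀ p : Space N × Space N, (∑ i, ∑ j,
        (k p.2 i j * (dT0 p.1 j + ∑ α, dM1 α p.2 j * dT0 p.1 α) * fderiv ℝ φ p (macroVec i) +
          k p.2 i j * ((∑ α, M1 α p.2 * d2 p.1 α j) + ∑ α, ∑ β, dM2 α β p.2 j * d2 p.1 α β) *
            fderiv ℝ φ p (microVec i))) =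
        (∑ α, ∑ i, dT0 p.1 α * firstFlux k dM1 i α p.2 * fderiv ℝ φ p (macroVec i)) +
          ∑ α, ∑ β, ∑ i, d2 p.1 α β * secondFlux k M1 dM2 i α β p.2 *
            fderiv ℝ φ p (microVec i) := fun p => by
      simp only [Finset.sum_add_distrib]
      congr 1
      · rw [Finset.sum_comm (f := fun α i => dT0 p.1 α * firstFlux k dM1 i α p.2 *
          fderiv ℝ φ p (macroVec i))]
        refine Finset.sum_congr rfl fun i _ => ?_
        rw [← Finset.sum_mul, ← Finset.sum_mul, sum_firstFlux]
      · simp_rw [← Finset.sum_mul, sum_secondFlux, Finset.sum_mul]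
        rw [Finset.sum_comm]
        exact Finset.sum_congr rfl fun α _ => Finset.sum_comm
    simp_rw [e]
    have iA := fun α i => I (lT α) (iP i α) (hma i)
    have iB := fun α β i => I (l2 α β) (iW i α β) (hmi i)
    rw [integral_add (integrable_finsetSum _ fun α _ => integrable_finsetSum _ fun i _ => iA α i)
      (integrable_finsetSum _ fun α _ => integrable_finsetSum _ fun β _ =>
        integrable_finsetSum _ fun i _ => iB α β i),
      integral_finsetSum _ fun α _ => integrable_finsetSum _ fun i _ => iA α i,
      integral_finsetSum _ fun α _ => integrable_finsetSum _ fun β _ =>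
        integrable_finsetSum _ fun i _ => iB α β i]
    -- integration by parts in `x`
    have e1 : ∀ α, ∫ p : Space N × Space N, ∑ i,
        dT0 p.1 α * firstFlux k dM1 i α p.2 * fderiv ℝ φ p (macroVec i) =
          -∑ i, ∫ p : Space N × Space N, d2 p.1 α i * firstFlux k dM1 i α p.2 * φ p := fun α => by
      rw [integral_finsetSum _ fun i _ => iA α i, ← Finset.sum_neg_distrib]
      exact Finset.sum_congr rfl fun i _ =>
        ((hd2 α i).tensor_left hU hQ (iP i α)).integral_eq' hφ
    -- the second-order cell problem
    have e2 : ∀ α β, ∫ p : Space N × Space N, ∑ i,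
        d2 p.1 α β * secondFlux k M1 dM2 i α β p.2 * fderiv ℝ φ p (microVec i) =
          (∫ p : Space N × Space N, d2 p.1 α β * firstFlux k dM1 α β p.2 * φ p) -
            homogenized k dM1 α β * ∫ p : Space N × Space N, d2 p.1 α β * 1 * φ p := fun α β => by
      rw [integral_finsetSum _ fun i _ => iB α β i]
      refine (sum_integral_tensor_right hU hQ
        (f := fun y => firstFlux k dM1 α β y - homogenized k dM1 α β) unitVec (fun i => iW i α β)
        ((iP α β).sub (i1 (memLp_const _))) (l2 α β) (fun ψ hψ => ?_) hφ).trans ?_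
      · exact sum_integral_eq_of_setIntegral_eq (fun i => (iW i α β).locallyIntegrableOn) hψ.toC1
          ((hM2 α β).integral_secondFlux h₀ hk (hM1 α).1.memLp hψ)
      · rw [← integral_const_mul, ← integral_sub (I (l2 α β) (iP α β) hφ)
          ((I (l2 α β) ione hφ).const_mul _)]
        congr 1; ext p; ring
    -- symmetry of the second derivatives
    have e3 : ∀ α β, ∫ p : Space N × Space N, d2 p.1 β α * firstFlux k dM1 α β p.2 * φ p =
        ∫ p : Space N × Space N, d2 p.1 α β * firstFlux k dM1 α β p.2 * φ p := fun α β => by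
      have hs := (ae_restrict_iff' hU.measurableSet).1
        ((hT α).ae_eq_swap hU (hT β) (hd2 α β) (hd2 β α))
      refine integral_congr_ae ?_
      filter_upwards [Measure.quasiMeasurePreserving_fst.ae hs] with p hp
      by_cases hpU : p.1 ∈ U
      · simp only [hp hpU]
      · simp [hφ.toC1.eq_zero fun h' => hpU h'.1]
    have e4 : ∀ α β, ∫ p : Space N × Space N, d2 p.1 α β * 1 * φ p =
        -∫ p : Space N × Space N, dT0 p.1 α * 1 * fderiv ℝ φ p (macroVec β) := fun α β => by
      rw [((hd2 α β).tensor_left hU hQ ione).integral_eq' hφ, neg_neg]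
    -- the homogenized equation
    have e5 : ∑ i, ∫ p : Space N × Space N, (∑ j, homogenized k dM1 i j * dT0 p.1 j) * 1 *
        fderiv ℝ φ p (macroVec i) = ∫ p : Space N × Space N, h p.1 * 1 * φ p := by
      have lF : ∀ i, LocallyIntegrableOn (fun x => ∑ j, homogenized k dM1 i j * dT0 x j) U :=
        fun i => by
          exact locallyIntegrableOn_finsetSum _ fun j _ => (lT j).smul (homogenized k dM1 i j)
      refine sum_integral_tensor_left hU hQ (F := fun i x => ∑ j, homogenized k dM1 i j * dT0 x j)
        unitVec lF hh ione (fun ψ hψ => ?_) hφ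
      refine sum_integral_eq_of_setIntegral_eq lF hψ.toC1 ?_
      simp_rw [Finset.sum_mul]
      exact heq ψ hψ
    have e6 : ∀ i, ∫ p : Space N × Space N, (∑ j, homogenized k dM1 i j * dT0 p.1 j) * 1 *
        fderiv ℝ φ p (macroVec i) = ∑ j, homogenized k dM1 j i *
          ∫ p : Space N × Space N, dT0 p.1 j * 1 * fderiv ℝ φ p (macroVec i) := fun i => by
      simp_rw [← integral_const_mul]
      rw [← integral_finsetSum _ fun j _ => (I (lT j) ione (hma i)).const_mul _]
      congr 1; ext p
      simp_rw [Finset.sum_mul]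
      exact Finset.sum_congr rfl fun j _ => by
        rw [(homogenized_isSymm h₀ hk hM1).apply j i]; ring
    have e7 : ∀ α, ∫ p : Space N × Space N, ∑ β, ∑ i,
        d2 p.1 α β * secondFlux k M1 dM2 i α β p.2 * fderiv ℝ φ p (microVec i) =
          ∑ β, ((∫ p : Space N × Space N, d2 p.1 α β * firstFlux k dM1 α β p.2 * φ p) +
            homogenized k dM1 α β *
              ∫ p : Space N × Space N, dT0 p.1 α * 1 * fderiv ℝ φ p (macroVec β)) := fun α => by
      rw [integral_finsetSum _ fun β _ => integrable_finsetSum _ fun i _ => iB α β i]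
      exact Finset.sum_congr rfl fun β _ => by rw [e2, e4]; ring
    simp_rw [e6, mul_one] at e5
    rw [← e5]
    simp only [e1, e7, mul_one, Finset.sum_add_distrib, Finset.sum_neg_distrib]
    have e8 : ∑ α, ∑ i, ∫ p : Space N × Space N, d2 p.1 α i * firstFlux k dM1 i α p.2 * φ p =
        ∑ α, ∑ i, ∫ p : Space N × Space N, d2 p.1 α i * firstFlux k dM1 α i p.2 * φ p := by
      rw [Finset.sum_comm]
      exact Finset.sum_congr rfl fun i _ => Finset.sum_congr rfl fun α _ => e3 i α
    rw [e8, neg_add_cancel_left]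
    exact Finset.sum_comm

end Formal

/-! ### Periodic cells -/

section Cells

/-- The vector in `ℝᴺ` with integer coordinates `z`. -/
def latticeVec (z : Fin N → ℤ) : Space N := WithLp.toLp 2 fun i => (z i : ℝ)

/-- The open cell `ε (z + Q)`. -/
def cell (ε : ℝ) (z : Fin N → ℤ) : Set (Space N) := {x | ∀ i, ε * z i < x i ∧ x i < ε * (z i + 1)}

/-- The affine map `y ↦ ε (y + z)`, which maps `Q` onto `cell ε z`. -/
noncomputable def cellMap {ε : ℝ} (hε : ε ≠ 0) (z : Fin N → ℤ) : Space N ≃ₜ Space N :=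
  (Homeomorph.addRight (latticeVec z)).trans (Homeomorph.smulOfNeZero ε hε)

/-- The `ε`-periodic function equal to `b (x / ε - z)` in the cell `ε (z + Q)`. On the cell walls,
a null set, it takes values of `b` on the boundary of `Q`. -/
noncomputable def oscillate (ε : ℝ) (b : Space N → ℝ) (x : Space N) : ℝ := b (fracPart (ε⁻¹ • x))

variable {ε : ℝ}

theorem cellMap_apply (hε : ε ≠ 0) (z : Fin N → ℤ) (y : Space N) :
    cellMap hε z y = ε • (y + latticeVec z) := rfl

theorem cellMap_mem_cell (hε : 0 < ε) (z w : Fin N → ℤ) (y : Space N) :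
    cellMap hε.ne' z y ∈ cell ε (z + w) ↔ y ∈ cell 1 w := by
  simp only [cell, cellMap_apply, latticeVec, mem_ofPred_eq, PiLp.smul_apply, PiLp.add_apply,
    smul_eq_mul, mul_lt_mul_iff_right₀ hε, Pi.add_apply, Int.cast_add, one_mul]
  refine forall_congr' fun i => and_congr ?_ ?_ <;> constructor <;> intro h <;> linarith

theorem cell_one_zero : cell 1 (0 : Fin N → ℤ) = unitCell N := by
  simp [cell, unitCell]

theorem preimage_cellMap (hε : 0 < ε) (z : Fin N → ℤ) :
    cellMap hε.ne' z ⁻¹' cell ε z = unitCell N := by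
  ext y
  rw [mem_preimage, ← cell_one_zero, ← cellMap_mem_cell hε z 0, add_zero]

theorem isOpen_cell (z : Fin N → ℤ) : IsOpen (cell ε z) := by
  simp only [cell, ofPred_forall, ofPred_and]
  refine isOpen_iInter_of_finite fun i => IsOpen.inter ?_ ?_
  · exact isOpen_lt continuous_const (by fun_prop)
  · exact isOpen_lt (by fun_prop) continuous_const

theorem disjoint_cell (hε : 0 < ε) :
    Pairwise fun z w : Fin N → ℤ => Disjoint (cell ε z) (cell ε w) := by
  intro z w hzw
  refine Set.disjoint_left.2 fun x hz hw => hzw ?_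
  ext i
  have h1 : (z i : ℝ) < w i + 1 := lt_of_mul_lt_mul_left ((hz i).1.trans (hw i).2) hε.le
  have h2 : (w i : ℝ) < z i + 1 := lt_of_mul_lt_mul_left ((hw i).1.trans (hz i).2) hε.le
  have h3 : z i < w i + 1 := by exact_mod_cast h1
  have h4 : w i < z i + 1 := by exact_mod_cast h2
  omega

theorem iUnion_cell (hε : 0 < ε) : ⋃ z, cell ε z = openCells N ε := by
  ext x
  simp only [mem_iUnion, openCells, cell, mem_ofPred_eq]
  constructor
  · rintro ⟨z, hz⟩ i m hm
    have h1 : (z i : ℝ) < m := lt_of_mul_lt_mul_left (hm ▸ (hz i).1) hε.le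
    have h2 : (m : ℝ) < z i + 1 := lt_of_mul_lt_mul_left (hm ▸ (hz i).2) hε.le
    have h3 : z i < m := by exact_mod_cast h1
    have h4 : m < z i + 1 := by exact_mod_cast h2
    omega
  · intro h
    refine ⟨fun i => ⌊x i / ε⌋, fun i => ⟨?_, ?_⟩⟩
    · refine lt_of_le_of_ne ?_ (h i _).symm
      rw [mul_comm, ← le_div_iff₀ hε]
      exact Int.floor_le _
    · rw [mul_comm, ← div_lt_iff₀ hε]
      exact Int.lt_floor_add_one _

theorem volume_compl_openCells (ε : ℝ) : volume (openCells N ε)ᶜ = 0 := by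
  have : (openCells N ε)ᶜ = ⋃ i, ⋃ m : ℤ, {x : Space N | x i = ε * m} := by
    ext x; simp [openCells]
  rw [this]
  refine measure_iUnion_null fun i => measure_iUnion_null fun m => ?_
  have h1 : volume {x : Fin N → ℝ | x i = ε * m} = 0 := by
    have := Measure.pi_hyperplane (fun _ : Fin N => (volume : Measure ℝ)) i (ε * m)
    simpa [volume_pi] using this
  have h2 := (EuclideanSpace.volume_preserving_symm_measurableEquiv_toLp
    (Fin N)).measure_preimage_equiv {x : Fin N → ℝ | x i = ε * m}
  rw [h1] at h2
  exact h2

theorem ae_mem_openCells (ε : ℝ) : ∀ᵐ x : Space N, x ∈ openCells N ε := volume_compl_openCells ε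

theorem fracPart_cellMap (hε : 0 < ε) (z : Fin N → ℤ) {y : Space N} (hy : y ∈ unitCell N) :
    fracPart (ε⁻¹ • cellMap hε.ne' z y) = y := by
  rw [cellMap_apply, inv_smul_smul₀ hε.ne']
  ext i
  simp only [fracPart, latticeVec, PiLp.add_apply, Int.fract_add_intCast]
  exact Int.fract_eq_self.2 ⟨(hy i).1.le, (hy i).2⟩

theorem oscillate_cellMap (hε : 0 < ε) (b : Space N → ℝ) (z : Fin N → ℤ) {y : Space N}
    (hy : y ∈ unitCell N) : oscillate ε b (cellMap hε.ne' z y) = b y := by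
  rw [oscillate, fracPart_cellMap hε z hy]

theorem volume_restrict_cell (hε : 0 < ε) (z : Fin N → ℤ) :
    (volume : Measure (Space N)).restrict (cell ε z) = ENNReal.ofReal (ε ^ N) •
      Measure.map (cellMap hε.ne' z).toMeasurableEquiv (volume.restrict (unitCell N)) := by
  have h1 : Measure.map (cellMap hε.ne' z).toMeasurableEquiv (volume : Measure (Space N)) =
      ENNReal.ofReal ((ε ^ N)⁻¹) • volume := by
    have e : ((cellMap hε.ne' z).toMeasurableEquiv : Space N → Space N) =
        (ε • ·) ∘ (· + latticeVec z) := rfl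
    rw [e, ← Measure.map_map (measurable_const_smul ε) (measurable_add_const _),
      map_add_right_eq_self, Measure.map_addHaar_smul _ hε.ne']
    simp [abs_of_pos (pow_pos hε N)]
  have h2 : (volume : Measure (Space N)) = ENNReal.ofReal (ε ^ N) •
      Measure.map (cellMap hε.ne' z).toMeasurableEquiv volume := by
    rw [h1, smul_smul, ← ENNReal.ofReal_mul (by positivity), mul_inv_cancel₀ (by positivity)]
    simp
  conv_lhs => rw [h2]
  rw [Measure.restrict_smul, MeasurableEquiv.restrict_map]
  congr 3
  rw [← preimage_cellMap hε z]; rfl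

theorem setLIntegral_cell (hε : 0 < ε) (z : Fin N → ℤ) (f : Space N → ENNReal) :
    ∫⁻ x in cell ε z, f x =
      ENNReal.ofReal (ε ^ N) * ∫⁻ y in unitCell N, f (cellMap hε.ne' z y) := by
  rw [volume_restrict_cell hε z, lintegral_smul_measure, lintegral_map_equiv]
  rfl

theorem setIntegral_cell (hε : 0 < ε) (z : Fin N → ℤ) (f : Space N → ℝ) :
    ∫ x in cell ε z, f x = ε ^ N * ∫ y in unitCell N, f (cellMap hε.ne' z y) := by
  rw [volume_restrict_cell hε z, integral_smul_measure, integral_map_equiv,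
    ENNReal.toReal_ofReal (by positivity)]
  rfl

/-- Two integrable functions with the same integral over every cell have the same integral. -/
theorem integral_eq_of_cells (hε : 0 < ε) {f g : Space N → ℝ} (hf : Integrable f)
    (hg : Integrable g) (h : ∀ z : Fin N → ℤ, ∫ x in cell ε z, f x = ∫ x in cell ε z, g x) :
    ∫ x, f x = ∫ x, g x := by
  have key : ∀ {f : Space N → ℝ}, Integrable f →
      HasSum (fun z : Fin N → ℤ => ∫ x in cell ε z, f x) (∫ x, f x) := fun {f} hf => by
    have := hasSum_integral_iUnion (fun z => (isOpen_cell (ε := ε) z).measurableSet)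
      (disjoint_cell hε) (f := f) (μ := volume) hf.integrableOn
    rwa [iUnion_cell hε, Measure.restrict_eq_self_of_ae_mem (ae_mem_openCells ε)] at this
  have h1 := key hf
  simp_rw [h] at h1
  exact h1.unique (key hg)

theorem lintegral_eq_tsum_cells (hε : 0 < ε) (f : Space N → ENNReal) :
    ∫⁻ x, f x = ∑' z : Fin N → ℤ, ∫⁻ x in cell ε z, f x := by
  rw [← lintegral_iUnion (fun z => (isOpen_cell z).measurableSet) (disjoint_cell hε),
    iUnion_cell hε, Measure.restrict_eq_self_of_ae_mem (ae_mem_openCells ε)]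

theorem measurable_fracPart : Measurable (fracPart : Space N → Space N) := by
  unfold fracPart
  exact (WithLp.measurable_toLp 2 _).comp (measurable_pi_lambda _ fun i =>
    measurable_fract.comp (by fun_prop))

/-- Null sets of the unit cell repeat periodically to null sets. -/
theorem quasiMeasurePreserving_fracPart (hε : 0 < ε) :
    Measure.QuasiMeasurePreserving (fun x : Space N => fracPart (ε⁻¹ • x)) volume
      (volume.restrict (unitCell N)) := by
  have hm : Measurable fun x : Space N => fracPart (ε⁻¹ • x) :=
    measurable_fracPart.comp (measurable_const_smul _)
  refine ⟨hm, Measure.AbsolutelyContinuous.mk fun s hs h0 => ?_⟩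
  rw [Measure.map_apply hm hs, ← lintegral_indicator_one (hm hs), lintegral_eq_tsum_cells hε,
    ENNReal.tsum_eq_zero]
  intro z
  rw [setLIntegral_cell hε z]
  have : ∫⁻ y in unitCell N, ((fun x : Space N => fracPart (ε⁻¹ • x)) ⁻¹' s).indicator 1
      (cellMap hε.ne' z y) = ∫⁻ y in unitCell N, s.indicator 1 y :=
    setLIntegral_congr_fun isOpen_unitCell.measurableSet fun y hy => by
      have : cellMap hε.ne' z y ∈ (fun x : Space N => fracPart (ε⁻¹ • x)) ⁻¹' s ↔ y ∈ s := by
        rw [mem_preimage, fracPart_cellMap hε z hy]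
      by_cases hys : y ∈ s
      · rw [indicator_of_mem (this.2 hys), indicator_of_mem hys]; rfl
      · rw [indicator_of_notMem (mt this.1 hys), indicator_of_notMem hys]
  rw [this, lintegral_indicator_one hs, h0, mul_zero]

theorem aestronglyMeasurable_oscillate (hε : 0 < ε) {b : Space N → ℝ}
    (hb : AEStronglyMeasurable b (volume.restrict (unitCell N))) :
    AEStronglyMeasurable (oscillate ε b) :=
  hb.comp_quasiMeasurePreserving (quasiMeasurePreserving_fracPart hε)

/-- Cells have diameter at most `2 √N ε`. -/
theorem dist_le_of_mem_cell (hε : 0 < ε) {z : Fin N → ℤ} {x x' : Space N} (hx : x ∈ cell ε z)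
    (hx' : x' ∈ cell ε z) : dist x x' ≤ ε * (2 * Real.sqrt N) := by
  have key : ∀ {x}, x ∈ cell ε z → ‖x - ε • latticeVec z‖ ≤ ε * Real.sqrt N := fun {x} hx => by
    obtain ⟨y, rfl⟩ := (cellMap hε.ne' z).surjective x
    have hy : y ∈ unitCell N := by rw [← preimage_cellMap hε z]; exact hx
    rw [cellMap_apply, smul_add, add_sub_cancel_right, norm_smul, Real.norm_of_nonneg hε.le]
    exact mul_le_mul_of_nonneg_left (norm_le_of_mem_unitCell hy) hε.le
  calc dist x x' = ‖(x - ε • latticeVec z) - (x' - ε • latticeVec z)‖ := by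
        rw [sub_sub_sub_cancel_right, dist_eq_norm]
    _ ≤ _ := norm_sub_le _ _
    _ ≤ _ := by linarith [key hx, key hx']

/-- Oscillating functions are bounded in `L¹` on bounded sets, uniformly in `ε ≤ 1`: the cells that
meet `B` are disjoint and lie in a fixed neighbourhood of `B`. -/
theorem setLIntegral_fracPart_le (hε : 0 < ε) (hε1 : ε ≤ 1) {B : Set (Space N)}
    (hB : MeasurableSet B) (g : Space N → ENNReal) :
    ∫⁻ x in B, g (fracPart (ε⁻¹ • x)) ≤
      volume (Metric.cthickening (2 * Real.sqrt N) B) * ∫⁻ y in unitCell N, g y := by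
  set B' := Metric.cthickening (2 * Real.sqrt N) B
  have hB' : MeasurableSet B' := Metric.isClosed_cthickening.measurableSet
  have hc : ∀ z : Fin N → ℤ, ∫⁻ x in cell ε z, B.indicator (fun x => g (fracPart (ε⁻¹ • x))) x ≤
      volume (cell ε z ∩ B') * ∫⁻ y in unitCell N, g y := by
    intro z
    by_cases hz : (cell ε z ∩ B).Nonempty
    · obtain ⟨x₀, hx₀, hx₀B⟩ := hz
      have hsub : cell ε z ⊆ B' := fun x hx =>
        Metric.mem_cthickening_of_dist_le x x₀ _ B hx₀B
          ((dist_le_of_mem_cell hε hx hx₀).trans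
            (mul_le_of_le_one_left (by positivity) hε1))
      have hv : volume (cell ε z) = ENNReal.ofReal (ε ^ N) := by
        have := setLIntegral_cell hε z (fun _ => 1)
        simpa using this
      rw [inter_eq_left.2 hsub, hv]
      calc _ ≤ ∫⁻ x in cell ε z, g (fracPart (ε⁻¹ • x)) :=
            lintegral_mono fun x => indicator_le_self _ _ x
        _ = _ := by
            rw [setLIntegral_cell hε z]
            congr 1
            exact setLIntegral_congr_fun isOpen_unitCell.measurableSet fun y hy => by
              simp only [fracPart_cellMap hε z hy]
    · have : ∫⁻ x in cell ε z, B.indicator (fun x => g (fracPart (ε⁻¹ • x))) x = 0 := by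
        rw [setLIntegral_congr_fun (g := fun _ => 0) (isOpen_cell z).measurableSet]
        · simp
        · intro x hx
          exact indicator_of_notMem (fun hxB => hz ⟨x, hx, hxB⟩) _
      rw [this]; exact bot_le
  rw [← lintegral_indicator hB, lintegral_eq_tsum_cells hε]
  refine (ENNReal.tsum_le_tsum hc).trans ?_
  rw [ENNReal.tsum_mul_right]
  gcongr
  rw [← measure_iUnion (fun z w hzw => (disjoint_cell hε hzw).mono inter_subset_left
    inter_subset_left) fun z => (isOpen_cell z).measurableSet.inter hB']
  exact measure_mono (iUnion_subset fun z => inter_subset_right)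

/-- Oscillating functions are bounded in `L²` on bounded sets, uniformly in `ε ≤ 1`. -/
theorem exists_eLpNorm_oscillate_le {B : Set (Space N)} (hB : IsCompact B) {b : Space N → ℝ}
    (hb : MemLp b 2 (volume.restrict (unitCell N))) :
    ∃ C : ℝ, 0 ≤ C ∧ ∀ ε : ℝ, 0 < ε → ε ≤ 1 → MemLp (oscillate ε b) 2 (volume.restrict B) ∧
      Real.sqrt (∫ x in B, oscillate ε b x ^ 2) ≤ C := by
  have hV : volume (Metric.cthickening (2 * Real.sqrt N) B) < ⊤ :=
    (hB.isBounded.cthickening).measure_lt_top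
  have hfin : ∫⁻ y in unitCell N, ENNReal.ofReal (b y ^ 2) < ⊤ := by
    have := (memLp_two_iff_integrable_sq hb.aestronglyMeasurable).1 hb
    exact (hasFiniteIntegral_iff_ofReal (Eventually.of_forall fun _ => sq_nonneg _)).1
      this.hasFiniteIntegral
  set V := volume (Metric.cthickening (2 * Real.sqrt N) B) *
    ∫⁻ y in unitCell N, ENNReal.ofReal (b y ^ 2)
  have hVt : V < ⊤ := ENNReal.mul_lt_top hV hfin
  refine ⟨Real.sqrt V.toReal, Real.sqrt_nonneg _, fun ε hε hε1 => ?_⟩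
  have hle : ∫⁻ x in B, ENNReal.ofReal (oscillate ε b x ^ 2) ≤ V :=
    setLIntegral_fracPart_le hε hε1 hB.measurableSet fun y => ENNReal.ofReal (b y ^ 2)
  have hm : AEStronglyMeasurable (oscillate ε b) (volume.restrict B) :=
    (aestronglyMeasurable_oscillate hε hb.aestronglyMeasurable).restrict
  refine ⟨(memLp_two_iff_integrable_sq hm).2 ⟨hm.pow 2,
    (hasFiniteIntegral_iff_ofReal (Eventually.of_forall fun _ => sq_nonneg _)).2
      (hle.trans_lt hVt)⟩, Real.sqrt_le_sqrt ?_⟩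
  rw [integral_eq_lintegral_of_nonneg_ae (Eventually.of_forall fun _ => sq_nonneg _) (hm.pow 2)]
  exact ENNReal.toReal_mono hVt.ne hle

end Cells

/-! ### Periodic extension of the cell functions -/

section Periodic

variable {ε : ℝ} {U : Set (Space N)}

theorem locallyIntegrable_oscillate (hε : 0 < ε) (hε1 : ε ≤ 1) {b : Space N → ℝ}
    (hb : MemLp b 2 (volume.restrict (unitCell N))) : LocallyIntegrable (oscillate ε b) := by
  refine locallyIntegrable_iff.2 fun K hK => ?_
  obtain ⟨C, -, hC⟩ := exists_eLpNorm_oscillate_le hK hb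
  have : IsFiniteMeasure ((volume : Measure (Space N)).restrict K) :=
    ⟨by simpa using hK.measure_lt_top⟩
  exact (hC ε hε hε1).1.integrable (by norm_num)

theorem locallyIntegrableOn_oscillate_mul (hU : IsOpen U) (hε : 0 < ε) (hε1 : ε ≤ 1)
    {a b : Space N → ℝ} (hb : MemLp b 2 (volume.restrict (unitCell N))) (ha : ContinuousOn a U) :
    LocallyIntegrableOn (fun x => oscillate ε b x * a x) U :=
  ((locallyIntegrable_oscillate hε hε1 hb).locallyIntegrableOn U).mul_continuousOn ha
    hU.isLocallyClosed

theorem integrable_oscillate_mul (hU : IsOpen U) (hε : 0 < ε) (hε1 : ε ≤ 1)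
    {a b θ : Space N → ℝ} (hb : MemLp b 2 (volume.restrict (unitCell N))) (ha : ContinuousOn a U)
    (hθ : Continuous θ) (hc : HasCompactSupport θ) (hs : tsupport θ ⊆ U) :
    Integrable fun x => oscillate ε b x * a x * θ x :=
  integrable_mul_of_locallyIntegrableOn (locallyIntegrableOn_oscillate_mul hU hε hε1 hb ha) hθ hc hs

theorem partialDeriv_comp_cellMap (hε : ε ≠ 0) (z : Fin N → ℤ) {ψ : Space N → ℝ}
    (hψ : ContDiff ℝ 1 ψ) (i : Fin N) (y : Space N) :
    partialDeriv i (fun y => ψ (cellMap hε z y)) y = ε * partialDeriv i ψ (cellMap hε z y) := by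
  have h1 : HasFDerivAt (fun y => cellMap hε z y) (ε • ContinuousLinearMap.id ℝ (Space N)) y :=
    ((hasFDerivAt_id y).add_const (latticeVec z)).const_smul ε
  have h2 := ((hψ.differentiable (by simp) (cellMap hε z y)).hasFDerivAt).comp y h1
  have h3 : fderiv ℝ (fun y => ψ (cellMap hε z y)) y = _ := h2.fderiv
  simp [partialDeriv, h3]

theorem contDiff_cellMap (hε : ε ≠ 0) (z : Fin N → ℤ) :
    ContDiff ℝ 1 fun y : Space N => cellMap hε z y :=
  (contDiff_id.add contDiff_const).const_smul ε

/-- The periodic extension of an `H¹₀` function is weakly differentiable across the cell walls: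
in every cell, integration by parts against a `C¹` function leaves no boundary term. -/
theorem MemH10.integral_oscillate {u : Space N → ℝ} {g : Space N → Fin N → ℝ}
    (h : MemH10 (unitCell N) u g) (hε : 0 < ε) (hε1 : ε ≤ 1) {ψ : Space N → ℝ}
    (hψ : IsC1TestFunction univ ψ) (i : Fin N) :
    ∫ x, oscillate ε u x * partialDeriv i ψ x =
      ∫ x, -(ε⁻¹ * (oscillate ε (fun y => g y i) x * ψ x)) := by
  have i1 : Integrable fun x => oscillate ε u x * partialDeriv i ψ x :=
    integrable_mul_of_locallyIntegrableOn
      ((locallyIntegrable_oscillate hε hε1 h.memLp).locallyIntegrableOn univ)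
      (hψ.continuous_fderiv_apply _) (hψ.hasCompactSupport_fderiv_apply _) (subset_univ _)
  have i2 : Integrable fun x => oscillate ε (fun y => g y i) x * ψ x :=
    integrable_mul_of_locallyIntegrableOn
      ((locallyIntegrable_oscillate hε hε1 (h.memLp_grad i)).locallyIntegrableOn univ)
      hψ.continuous hψ.compact (subset_univ _)
  refine integral_eq_of_cells hε i1 (i2.const_mul _).neg fun z => ?_
  rw [setIntegral_cell hε, setIntegral_cell hε]
  congr 1
  have e := h.integral_mul_partialDeriv isBounded_unitCell
    (hψ.contDiff.comp (contDiff_cellMap hε.ne' z)) i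
  have e1 : ∫ y in unitCell N, oscillate ε u (cellMap hε.ne' z y) *
      partialDeriv i ψ (cellMap hε.ne' z y) =
      ε⁻¹ * ∫ y in unitCell N, u y * partialDeriv i (fun y => ψ (cellMap hε.ne' z y)) y := by
    rw [← integral_const_mul]
    refine setIntegral_congr_fun isOpen_unitCell.measurableSet fun y hy => ?_
    simp only [oscillate_cellMap hε _ z hy, partialDeriv_comp_cellMap hε.ne' z hψ.contDiff]
    field_simp
  have e2 : ∫ y in unitCell N, -(ε⁻¹ * (oscillate ε (fun y => g y i) (cellMap hε.ne' z y) *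
      ψ (cellMap hε.ne' z y))) = ε⁻¹ * -∫ y in unitCell N, g y i * ψ (cellMap hε.ne' z y) := by
    rw [← integral_neg, ← integral_const_mul]
    refine setIntegral_congr_fun isOpen_unitCell.measurableSet fun y hy => ?_
    simp only [oscillate_cellMap hε _ z hy]
    ring
  rw [e1, e2]
  congr 1

/-- The product rule for `M(x / ε) a(x)` with `a ∈ C¹(U)`. -/
theorem MemH10.hasWeakDeriv_oscillate_mul (hU : IsOpen U) {u a : Space N → ℝ}
    {g : Space N → Fin N → ℝ} (h : MemH10 (unitCell N) u g) (hε : 0 < ε) (hε1 : ε ≤ 1)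
    (ha : ContDiffOn ℝ 1 a U) (i : Fin N) :
    HasWeakDeriv U (unitVec i) (fun x => oscillate ε u x * a x)
      (fun x => ε⁻¹ * (oscillate ε (fun y => g y i) x * a x) +
        oscillate ε u x * partialDeriv i a x) := by
  have ha' : ContinuousOn (partialDeriv i a) U :=
    (ha.continuousOn_fderiv_of_isOpen hU (by simp)).clm_apply continuousOn_const
  have l1 := locallyIntegrableOn_oscillate_mul hU hε hε1 h.memLp ha.continuousOn
  have l2 := locallyIntegrableOn_oscillate_mul hU hε hε1 (h.memLp_grad i) ha.continuousOn
  have l3 := locallyIntegrableOn_oscillate_mul hU hε hε1 h.memLp ha'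
  refine .of_integral_eq l1 ((l2.smul ε⁻¹).add l3) fun φ hφ => ?_
  have hd := hφ.fderiv_apply (unitVec i)
  have i1 := integrable_mul_of_locallyIntegrableOn l1 hd.toC1.continuous hd.compact
    hd.support_subset
  have i2 := integrable_mul_of_locallyIntegrableOn l2 hφ.toC1.continuous hφ.compact
    hφ.support_subset
  have i3 := integrable_mul_of_locallyIntegrableOn l3 hφ.toC1.continuous hφ.compact
    hφ.support_subset
  have e := h.integral_oscillate hε hε1 ((hφ.toC1.mul_contDiffOn hU ha).mono (subset_univ _)) i
  have e1 : ∀ x, oscillate ε u x * partialDeriv i (fun x => a x * φ x) x =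
      oscillate ε u x * a x * fderiv ℝ φ x (unitVec i) +
        oscillate ε u x * partialDeriv i a x * φ x := fun x => by
    rw [partialDeriv, fderiv_mul_test hU ha hφ.toC1, partialDeriv]; ring
  simp_rw [e1] at e
  rw [integral_add i1 i3, integral_neg, integral_const_mul] at e
  have e2 : ∫ x, (ε⁻¹ * (oscillate ε (fun y => g y i) x * a x) +
      oscillate ε u x * partialDeriv i a x) * φ x =
      ε⁻¹ * (∫ x, oscillate ε (fun y => g y i) x * a x * φ x) +
        ∫ x, oscillate ε u x * partialDeriv i a x * φ x := by
    rw [← integral_const_mul, ← integral_add (i2.const_mul _) i3]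
    congr 1; ext x; ring
  simp_rw [← mul_assoc] at e e2 ⊢
  rw [e2]
  linarith

/-- A `C_c¹` function on a disjoint union of two open sets restricts to each of them. -/
theorem IsC1TestFunction.indicator {V W : Set (Space N)} (hV : IsOpen V) (hW : IsOpen W)
    (hVW : Disjoint V W) {ψ : Space N → ℝ} (hψ : IsC1TestFunction (V ∪ W) ψ) :
    IsC1TestFunction V (V.indicator ψ) := by
  have hz : ∀ x ∉ V, V.indicator ψ =ᶠ[𝓝 x] fun _ => 0 := by
    intro x hx
    by_cases hxW : x ∈ W
    · filter_upwards [hW.mem_nhds hxW] with y hy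
      exact indicator_of_notMem (fun hyV => hVW.le_bot ⟨hyV, hy⟩) _
    · have h1 : x ∉ tsupport ψ := fun h' => (hψ.support_subset h').elim hx hxW
      filter_upwards [notMem_tsupport_iff_eventuallyEq.1 h1] with y hy
      by_cases hyV : y ∈ V
      · rw [indicator_of_mem hyV, hy]; rfl
      · exact indicator_of_notMem hyV _
  refine ⟨contDiff_iff_contDiffAt.2 fun x => ?_,
    hψ.compact.mono (by rw [support_indicator]; exact inter_subset_right),
    fun x hx => by_contra fun hxV =>
      notMem_tsupport_iff_eventuallyEq.2 (hz x hxV) hx⟩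
  by_cases hx : x ∈ V
  · refine hψ.contDiff.contDiffAt.congr_of_eventuallyEq ?_
    filter_upwards [hV.mem_nhds hx] with y hy using indicator_of_mem hy _
  · exact contDiffAt_const.congr_of_eventuallyEq (hz x hx)

/-- A weak identity in the unit cell, rescaled to functions supported in the open cells. -/
theorem oscillate_integral_eq_of_test {F : Fin N → Space N → ℝ} {f : Space N → ℝ}
    (hF : ∀ i, MemLp (F i) 2 (volume.restrict (unitCell N)))
    (hf : MemLp f 2 (volume.restrict (unitCell N)))
    (hw : ∀ φ, IsTestFunction (unitCell N) φ →
      ∫ y in unitCell N, ∑ i, F i y * partialDeriv i φ y = ∫ y in unitCell N, f y * φ y)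
    (hε : 0 < ε) (hε1 : ε ≤ 1) {ψ : Space N → ℝ} (hψ : IsC1TestFunction (openCells N ε) ψ) :
    ε * ∑ i, ∫ x, oscillate ε (F i) x * partialDeriv i ψ x = ∫ x, oscillate ε f x * ψ x := by
  have i1 : ∀ i, Integrable fun x => oscillate ε (F i) x * partialDeriv i ψ x := fun i =>
    integrable_mul_of_locallyIntegrableOn
      ((locallyIntegrable_oscillate hε hε1 (hF i)).locallyIntegrableOn univ)
      (hψ.continuous_fderiv_apply _) (hψ.hasCompactSupport_fderiv_apply _) (subset_univ _)
  have i2 : Integrable fun x => oscillate ε f x * ψ x :=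
    integrable_mul_of_locallyIntegrableOn
      ((locallyIntegrable_oscillate hε hε1 hf).locallyIntegrableOn univ)
      hψ.continuous hψ.compact (subset_univ _)
  rw [← integral_finsetSum _ fun i _ => i1 i, ← integral_const_mul]
  refine integral_eq_of_cells hε ((integrable_finsetSum _ fun i _ => i1 i).const_mul _) i2
    fun z => ?_
  rw [setIntegral_cell hε, setIntegral_cell hε]
  congr 1
  -- Rescaled to the unit cell, `ψ` is supported in the union of `Q` and the other open cells `W`;
  -- its restriction to `Q` is an admissible test function there.
  let T := cellMap hε.ne' z
  let W : Set (Space N) := ⋃ w : {w : Fin N → ℤ // w ≠ 0}, cell 1 w.1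
  have hWo : IsOpen W := isOpen_iUnion fun w => isOpen_cell w.1
  have hQW : Disjoint (unitCell N) W := by
    rw [← cell_one_zero]
    exact disjoint_iUnion_right.2 fun w => disjoint_cell one_pos w.2.symm
  have hψT : IsC1TestFunction (unitCell N ∪ W) fun y => ψ (T y) := by
    refine ⟨hψ.contDiff.comp (contDiff_cellMap hε.ne' z), hψ.compact.comp_homeomorph T, ?_⟩
    have : tsupport (fun y => ψ (T y)) = T ⁻¹' tsupport ψ := tsupport_comp_eq_preimage ψ T
    rw [this]
    intro y hy
    have hy' := hψ.support_subset hy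
    rw [← iUnion_cell hε, mem_iUnion] at hy'
    obtain ⟨w, hw'⟩ := hy'
    have h1 : y ∈ cell 1 (w - z) := by
      rw [← cellMap_mem_cell hε z, add_sub_cancel]; exact hw'
    by_cases h0 : w - z = 0
    · left; rwa [h0, cell_one_zero] at h1
    · right; exact mem_iUnion.2 ⟨⟨_, h0⟩, h1⟩
  have hind := hψT.indicator isOpen_unitCell hWo hQW
  have e := hind.integral_eq_of_test isOpen_unitCell hF hf hw
  have e1 : ∫ y in unitCell N, ε * ∑ i, oscillate ε (F i) (T y) * partialDeriv i ψ (T y) =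
      ∫ y in unitCell N, ∑ i, F i y *
        partialDeriv i ((unitCell N).indicator fun y => ψ (T y)) y := by
    refine setIntegral_congr_fun isOpen_unitCell.measurableSet fun y hy => ?_
    have h1 : (unitCell N).indicator (fun y => ψ (T y)) =ᶠ[𝓝 y] fun y => ψ (T y) := by
      filter_upwards [isOpen_unitCell.mem_nhds hy] with y' hy' using indicator_of_mem hy' _
    simp only [Finset.mul_sum]
    refine Finset.sum_congr rfl fun i _ => ?_
    have h2 := partialDeriv_comp_cellMap hε.ne' z hψ.contDiff i y
    have h3 : partialDeriv i ((unitCell N).indicator fun y => ψ (T y)) y =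
        ε * partialDeriv i ψ (T y) := by
      rw [← h2, partialDeriv, h1.fderiv_eq]; rfl
    rw [h3, oscillate_cellMap hε _ z hy]; ring
  have e2 : ∫ y in unitCell N, oscillate ε f (T y) * ψ (T y) =
      ∫ y in unitCell N, f y * (unitCell N).indicator (fun y => ψ (T y)) y :=
    setIntegral_congr_fun isOpen_unitCell.measurableSet fun y hy => by
      simp only [indicator_of_mem hy, T, oscillate_cellMap hε _ z hy]
  exact e1.trans (e.trans e2.symm)

theorem eq_add_latticeVec {α : Type*} {k : Space N → α} (hk : ∀ i y, k (y + unitVec i) = k y)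
    (z : Fin N → ℤ) (y : Space N) : k (y + latticeVec z) = k y := by
  have h1 : ∀ i (n : ℤ) y, k (y + (n : ℝ) • unitVec i) = k y := by
    intro i n
    induction n using Int.induction_on with
    | zero => simp
    | succ n ih =>
      intro y
      have := ih (y + unitVec i)
      rw [hk] at this
      rw [← this]; congr 1; push_cast; module
    | pred n ih =>
      intro y
      rw [← hk i (y + _)]
      have := ih y
      rw [← this]; congr 1; push_cast; module
  have h2 : ∀ s : Finset (Fin N), ∀ y, k (y + ∑ i ∈ s, (z i : ℝ) • unitVec i) = k y := by
    intro s
    induction s using Finset.induction_on with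
    | empty => simp
    | insert i s hi ih =>
      intro y
      rw [Finset.sum_insert hi, ← add_assoc, ih, h1]
  rw [← h2 Finset.univ y]
  congr 2
  ext i
  simp [latticeVec, unitVec, Pi.single_apply]

/-- A periodic function is the periodic extension of its restriction to the half-open unit cell. -/
theorem eq_fracPart {α : Type*} {k : Space N → α} (hk : ∀ i y, k (y + unitVec i) = k y)
    (y : Space N) : k (fracPart y) = k y := by
  rw [← eq_add_latticeVec hk (fun i => ⌊y i⌋) (fracPart y)]
  congr 1
  ext i
  simp [latticeVec, fracPart, Int.fract_add_floor]

end Periodic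

/-! ### The truncated expansion -/

section Truncation

variable {U B : Set (Space N)}

/-- The constant does not depend on `ε`, since `b(x / ε)` is bounded in `L²(B)`. -/
theorem exists_abs_integral_oscillate_le (hB : IsCompact B) {a b : Space N → ℝ}
    (hb : MemLp b 2 (volume.restrict (unitCell N))) (ha : ContinuousOn a B) :
    ∃ C : ℝ, 0 ≤ C ∧ ∀ ε : ℝ, 0 < ε → ε ≤ 1 → ∀ θ : Space N → ℝ, Continuous θ →
      HasCompactSupport θ → tsupport θ ⊆ B →
        |∫ x, oscillate ε b x * a x * θ x| ≤ C * Real.sqrt (∫ x, θ x ^ 2) := by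
  obtain ⟨K, hK0, hK⟩ := exists_eLpNorm_oscillate_le hB hb
  obtain ⟨A, hA⟩ := hB.exists_bound_of_continuousOn ha
  refine ⟨K * |A|, by positivity, fun ε hε hε1 θ hθ hc hs => ?_⟩
  obtain ⟨hm, hle⟩ := hK ε hε hε1
  have hθ2 : MemLp θ 2 := hθ.memLp_of_hasCompactSupport hc
  have hA' : ∀ᵐ x ∂volume.restrict B, ‖a x‖ ≤ |A| :=
    (ae_restrict_iff' hB.measurableSet).2 (Eventually.of_forall fun x hx =>
      (hA x hx).trans (le_abs_self A))
  have haθ : MemLp (fun x => a x * θ x) 2 (volume.restrict B) :=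
    (hθ2.restrict B).mul_bdd (ha.aestronglyMeasurable hB.measurableSet) hA'
  have hsq : ∫ x in B, (a x * θ x) ^ 2 ≤ |A| ^ 2 * ∫ x, θ x ^ 2 := by
    rw [← integral_const_mul]
    have i1 : Integrable fun x => |A| ^ 2 * θ x ^ 2 := hθ2.integrable_sq.const_mul _
    refine (integral_mono_ae haθ.integrable_sq i1.integrableOn ?_).trans
      (setIntegral_le_integral i1 (Eventually.of_forall fun x => by positivity))
    filter_upwards [hA'] with x hx
    rw [mul_pow]
    have : a x ^ 2 ≤ |A| ^ 2 := sq_le_sq' (by linarith [neg_abs_le (a x), Real.norm_eq_abs (a x)])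
      ((le_abs_self _).trans hx)
    exact mul_le_mul_of_nonneg_right this (sq_nonneg _)
  have e : ∫ x, oscillate ε b x * a x * θ x = ∫ x in B, oscillate ε b x * (a x * θ x) := by
    rw [← setIntegral_eq_of_tsupport hs]
    simp_rw [mul_assoc]
  rw [e]
  refine (abs_integral_mul_le hm haθ).trans ?_
  have h1 : Real.sqrt (∫ x in B, (a x * θ x) ^ 2) ≤ |A| * Real.sqrt (∫ x, θ x ^ 2) := by
    refine (Real.sqrt_le_sqrt hsq).trans ?_
    rw [Real.sqrt_mul (by positivity), Real.sqrt_sq (abs_nonneg A)]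
  calc _ ≤ K * (|A| * Real.sqrt (∫ x, θ x ^ 2)) :=
        mul_le_mul hle h1 (Real.sqrt_nonneg _) hK0
    _ = _ := by ring

theorem sqrt_integral_partialDeriv_sq_le {φ : Space N → ℝ} (hφ : IsC1TestFunction univ φ)
    (i : Fin N) : Real.sqrt (∫ x, partialDeriv i φ x ^ 2) ≤
      Real.sqrt (∫ x, ‖fderiv ℝ φ x‖ ^ 2) := by
  have hc : Continuous (fderiv ℝ φ) := hφ.contDiff.continuous_fderiv (by simp)
  have hs : HasCompactSupport (fderiv ℝ φ) := hφ.compact.fderiv ℝ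
  refine Real.sqrt_le_sqrt (integral_mono ?_ ?_ fun x => ?_)
  · exact (hφ.memLp_fderiv (unitVec i)).integrable_sq
  · have hs2 : HasCompactSupport fun x => ‖fderiv ℝ φ x‖ ^ 2 :=
      hs.comp_left (g := fun L : Space N →L[ℝ] ℝ => ‖L‖ ^ 2) (by simp)
    exact (hc.norm.pow 2).integrable_of_hasCompactSupport hs2
  · have h1 : |partialDeriv i φ x| ≤ ‖fderiv ℝ φ x‖ := by
      have := (fderiv ℝ φ x).le_opNorm (unitVec i)
      simpa [partialDeriv, unitVec] using this
    change partialDeriv i φ x ^ 2 ≤ ‖fderiv ℝ φ x‖ ^ 2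
    rw [← sq_abs]
    exact pow_le_pow_left₀ (abs_nonneg _) h1 2

variable {k : Space N → Matrix (Fin N) (Fin N) ℝ} {γ₀ γ₁ : ℝ} {M1 : Fin N → Space N → ℝ}
  {dM1 : Fin N → Space N → Fin N → ℝ} {M2 : Fin N → Fin N → Space N → ℝ}
  {dM2 : Fin N → Fin N → Space N → Fin N → ℝ}

/-- The gradient of the truncated expansion, in terms of the classical derivatives `t1`, `t2`, `t3`
of `T0`: the product rule, with the factors `ε⁻¹` from differentiating `M(x / ε)` not yet cancelled.
-/
noncomputable def sotsGrad (ε : ℝ) (M1 : Fin N → Space N → ℝ) (dM1 : Fin N → Space N → Fin N → ℝ)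
    (M2 : Fin N → Fin N → Space N → ℝ) (dM2 : Fin N → Fin N → Space N → Fin N → ℝ)
    (t1 : Fin N → Space N → ℝ) (t2 : Fin N → Fin N → Space N → ℝ)
    (t3 : Fin N → Fin N → Fin N → Space N → ℝ) (x : Space N) (j : Fin N) : ℝ :=
  t1 j x +
    (∑ α, ε * (ε⁻¹ * (oscillate ε (fun y => dM1 α y j) x * t1 α x) +
      oscillate ε (M1 α) x * t2 α j x)) +
    ∑ α, ∑ β, ε ^ 2 * (ε⁻¹ * (oscillate ε (fun y => dM2 α β y j) x * t2 α β x) +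
      oscillate ε (M2 α β) x * t3 α β j x)

theorem hasWeakGrad_sots (hU : IsOpen U) (hM1 : ∀ α, MemH10 (unitCell N) (M1 α) (dM1 α))
    (hM2 : ∀ α β, MemH10 (unitCell N) (M2 α β) (dM2 α β))
    {T0 : Space N → ℝ} {dT0 : Space N → Fin N → ℝ} {d2 : Space N → Fin N → Fin N → ℝ}
    {t1 : Fin N → Space N → ℝ} {t2 : Fin N → Fin N → Space N → ℝ}
    {t3 : Fin N → Fin N → Fin N → Space N → ℝ}
    (c0 : ContDiffOn ℝ 1 T0 U) (c1 : ∀ α, ContDiffOn ℝ 1 (t1 α) U)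
    (c2 : ∀ α β, ContDiffOn ℝ 1 (t2 α β) U) (ht1 : ∀ α, t1 α = partialDeriv α T0)
    (ht2 : ∀ α β, t2 α β = partialDeriv β (t1 α))
    (ht3 : ∀ α β j, t3 α β j = partialDeriv j (t2 α β))
    (e1 : ∀ α, (fun x => dT0 x α) =ᵐ[volume.restrict U] t1 α)
    (e2 : ∀ α β, (fun x => d2 x α β) =ᵐ[volume.restrict U] t2 α β) {ε : ℝ} (hε : 0 < ε)
    (hε1 : ε ≤ 1) :
    HasWeakGrad U (sots ε M1 M2 T0 dT0 d2) (sotsGrad ε M1 dM1 M2 dM2 t1 t2 t3) := by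
  intro j
  have w0 : HasWeakDeriv U (unitVec j) T0 (t1 j) := by
    rw [ht1]; exact .of_contDiffOn hU c0 _
  have w1 : ∀ α, HasWeakDeriv U (unitVec j) (fun x => oscillate ε (M1 α) x * t1 α x)
      (fun x => ε⁻¹ * (oscillate ε (fun y => dM1 α y j) x * t1 α x) +
        oscillate ε (M1 α) x * t2 α j x) := fun α => by
    rw [ht2]; exact (hM1 α).hasWeakDeriv_oscillate_mul hU hε hε1 (c1 α) j
  have w2 : ∀ α β, HasWeakDeriv U (unitVec j) (fun x => oscillate ε (M2 α β) x * t2 α β x)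
      (fun x => ε⁻¹ * (oscillate ε (fun y => dM2 α β y j) x * t2 α β x) +
        oscillate ε (M2 α β) x * t3 α β j x) := fun α β => by
    rw [ht3]; exact (hM2 α β).hasWeakDeriv_oscillate_mul hU hε hε1 (c2 α β) j
  refine ((w0.add (.sum Finset.univ fun α _ => (w1 α).const_mul ε)).add
    (.sum Finset.univ fun α _ => .sum Finset.univ fun β _ => (w2 α β).const_mul (ε ^ 2))).congr
      ?_ (ae_eq_refl _)
  filter_upwards [ae_all_iff.2 e1, ae_all_iff.2 fun α => ae_all_iff.2 (e2 α)] with x h1 h2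
  simp only [sots, firstOrderTerm, secondOrderTerm, oscillate, Finset.mul_sum, h1, h2]

/-- The flux of the truncated expansion, ordered by powers of `ε`. -/
theorem sum_mul_sotsGrad (hper : ∀ i y, k (y + unitVec i) = k y) {ε : ℝ} (hε : 0 < ε)
    (t1 : Fin N → Space N → ℝ) (t2 : Fin N → Fin N → Space N → ℝ)
    (t3 : Fin N → Fin N → Fin N → Space N → ℝ) (x : Space N) (i : Fin N) :
    ∑ j, k (ε⁻¹ • x) i j * sotsGrad ε M1 dM1 M2 dM2 t1 t2 t3 x j =
      (∑ α, oscillate ε (firstFlux k dM1 i α) x * t1 α x) +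
      ε * (∑ α, ∑ β, oscillate ε (secondFlux k M1 dM2 i α β) x * t2 α β x) +
      ε ^ 2 * ∑ j, ∑ α, ∑ β, oscillate ε (fun y => k y i j * M2 α β y) x * t3 α β j x := by
  rw [← eq_fracPart hper]
  simp only [oscillate]
  set y := fracPart (ε⁻¹ • x)
  have e : ∀ j, sotsGrad ε M1 dM1 M2 dM2 t1 t2 t3 x j =
      (t1 j x + ∑ α, dM1 α y j * t1 α x) +
      ε * ((∑ α, M1 α y * t2 α j x) + ∑ α, ∑ β, dM2 α β y j * t2 α β x) +
      ε ^ 2 * ∑ α, ∑ β, M2 α β y * t3 α β j x := by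
    intro j
    have h1 : ∀ u v : ℝ, ε * (ε⁻¹ * u + v) = u + ε * v := fun u v => by field_simp
    have h2 : ∀ u v : ℝ, ε ^ 2 * (ε⁻¹ * u + v) = ε * u + ε ^ 2 * v := fun u v => by field_simp
    simp only [sotsGrad, oscillate, h1, h2, Finset.sum_add_distrib, ← Finset.mul_sum]
    change _ + (∑ α, dM1 α y j * t1 α x + ε * ∑ α, M1 α y * t2 α j x) +
      (ε * ∑ α, ∑ β, dM2 α β y j * t2 α β x + ε ^ 2 * ∑ α, ∑ β, M2 α β y * t3 α β j x) = _
    ring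
  simp_rw [e, mul_add, Finset.sum_add_distrib]
  have h3 : ∀ c : ℝ, ∀ v : Fin N → ℝ, ∑ j, k y i j * (c * v j) = c * ∑ j, k y i j * v j :=
    fun c v => by rw [Finset.mul_sum]; exact Finset.sum_congr rfl fun j _ => by ring
  have f1 := sum_firstFlux (k := k) dM1 (fun α => t1 α x) y i
  have f2 := sum_secondFlux (k := k) M1 dM2 (fun α β => t2 α β x) y i
  simp_rw [mul_add, Finset.sum_add_distrib] at f1 f2
  simp_rw [h3, f1]
  rw [add_assoc (∑ α, _), ← mul_add, f2]
  simp only [Finset.mul_sum, mul_comm, mul_left_comm]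
  exact (add_assoc _ _ _).symm

end Truncation

section Residual

variable {U B : Set (Space N)} {k : Space N → Matrix (Fin N) (Fin N) ℝ} {γ₀ γ₁ : ℝ}
  {M1 : Fin N → Space N → ℝ} {dM1 : Fin N → Space N → Fin N → ℝ}
  {M2 : Fin N → Fin N → Space N → ℝ} {dM2 : Fin N → Fin N → Space N → Fin N → ℝ}

/-- Inside the cells, the residual of the truncated expansion in the heat equation is
`-ε² ∂ᵢ(k_ij M_αβ ∂³_αβj T0) - ε W_iαβ ∂³_αβi T0`. -/
theorem integral_sotsGrad_sub_eq (hU : IsOpen U) (h₀ : 0 ≤ γ₀)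
    (hk : IsElliptic (unitCell N) k γ₀ γ₁) (hper : ∀ i y, k (y + unitVec i) = k y)
    (hM1 : ∀ α, IsFirstCellSolution k α (M1 α) (dM1 α))
    (hM2 : ∀ α β, IsSecondCellSolution k M1 dM1 α β (M2 α β) (dM2 α β))
    {h : Space N → ℝ} {t1 : Fin N → Space N → ℝ} {t2 : Fin N → Fin N → Space N → ℝ}
    {t3 : Fin N → Fin N → Fin N → Space N → ℝ} (c1 : ∀ α, ContDiffOn ℝ 1 (t1 α) U)
    (c2 : ∀ α β, ContDiffOn ℝ 1 (t2 α β) U) (c3 : ∀ α β j, ContinuousOn (t3 α β j) U)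
    (ht2 : ∀ α β, t2 α β = partialDeriv β (t1 α))
    (ht3 : ∀ α β j, t3 α β j = partialDeriv j (t2 α β))
    (hsymm : ∀ α β, t2 α β =ᵐ[volume.restrict U] t2 β α)
    (heq : ∀ φ, IsTestFunction U φ →
      ∫ x in U, ∑ i, ∑ j, homogenized k dM1 i j * t1 j x * partialDeriv i φ x =
        ∫ x in U, h x * φ x)
    {ε : ℝ} (hε : 0 < ε) (hε1 : ε ≤ 1) {φ : Space N → ℝ}
    (hφ : IsTestFunction (U ∩ openCells N ε) φ) :
    (∫ x in U, ∑ i, ∑ j, k (ε⁻¹ • x) i j * sotsGrad ε M1 dM1 M2 dM2 t1 t2 t3 x j *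
        partialDeriv i φ x) - ∫ x in U, h x * φ x =
      ε ^ 2 * (∑ i, ∑ j, ∑ α, ∑ β,
        ∫ x, oscillate ε (fun y => k y i j * M2 α β y) x * t3 α β j x * partialDeriv i φ x) -
      ε * ∑ α, ∑ β, ∑ i,
        ∫ x, oscillate ε (secondFlux k M1 dM2 i α β) x * t3 α β i x * φ x := by
  have hφU := hφ.mono inter_subset_left
  have hP : ∀ i α, MemLp (firstFlux k dM1 i α) 2 (volume.restrict (unitCell N)) := fun i α =>
    memLp_firstFlux h₀ hk (fun α => (hM1 α).1.memLp_grad) i α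
  have hW : ∀ i α β, MemLp (secondFlux k M1 dM2 i α β) 2 (volume.restrict (unitCell N)) :=
    fun i α β => memLp_secondFlux h₀ hk (fun α => (hM1 α).1.memLp)
      (fun α β => (hM2 α β).1.memLp_grad) i α β
  have hkM : ∀ i j α β, MemLp (fun y => k y i j * M2 α β y) 2 (volume.restrict (unitCell N)) :=
    fun i j α β => hk.memLp_mul h₀ (hM2 α β).1.memLp i j
  have hd := fun i => hφU.fderiv_apply (unitVec i)
  have I0 : ∀ {a b : Space N → ℝ}, MemLp b 2 (volume.restrict (unitCell N)) → ContinuousOn a U →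
      Integrable fun x => oscillate ε b x * a x * φ x := fun hb ha =>
    integrable_oscillate_mul hU hε hε1 hb ha hφU.toC1.continuous hφU.compact hφU.support_subset
  have I1 : ∀ {a b : Space N → ℝ} (i : Fin N), MemLp b 2 (volume.restrict (unitCell N)) →
      ContinuousOn a U → Integrable fun x => oscillate ε b x * a x * partialDeriv i φ x :=
    fun i hb ha => integrable_oscillate_mul hU hε hε1 hb ha (hd i).toC1.continuous
      (hd i).compact (hd i).support_subset
  have ca1 := fun α => (c1 α).continuousOn
  have ca2 := fun α β => (c2 α β).continuousOn
  -- `a φ` is an admissible test function in the cells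
  have hcell : ∀ {a : Space N → ℝ}, ContDiffOn ℝ 1 a U →
      IsC1TestFunction (openCells N ε) fun x => a x * φ x := fun ha =>
    have h1 := hφU.toC1.mul_contDiffOn hU ha
    ⟨h1.contDiff, h1.compact, tsupport_mul_subset_right.trans
      (hφ.support_subset.trans inter_subset_right)⟩
  have hprod : ∀ {a : Space N → ℝ}, ContDiffOn ℝ 1 a U → ∀ i x,
      partialDeriv i (fun x => a x * φ x) x =
        a x * partialDeriv i φ x + partialDeriv i a x * φ x := fun ha i x =>
    fderiv_mul_test hU ha hφU.toC1 x _
  -- the first-order cell problem, tested with `∂_αT0 φ`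
  have r1 : ∀ α, ∑ i, ∫ x, oscillate ε (firstFlux k dM1 i α) x * t1 α x * partialDeriv i φ x =
      -∑ i, ∫ x, oscillate ε (firstFlux k dM1 i α) x * t2 α i x * φ x := by
    intro α
    have e := oscillate_integral_eq_of_test (f := fun _ => 0) (fun i => hP i α) MemLp.zero
      (fun ψ hψ => by simpa using (hM1 α).integral_firstFlux h₀ hk hψ) hε hε1 (hcell (c1 α))
    have e' : ∑ i, ∫ x, oscillate ε (firstFlux k dM1 i α) x *
        partialDeriv i (fun x => t1 α x * φ x) x = 0 := by
      refine (mul_eq_zero.1 (e.trans ?_)).resolve_left hε.ne'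
      simp [oscillate]
    rw [eq_neg_iff_add_eq_zero, ← Finset.sum_add_distrib, ← e']
    refine Finset.sum_congr rfl fun i _ => ?_
    rw [← integral_add (I1 i (hP i α) (ca1 α)) (I0 (hP i α) (ca2 α i))]
    congr 1; ext x
    rw [hprod (c1 α), ht2]; ring
  -- the second-order cell problem, tested with `∂²_αβ T0 φ`
  have r2 : ∀ α β, ε * ∑ i, ∫ x, oscillate ε (secondFlux k M1 dM2 i α β) x * t2 α β x *
      partialDeriv i φ x = (∫ x, oscillate ε (firstFlux k dM1 α β) x * t2 α β x * φ x) -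
        homogenized k dM1 α β * (∫ x, t2 α β x * φ x) -
        ε * ∑ i, ∫ x, oscillate ε (secondFlux k M1 dM2 i α β) x * t3 α β i x * φ x := by
    intro α β
    have e := oscillate_integral_eq_of_test
      (f := fun y => firstFlux k dM1 α β y - homogenized k dM1 α β) (fun i => hW i α β)
      ((hP α β).sub (memLp_const _))
      (fun ψ hψ => (hM2 α β).integral_secondFlux h₀ hk (hM1 α).1.memLp hψ) hε hε1
      (hcell (c2 α β))
    have i3 : Integrable fun x => t2 α β x * φ x :=
      integrable_mul_of_locallyIntegrableOn ((ca2 α β).locallyIntegrableOn hU.measurableSet)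
        hφU.toC1.continuous hφU.compact hφU.support_subset
    have e1 : ∫ x, oscillate ε (fun y => firstFlux k dM1 α β y - homogenized k dM1 α β) x *
        (t2 α β x * φ x) = (∫ x, oscillate ε (firstFlux k dM1 α β) x * t2 α β x * φ x) -
          homogenized k dM1 α β * ∫ x, t2 α β x * φ x := by
      rw [← integral_const_mul, ← integral_sub (I0 (hP α β) (ca2 α β)) (i3.const_mul _)]
      congr 1; ext x
      simp only [oscillate]; ring
    rw [← e1, ← e, ← mul_sub, ← Finset.sum_sub_distrib]
    congr 1
    refine Finset.sum_congr rfl fun i _ => ?_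
    rw [← integral_sub]
    · congr 1; ext x
      rw [hprod (c2 α β), ht3]; ring
    · have := (I1 i (hW i α β) (ca2 α β)).add (I0 (hW i α β) (c3 α β i))
      refine this.congr (Eventually.of_forall fun x => ?_)
      simp only [Pi.add_apply, hprod (c2 α β), ht3]; ring
    · exact I0 (hW i α β) (c3 α β i)
  have r3 : ∀ α β, ∫ x, t2 α β x * φ x = -∫ x, t1 α x * partialDeriv β φ x := fun α β => by
    have := integral_mul_fderiv_of_contDiffOn (μ := volume) hU (c1 α) hφU.toC1 (unitVec β)
    rw [ht2]; unfold partialDeriv; linarith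
  -- the homogenized equation
  have r4 : ∑ i, ∑ j, homogenized k dM1 i j * ∫ x, t1 j x * partialDeriv i φ x =
      ∫ x, h x * φ x := by
    have lF : ∀ i, LocallyIntegrableOn (fun x => ∑ j, homogenized k dM1 i j * t1 j x) U :=
      fun i => locallyIntegrableOn_finsetSum _ fun j _ =>
        ((ca1 j).locallyIntegrableOn hU.measurableSet).smul (homogenized k dM1 i j)
    have e := sum_integral_eq_of_setIntegral_eq (f := h) lF hφU.toC1
      (by simp_rw [Finset.sum_mul]; exact heq φ hφU)
    rw [← e]
    refine Finset.sum_congr rfl fun i _ => ?_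
    simp_rw [← integral_const_mul]
    rw [← integral_finsetSum _ fun j _ => ?_]
    · congr 1; ext x
      rw [Finset.sum_mul]
      exact Finset.sum_congr rfl fun j _ => by rw [partialDeriv]; ring
    · exact (integrable_mul_of_locallyIntegrableOn
        ((ca1 j).locallyIntegrableOn hU.measurableSet) (hd i).toC1.continuous (hd i).compact
        (hd i).support_subset).const_mul _
  -- symmetry of the second derivatives
  have r5 : ∑ α, ∑ i, ∫ x, oscillate ε (firstFlux k dM1 i α) x * t2 α i x * φ x =
      ∑ α, ∑ i, ∫ x, oscillate ε (firstFlux k dM1 α i) x * t2 α i x * φ x := by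
    rw [Finset.sum_comm]
    refine Finset.sum_congr rfl fun i _ => Finset.sum_congr rfl fun α _ => ?_
    refine integral_congr_ae ?_
    filter_upwards [(ae_restrict_iff' hU.measurableSet).1 (hsymm α i)] with x hx
    by_cases hxU : x ∈ U
    · rw [hx hxU]
    · simp [hφU.toC1.eq_zero hxU]
  have r6 : ∑ α, ∑ β, homogenized k dM1 α β * ∫ x, t1 α x * partialDeriv β φ x =
      ∫ x, h x * φ x := by
    rw [← r4, Finset.sum_comm]
    exact Finset.sum_congr rfl fun i _ => Finset.sum_congr rfl fun j _ => by
      rw [(homogenized_isSymm h₀ hk hM1).apply i j]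
  rw [setIntegral_eq_of_tsupport hφU.support_subset,
    setIntegral_eq_integral_of_forall_compl_eq_zero fun x hx => by
      simp [partialDeriv, hφU.toC1.fderiv_eq_zero hx]]
  have e : ∀ x, ∑ i, ∑ j, k (ε⁻¹ • x) i j * sotsGrad ε M1 dM1 M2 dM2 t1 t2 t3 x j *
      partialDeriv i φ x =
      (∑ α, ∑ i, oscillate ε (firstFlux k dM1 i α) x * t1 α x * partialDeriv i φ x) +
      ε * (∑ α, ∑ β, ∑ i, oscillate ε (secondFlux k M1 dM2 i α β) x * t2 α β x *
        partialDeriv i φ x) +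
      ε ^ 2 * ∑ i, ∑ j, ∑ α, ∑ β, oscillate ε (fun y => k y i j * M2 α β y) x * t3 α β j x *
        partialDeriv i φ x := fun x => by
    simp_rw [← Finset.sum_mul, sum_mul_sotsGrad hper hε, add_mul, Finset.sum_add_distrib,
      mul_assoc, ← Finset.mul_sum, Finset.sum_mul]
    congr 2
    · exact Finset.sum_comm.trans (by simp only [mul_assoc])
    · congr 1
      rw [Finset.sum_comm]
      refine Finset.sum_congr rfl fun α _ => ?_
      rw [Finset.sum_comm]
      simp only [mul_assoc]
  simp_rw [e]
  have j1 := fun α i => I1 i (hP i α) (ca1 α)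
  have j2 := fun α β i => I1 i (hW i α β) (ca2 α β)
  have j3 := fun i j α β => I1 i (hkM i j α β) (c3 α β j)
  have k1 := integrable_finsetSum Finset.univ fun α _ =>
    integrable_finsetSum Finset.univ fun i _ => j1 α i
  have k2 := integrable_finsetSum Finset.univ fun α _ => integrable_finsetSum Finset.univ fun β _ =>
    integrable_finsetSum Finset.univ fun i _ => j2 α β i
  have k3 := integrable_finsetSum Finset.univ fun i _ => integrable_finsetSum Finset.univ fun j _ =>
    integrable_finsetSum Finset.univ fun α _ => integrable_finsetSum Finset.univ fun β _ =>
      j3 i j α β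
  have k12 : Integrable fun x =>
      (∑ α, ∑ i, oscillate ε (firstFlux k dM1 i α) x * t1 α x * partialDeriv i φ x) +
      ε * ∑ α, ∑ β, ∑ i, oscillate ε (secondFlux k M1 dM2 i α β) x * t2 α β x *
        partialDeriv i φ x := k1.add (k2.const_mul ε)
  rw [integral_add k12 (k3.const_mul _), integral_add k1 (k2.const_mul ε),
    integral_const_mul, integral_const_mul]
  have m1 : ∫ x, ∑ α, ∑ i, oscillate ε (firstFlux k dM1 i α) x * t1 α x * partialDeriv i φ x =
      -∑ α, ∑ i, ∫ x, oscillate ε (firstFlux k dM1 α i) x * t2 α i x * φ x := by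
    rw [integral_finsetSum _ fun α _ => integrable_finsetSum _ fun i _ => j1 α i, ← r5,
      ← Finset.sum_neg_distrib]
    exact Finset.sum_congr rfl fun α _ => by
      rw [integral_finsetSum _ fun i _ => j1 α i, r1]
  have m2 : ε * ∫ x, ∑ α, ∑ β, ∑ i, oscillate ε (secondFlux k M1 dM2 i α β) x * t2 α β x *
      partialDeriv i φ x =
      (∑ α, ∑ β, ∫ x, oscillate ε (firstFlux k dM1 α β) x * t2 α β x * φ x) +
        (∫ x, h x * φ x) - ε * ∑ α, ∑ β, ∑ i,
          ∫ x, oscillate ε (secondFlux k M1 dM2 i α β) x * t3 α β i x * φ x := by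
    rw [integral_finsetSum _ fun α _ => integrable_finsetSum _ fun β _ =>
      integrable_finsetSum _ fun i _ => j2 α β i, ← r6]
    simp only [Finset.mul_sum, ← Finset.sum_add_distrib, ← Finset.sum_sub_distrib]
    refine Finset.sum_congr rfl fun α _ => ?_
    rw [integral_finsetSum _ fun β _ => integrable_finsetSum _ fun i _ => j2 α β i,
      Finset.mul_sum]
    refine Finset.sum_congr rfl fun β _ => ?_
    rw [integral_finsetSum _ fun i _ => j2 α β i, r2, r3, Finset.mul_sum]
    ring
  have m3 : ∫ x, ∑ i, ∑ j, ∑ α, ∑ β, oscillate ε (fun y => k y i j * M2 α β y) x * t3 α β j x *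
      partialDeriv i φ x = ∑ i, ∑ j, ∑ α, ∑ β,
        ∫ x, oscillate ε (fun y => k y i j * M2 α β y) x * t3 α β j x * partialDeriv i φ x := by
    rw [integral_finsetSum _ fun i _ => integrable_finsetSum _ fun j _ =>
      integrable_finsetSum _ fun α _ => integrable_finsetSum _ fun β _ => j3 i j α β]
    refine Finset.sum_congr rfl fun i _ => ?_
    rw [integral_finsetSum _ fun j _ => integrable_finsetSum _ fun α _ =>
      integrable_finsetSum _ fun β _ => j3 i j α β]
    refine Finset.sum_congr rfl fun j _ => ?_
    rw [integral_finsetSum _ fun α _ => integrable_finsetSum _ fun β _ => j3 i j α β]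
    refine Finset.sum_congr rfl fun α _ => ?_
    rw [integral_finsetSum _ fun β _ => j3 i j α β]
  rw [m1, m2, m3]
  ring

/-- The residual bound for one subdomain. For `T0 ∈ C³` the weak derivatives agree with the
classical ones, and the third derivatives are bounded on `B`. -/
theorem exists_truncation_bound (hU : IsOpen U) (h₀ : 0 ≤ γ₀)
    (hk : IsElliptic (unitCell N) k γ₀ γ₁) (hper : ∀ i y, k (y + unitVec i) = k y)
    (hM1 : ∀ α, IsFirstCellSolution k α (M1 α) (dM1 α))
    (hM2 : ∀ α β, IsSecondCellSolution k M1 dM1 α β (M2 α β) (dM2 α β))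
    {T0 h : Space N → ℝ} {dT0 : Space N → Fin N → ℝ} {d2 : Space N → Fin N → Fin N → ℝ}
    (hT : HasWeakGrad U T0 dT0) (hd2 : ∀ α, HasWeakGrad U (fun x => dT0 x α) fun x => d2 x α)
    (heq : ∀ φ, IsTestFunction U φ →
      ∫ x in U, ∑ i, ∑ j, homogenized k dM1 i j * dT0 x j * partialDeriv i φ x =
        ∫ x in U, h x * φ x)
    (hC : ContDiffOn ℝ 3 T0 U) (hB : IsCompact B) (hBU : B ⊆ U) :
    ∃ C : ℝ, ∀ ε : ℝ, 0 < ε → ε ≤ 1 → ∃ g : Space N → Fin N → ℝ,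
      HasWeakGrad U (sots ε M1 M2 T0 dT0 d2) g ∧
      ∀ φ, IsTestFunction (B ∩ openCells N ε) φ →
        |(∫ x in U, ∑ i, ∑ j, k (ε⁻¹ • x) i j * g x j * partialDeriv i φ x) -
          ∫ x in U, h x * φ x| ≤ C * ε * scaledNorm ε φ := by
  have hpd : ∀ {m n : WithTop ℕ∞} {u : Space N → ℝ} (i : Fin N), ContDiffOn ℝ n u U →
      m + 1 ≤ n → ContDiffOn ℝ m (partialDeriv i u) U := fun i hu hmn =>
    (hu.fderiv_of_isOpen hU hmn).clm_apply contDiffOn_const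
  let t1 : Fin N → Space N → ℝ := fun α => partialDeriv α T0
  let t2 : Fin N → Fin N → Space N → ℝ := fun α β => partialDeriv β (t1 α)
  let t3 : Fin N → Fin N → Fin N → Space N → ℝ := fun α β j => partialDeriv j (t2 α β)
  have c1' : ∀ α, ContDiffOn ℝ 2 (t1 α) U := fun α => hpd α hC (by norm_num)
  have c2 : ∀ α β, ContDiffOn ℝ 1 (t2 α β) U := fun α β => hpd β (c1' α) (by norm_num)
  have c3 : ∀ α β j, ContinuousOn (t3 α β j) U := fun α β j =>
    (hpd (m := 0) j (c2 α β) (by norm_num)).continuousOn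
  have c1 : ∀ α, ContDiffOn ℝ 1 (t1 α) U := fun α => (c1' α).of_le (by norm_num)
  have c0 : ContDiffOn ℝ 1 T0 U := hC.of_le (by norm_num)
  have w1 : ∀ α, HasWeakDeriv U (unitVec α) T0 (t1 α) := fun α => .of_contDiffOn hU c0 _
  have w2 : ∀ α β, HasWeakDeriv U (unitVec β) (t1 α) (t2 α β) := fun α β =>
    .of_contDiffOn hU (c1 α) _
  have e1 : ∀ α, (fun x => dT0 x α) =ᵐ[volume.restrict U] t1 α := fun α =>
    (hT α).unique hU (w1 α)
  have e2 : ∀ α β, (fun x => d2 x α β) =ᵐ[volume.restrict U] t2 α β := fun α β =>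
    ((hd2 α β).congr (e1 α) (ae_eq_refl _)).unique hU (w2 α β)
  have hsymm : ∀ α β, t2 α β =ᵐ[volume.restrict U] t2 β α := fun α β =>
    (w1 α).ae_eq_swap hU (w1 β) (w2 α β) (w2 β α)
  have heq' : ∀ φ, IsTestFunction U φ →
      ∫ x in U, ∑ i, ∑ j, homogenized k dM1 i j * t1 j x * partialDeriv i φ x =
        ∫ x in U, h x * φ x := fun φ hφ => by
    rw [← heq φ hφ]
    refine integral_congr_ae ?_
    filter_upwards [ae_all_iff.2 e1] with x hx
    simp only [hx]
  have hW : ∀ i α β, MemLp (secondFlux k M1 dM2 i α β) 2 (volume.restrict (unitCell N)) :=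
    fun i α β => memLp_secondFlux h₀ hk (fun α => (hM1 α).1.memLp)
      (fun α β => (hM2 α β).1.memLp_grad) i α β
  have hkM : ∀ i j α β, MemLp (fun y => k y i j * M2 α β y) 2 (volume.restrict (unitCell N)) :=
    fun i j α β => hk.memLp_mul h₀ (hM2 α β).1.memLp i j
  choose CW hCW0 hCW using fun α β i =>
    exists_abs_integral_oscillate_le hB (hW i α β) ((c3 α β i).mono hBU)
  choose CM hCM0 hCM using fun i j α β =>
    exists_abs_integral_oscillate_le hB (hkM i j α β) ((c3 α β j).mono hBU)
  let C₁ := ∑ α, ∑ β, ∑ i, CW α β i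
  let C₂ := ∑ i, ∑ j, ∑ α, ∑ β, CM i j α β
  have hC₁ : 0 ≤ C₁ := Finset.sum_nonneg fun α _ => Finset.sum_nonneg fun β _ =>
    Finset.sum_nonneg fun i _ => hCW0 α β i
  have hC₂ : 0 ≤ C₂ := Finset.sum_nonneg fun i _ => Finset.sum_nonneg fun j _ =>
    Finset.sum_nonneg fun α _ => Finset.sum_nonneg fun β _ => hCM0 i j α β
  refine ⟨C₁ + C₂, fun ε hε hε1 => ⟨sotsGrad ε M1 dM1 M2 dM2 t1 t2 t3,
    hasWeakGrad_sots hU (fun α => (hM1 α).1) (fun α β => (hM2 α β).1) c0 c1 c2 (fun _ => rfl)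
      (fun _ _ => rfl) (fun _ _ _ => rfl) e1 e2 hε hε1, fun φ hφ => ?_⟩⟩
  rw [integral_sotsGrad_sub_eq hU h₀ hk hper hM1 hM2 c1 c2 c3 (fun _ _ => rfl)
    (fun _ _ _ => rfl) hsymm heq' hε hε1 (hφ.mono (inter_subset_inter_left _ hBU))]
  have hφB := hφ.mono inter_subset_left
  set a := Real.sqrt (∫ x, φ x ^ 2)
  set b := Real.sqrt (∫ x, ‖fderiv ℝ φ x‖ ^ 2)
  have ha : 0 ≤ a := Real.sqrt_nonneg _
  have hb : 0 ≤ b := Real.sqrt_nonneg _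
  have b1 : |∑ α, ∑ β, ∑ i,
      ∫ x, oscillate ε (secondFlux k M1 dM2 i α β) x * t3 α β i x * φ x| ≤ C₁ * a := by
    simp only [C₁, Finset.sum_mul]
    refine (Finset.abs_sum_le_sum_abs _ _).trans (Finset.sum_le_sum fun α _ => ?_)
    refine (Finset.abs_sum_le_sum_abs _ _).trans (Finset.sum_le_sum fun β _ => ?_)
    refine (Finset.abs_sum_le_sum_abs _ _).trans (Finset.sum_le_sum fun i _ => ?_)
    exact hCW α β i ε hε hε1 φ hφB.toC1.continuous hφB.compact hφB.support_subset
  have b2 : |∑ i, ∑ j, ∑ α, ∑ β,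
      ∫ x, oscillate ε (fun y => k y i j * M2 α β y) x * t3 α β j x * partialDeriv i φ x| ≤
        C₂ * b := by
    simp only [C₂, Finset.sum_mul]
    refine (Finset.abs_sum_le_sum_abs _ _).trans (Finset.sum_le_sum fun i _ => ?_)
    refine (Finset.abs_sum_le_sum_abs _ _).trans (Finset.sum_le_sum fun j _ => ?_)
    refine (Finset.abs_sum_le_sum_abs _ _).trans (Finset.sum_le_sum fun α _ => ?_)
    refine (Finset.abs_sum_le_sum_abs _ _).trans (Finset.sum_le_sum fun β _ => ?_)
    have hd := hφB.partialDeriv i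
    refine (hCM i j α β ε hε hε1 _ hd.toC1.continuous hd.compact hd.support_subset).trans ?_
    exact mul_le_mul_of_nonneg_left
      (sqrt_integral_partialDeriv_sq_le (hφB.toC1.mono (subset_univ _)) i) (hCM0 i j α β)
  refine (abs_sub _ _).trans ?_
  rw [abs_mul, abs_mul, abs_of_pos hε, abs_of_pos (pow_pos hε 2)]
  have hs : scaledNorm ε φ = a + ε * b := rfl
  rw [hs]
  clear_value C₁ C₂ a b
  calc _ ≤ ε ^ 2 * (C₂ * b) + ε * (C₁ * a) :=
        add_le_add (mul_le_mul_of_nonneg_left b2 (by positivity))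
          (mul_le_mul_of_nonneg_left b1 hε.le)
    -- the added terms complete `(C₁ + C₂) ε (a + ε b)`
    _ ≤ ε ^ 2 * (C₂ * b) + ε * (C₁ * a) + (C₁ * ε ^ 2 * b + C₂ * ε * a) :=
        le_add_of_nonneg_right (by positivity)
    _ = _ := by ring

/-- Linearity of the oscillating flux, tested with `φ ∈ C_c^∞(U)`. -/
theorem integral_oscillating_flux_sub (h₀ : 0 ≤ γ₀) (hk : IsElliptic (unitCell N) k γ₀ γ₁)
    (hper : ∀ i y, k (y + unitVec i) = k y) {ε : ℝ} (hε : 0 < ε) {f g : Space N → Fin N → ℝ}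
    (hf : ∀ j, LocallyIntegrableOn (fun x => f x j) U)
    (hg : ∀ j, LocallyIntegrableOn (fun x => g x j) U) {φ : Space N → ℝ}
    (hφ : IsTestFunction U φ) :
    ∫ x in U, ∑ i, ∑ j, k (ε⁻¹ • x) i j * (f x j - g x j) * partialDeriv i φ x =
      (∫ x in U, ∑ i, ∑ j, k (ε⁻¹ • x) i j * f x j * partialDeriv i φ x) -
        ∫ x in U, ∑ i, ∑ j, k (ε⁻¹ • x) i j * g x j * partialDeriv i φ x := by
  have I : ∀ {f : Space N → Fin N → ℝ}, (∀ j, LocallyIntegrableOn (fun x => f x j) U) →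
      Integrable fun x => ∑ i, ∑ j, k (ε⁻¹ • x) i j * f x j * partialDeriv i φ x := by
    intro f hf
    refine integrable_finsetSum _ fun i _ => integrable_finsetSum _ fun j _ => ?_
    have hd := hφ.partialDeriv i
    have h1 := integrable_mul_of_locallyIntegrableOn (hf j) hd.toC1.continuous hd.compact
      hd.support_subset
    have hb : ∀ᵐ x : Space N, ‖k (ε⁻¹ • x) i j‖ ≤ γ₁ := by
      filter_upwards [(quasiMeasurePreserving_fracPart hε).ae (hk.abs_le h₀ i j)] with x hx
      rwa [eq_fracPart hper] at hx
    have hm : Measurable fun x : Space N => k (ε⁻¹ • x) i j :=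
      (hk.measurable i j).comp (measurable_const_smul _)
    simpa only [mul_assoc] using h1.bdd_mul hm.aestronglyMeasurable hb
  rw [← integral_sub (I hf).integrableOn (I hg).integrableOn]
  congr 1; ext x
  simp only [mul_sub, sub_mul, Finset.sum_sub_distrib]

end Residual

/-! ### The heat conduction problem -/

theorem theorem1 {N K : ℕ} (hN : N = 2 ∨ N = 3)
    -- the domain and its subdomains
    (Ω : Set (Space N)) (hΩ_open : IsOpen Ω) (hΩ_convex : Convex ℝ Ω)
    (hΩ_bounded : Bornology.IsBounded Ω) (hΩ_nonempty : Ω.Nonempty)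
    (Ωs : Fin K → Set (Space N)) (hΩs_open : ∀ s, IsOpen (Ωs s)) (hΩs_sub : ∀ s, Ωs s ⊆ Ω)
    (hΩs_disj : Pairwise (fun s r => Disjoint (Ωs s) (Ωs r)))
    (hΩs_cover : volume (Ω \ ⋃ s, Ωs s) = 0)
    -- the two parts of the boundary
    (ΓT Γq : Set (Space N)) (hΓ : frontier Ω = ΓT ∪ Γq)
    (hΓT : MeasurableSet ΓT) (hΓq : MeasurableSet Γq)
    -- the periodic conductivities
    (k : Fin K → Space N → Matrix (Fin N) (Fin N) ℝ)
    (hk_meas : ∀ s i j, Measurable (fun y => k s y i j))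
    (hk_per : ∀ s i y, k s (y + unitVec i) = k s y)
    (hk_symm : ∀ s, ∀ᵐ y, (k s y).IsSymm)
    (γ₀ γ₁ : ℝ) (hγ₀ : 0 < γ₀) (hγ : γ₀ ≤ γ₁)
    (hk_ell : ∀ s, ∀ᵐ y, ∀ ξ : Space N,
      γ₀ * ‖ξ‖ ^ 2 ≤ ∑ i, ∑ j, k s y i j * ξ i * ξ j ∧
      ∑ i, ∑ j, k s y i j * ξ i * ξ j ≤ γ₁ * ‖ξ‖ ^ 2)
    -- the data
    (h That q : Space N → ℝ) (hh : MemLp h 2 (volume.restrict Ω))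
    (hThat : MemLp That 2 ((surfaceMeasure N).restrict ΓT))
    (hq : MemLp q 2 ((surfaceMeasure N).restrict Γq)) :
    ∃ (M1 : Fin K → Fin N → Space N → ℝ) (dM1 : Fin K → Fin N → Space N → Fin N → ℝ)
      (M2 : Fin K → Fin N → Fin N → Space N → ℝ)
      (dM2 : Fin K → Fin N → Fin N → Space N → Fin N → ℝ),
      -- the first-order cell functions are the unique solutions of their cell problems
      (∀ s α, IsFirstCellSolution (k s) α (M1 s α) (dM1 s α) ∧
        ∀ u du, IsFirstCellSolution (k s) α u du →
          u =ᵐ[volume.restrict (unitCell N)] M1 s α ∧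
          du =ᵐ[volume.restrict (unitCell N)] dM1 s α) ∧
      -- the second-order cell functions are the unique solutions of their cell problems
      (∀ s α β, IsSecondCellSolution (k s) (M1 s) (dM1 s) α β (M2 s α β) (dM2 s α β) ∧
        ∀ u du, IsSecondCellSolution (k s) (M1 s) (dM1 s) α β u du →
          u =ᵐ[volume.restrict (unitCell N)] M2 s α β ∧
          du =ᵐ[volume.restrict (unitCell N)] dM2 s α β) ∧
      -- the homogenized coefficients are symmetric and elliptic with the same constants
      (∀ s, (homogenized (k s) (dM1 s)).IsSymm ∧ ∀ ξ : Space N,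
        γ₀ * ‖ξ‖ ^ 2 ≤ ∑ i, ∑ j, homogenized (k s) (dM1 s) i j * ξ i * ξ j ∧
        ∑ i, ∑ j, homogenized (k s) (dM1 s) i j * ξ i * ξ j ≤ γ₁ * ‖ξ‖ ^ 2) ∧
      -- the expansion, for the solution `T0` of the homogenized problem
      ∀ (T0 : Space N → ℝ) (dT0 : Space N → Fin N → ℝ),
        IsWeakSolution Ω ΓT Γq (piecewiseCoeff Ωs (fun s _ => homogenized (k s) (dM1 s)))
          h That q T0 dT0 →
        ∀ s, ∃ d2T0 : Space N → Fin N → Fin N → ℝ,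
          -- `T0` has second derivatives in `L²_loc` of the subdomain
          (∀ α, HasWeakGrad (Ωs s) (fun x => dT0 x α) (fun x => d2T0 x α)) ∧
          (∀ C : Set (Space N), IsCompact C → C ⊆ Ωs s → ∀ α β,
            MemLp (fun x => d2T0 x α β) 2 (volume.restrict C)) ∧
          -- the equations of orders `ε_s⁻²`, `ε_s⁻¹`, `ε_s⁰` hold
          IsFormalExpansion (Ωs s) (k s) h (fun p => T0 p.1)
            (firstOrderTerm (M1 s) dT0) (secondOrderTerm (M2 s) d2T0) ∧
          -- the truncated expansion solves the heat equation in the cells up to `O(ε_s)`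
          (ContDiffOn ℝ 3 T0 (Ωs s) →
            ∀ B : Set (Space N), IsCompact B → B ⊆ Ωs s → ∃ C : ℝ,
              ∀ ε : Fin K → ℝ, (∀ r, 0 < ε r) → ε s ≤ 1 →
                ∃ g : Space N → Fin N → ℝ,
                  HasWeakGrad (Ωs s) (sots (ε s) (M1 s) (M2 s) T0 dT0 d2T0) g ∧
                  ∀ φ : Space N → ℝ, IsTestFunction (B ∩ openCells N (ε s)) φ →
                    |(∫ x in Ωs s, ∑ i, ∑ j,
                        k s ((ε s)⁻¹ • x) i j * g x j * partialDeriv i φ x) -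
                      ∫ x in Ωs s, h x * φ x| ≤ C * ε s * scaledNorm (ε s) φ ∧
                    ∀ (Tε : Space N → ℝ) (dTε : Space N → Fin N → ℝ),
                      IsWeakSolution Ω ΓT Γq (oscillatingCoeff Ωs k ε) h That q Tε dTε →
                      |∫ x in Ωs s, ∑ i, ∑ j,
                        k s ((ε s)⁻¹ • x) i j * (dTε x j - g x j) * partialDeriv i φ x| ≤
                          C * ε s * scaledNorm (ε s) φ) := by
  have i₀ : Fin N := ⟨0, by omega⟩
  have hk : ∀ s, IsElliptic (unitCell N) (k s) γ₀ γ₁ := fun s =>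
    ⟨hk_meas s, ae_restrict_of_ae (hk_symm s), ae_restrict_of_ae (hk_ell s)⟩
  have hper : ∀ s i y, k s (y + unitVec i) = k s y := hk_per
  choose M1 dM1 hM1 using fun s α => exists_firstCellSolution i₀ hγ₀ (hk s) α
  choose M2 dM2 hM2 using fun s α β => exists_secondCellSolution i₀ hγ₀ (hk s) (hM1 s) α β
  refine ⟨M1, dM1, M2, dM2,
    fun s α => ⟨hM1 s α, fun u du hu => hu.unique i₀ hγ₀ (hk s) (hM1 s α)⟩,
    fun s α β => ⟨hM2 s α β, fun u du hu => hu.unique i₀ hγ₀ (hk s) (hM2 s α β)⟩,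
    fun s => ⟨homogenized_isSymm hγ₀.le (hk s) (hM1 s), fun ξ =>
      ⟨homogenized_ge hγ₀.le (hk s) (hM1 s) ξ, homogenized_le hγ₀.le (hk s) (hM1 s) ξ⟩⟩,
    fun T0 dT0 hT0 s => ?_⟩
  obtain ⟨t, ht, -⟩ := hT0.1
  have hsub := Measure.restrict_mono_set (volume : Measure (Space N)) (hΩs_sub s)
  have hw : HasWeakGrad (Ωs s) T0 dT0 := ht.hasWeakGrad hΩ_bounded (hΩs_sub s)
  have heq : ∀ φ, IsTestFunction (Ωs s) φ →
      ∫ x in Ωs s, ∑ i, ∑ j, homogenized (k s) (dM1 s) i j * dT0 x j * partialDeriv i φ x =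
        ∫ x in Ωs s, h x * φ x := fun φ hφ =>
    hT0.integral_eq_of_test hΩ_open hΩs_sub hΩs_disj s hφ
  have hhs : MemLp h 2 (volume.restrict (Ωs s)) := hh.mono_measure hsub
  obtain ⟨d2, hd2, hd2loc⟩ := exists_second_weakGrad (hΩs_open s) hγ₀
    (homogenized_ge hγ₀.le (hk s) (hM1 s)) (ht.memLp.mono_measure hsub)
    (fun i => (ht.memLp_grad i).mono_measure hsub) hhs hw heq
  refine ⟨d2, hd2, hd2loc, isFormalExpansion (hΩs_open s) hγ₀.le (hk s) (hM1 s) (hM2 s) hw hd2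
    (locallyIntegrableOn_of_memLp_two hhs) heq, fun hC B hB hBΩ => ?_⟩
  obtain ⟨C, hC⟩ := exists_truncation_bound (hΩs_open s) hγ₀.le (hk s) (hper s) (hM1 s) (hM2 s)
    hw hd2 heq hC hB hBΩ
  refine ⟨C, fun ε hε hε1 => ?_⟩
  obtain ⟨g, hg, hbound⟩ := hC (ε s) (hε s) hε1
  refine ⟨g, hg, fun φ hφ => ⟨hbound φ hφ, fun Tε dTε hTε => ?_⟩⟩
  have hφs : IsTestFunction (Ωs s) φ := hφ.mono (inter_subset_left.trans hBΩ)
  obtain ⟨t', ht', -⟩ := hTε.1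
  have hwε : HasWeakGrad (Ωs s) Tε dTε := ht'.hasWeakGrad hΩ_bounded (hΩs_sub s)
  have e := IsWeakSolution.integral_eq_of_test hΩ_open hΩs_sub hΩs_disj hTε s hφs
  rw [integral_oscillating_flux_sub hγ₀.le (hk s) (hper s) (hε s)
    (fun j => (hwε j).locallyIntegrable_deriv) (fun j => (hg j).locallyIntegrable_deriv) hφs, e,
    abs_sub_comm]
  exact hbound φ hφ
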